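/- **Simultaneous Substitution Lemma for the multi-level contextual modal $\lambda$-calculus.** *Syntax (up to renaming of bound variables; $n\in\mathbb N$ is a level).* - Types $T,S ::= \alpha[\sigma] \mid S\to T \mid (\alpha{:}(\Phi\vdash^n *))\to T \mid [\Phi\vdash^n T]$. - Terms $e ::= x[\sigma]\mid \mathrm{fn}\,x.e\mid e_1\,e_2\mid \Lambda\alpha^n.e\mid e\,(\hat\Phi^n.T)\mid \mathrm{box}(\hat\Phi^n.e)\mid \mathrm{let\ box}(\hat\Phi^n.u)=e_1\ \mathrm{in}\ e_2$. - Substitutions $\sigma ::= \cdot\mid \sigma,\hat\Phi^n.e\mid\sigma;x^n\mid\sigma,\hat\Phi^n.T\mid\sigma;\alpha^n$. - Contexts $\Gamma ::= \cdot\mid\Gamma,x{:}(\Psi\vdash^n T)\mid\Gamma,\alpha{:}(\Psi\vdash^n *)$. The context of a contextual kind $(\Psi\vdash^n *)$ contains only type variable declarations, hereditarily. Contexts are sorted: levels do not increase from left to right. $\hat\Gamma$ is $\Gamma$ without its types and kinds; $\mathrm{level}(\Phi)\le n$ means that all variables of $\Phi$ have level $<n$; $\Gamma\lfloor_n$ drops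 the declarations of level $<n$; $\Gamma,\Phi$ is the appended context, used only if the result is sorted; $\Gamma\oplus\Phi$ merges $\Phi$ into $\Gamma$ stably by level, the declarations of $\Gamma$ preceding those of $\Phi$ of the same level. *Substitution.* $[\sigma/\hat\Psi]$ assigns the entries of $\sigma$ to the variables of $\hat\Psi$ in order and leaves all other variables untouched. It is applied hereditarily: if $\alpha^n\in\hat\Psi$ is assigned $\hat\Phi^n.T$, then $[\sigma/\hat\Psi](\alpha[\sigma'])=[\,[\sigma/\hat\Psi]\sigma'/\hat\Phi]T$; if it is assigned a variable $\beta^n$, the result is $\beta[[\sigma/\hat\Psi]\sigma']$; likewise for $x[\sigma']$. A variable entry of a substitution is replaced by what is assigned to it. Under a binder the substitution is extended by the identity on the bound variable. Inside $\Phi\vdash^n T$ or $\hat\Phi^n.e$ or $\hat\Phi^n.T$ the entries of level below $n$ are dropped, and the substitution is extended by the identity on $\hat\Phi$; on $\Phi$ itself the substitution with the entries below $n$ dropped is applied. On contexts it acts from left to right, extended by the identity on the declarations already passed. The contexts of contextual kinds are unchanged. The single substitution $[(\hat\Phi^n.T)/\alpha^n]$ is the case of a one-element domain. Write $[\sigma/\hat\Psi]_n$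 for $[\sigma/\hat\Psi]$ with the entries below $n$ dropped and then extended by the identity on the local context in question. *Judgments.* $\vdash\Gamma$, $\Gamma\vdash T$, $\Gamma\vdash e:T$ and $\Gamma\vdash\sigma:\Psi$ are defined by simultaneous induction. Every judgment over $\Gamma$ presupposes $\vdash\Gamma$, and $\Gamma\vdash\sigma:\Psi$ presupposes that $\Psi$ is a sorted context with $\vdash\Gamma\oplus\Psi$; these presuppositions hold at every node of a derivation. Apart from them the rules are as follows. - $\vdash\cdot$. $\;\vdash\Gamma,x{:}(\Phi\vdash^n T)$ if $\vdash\Gamma$, the result is sorted, $\mathrm{level}(\Phi)\le n$, $\vdash\Gamma\lfloor_n,\Phi$ and $\Gamma\lfloor_n,\Phi\vdash T$. The same for $\alpha{:}(\Phi\vdash^n *)$, without the condition on $T$. - $\Gamma\vdash\alpha[\sigma]$ if $\Gamma(\alpha)=(\Phi\vdash^n *)$ and $\Gamma\vdash\sigma:\Phi$. $\;\Gamma\vdash S\to T$ if $\Gamma\vdash S$ and $\Gamma\vdash T$. $\;\Gamma\vdash(\alpha{:}(\Phi\vdash^n *))\to T$ if $\vdash\Gamma\lfloor_n,\Phi$ and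 $\Gamma\oplus\alpha{:}(\Phi\vdash^n *)\vdash T$. $\;\Gamma\vdash[\Phi\vdash^n T]$ if $n>0$, $\mathrm{level}(\Phi)\le n$, $\vdash\Gamma\lfloor_n,\Phi$ and $\Gamma\lfloor_n,\Phi\vdash T$. - $\Gamma\vdash x[\sigma]:[\sigma/\hat\Phi]T$ if $\Gamma(x)=(\Phi\vdash^n T)$ and $\Gamma\vdash\sigma:\Phi$. $\;\Gamma\vdash\mathrm{fn}\,x.e:S\to T$ if $\Gamma,x{:}(\cdot\vdash^0 S)\vdash e:T$. $\;\Gamma\vdash e_1\,e_2:T$ if $\Gamma\vdash e_1:S\to T$ and $\Gamma\vdash e_2:S$. $\;\Gamma\vdash\Lambda\alpha^n.e:(\alpha{:}(\Phi\vdash^n *))\to T$ if $\Gamma\oplus\alpha{:}(\Phi\vdash^n *)\vdash e:T$. $\;\Gamma\vdash e\,(\hat\Phi^n.T):[(\hat\Phi^n.T)/\alpha^n]S$ if $\Gamma\vdash e:(\alpha{:}(\Phi\vdash^n *))\to S$ and $\Gamma\lfloor_n,\Phi\vdash T$. $\;\Gamma\vdash\mathrm{box}(\hat\Phi^n.e):[\Phi\vdash^n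 T]$ if $n>0$, $\mathrm{level}(\Phi)\le n$ and $\Gamma\lfloor_n,\Phi\vdash e:T$. $\;\Gamma\vdash\mathrm{let\ box}(\hat\Phi^n.u)=e_1\ \mathrm{in}\ e_2:T$ if $n>0$, $\Gamma\vdash e_1:[\Phi\vdash^n S]$ and $\Gamma\oplus u{:}(\Phi\vdash^n S)\vdash e_2:T$. - $\Gamma\vdash\cdot:\cdot$. If $\Gamma\vdash\sigma:\Delta$, then: $\;\Gamma\vdash(\sigma,\hat\Psi^n.e):(\Delta,x{:}(\Psi\vdash^n T))$ if $\Gamma\lfloor_n,[\sigma/\hat\Delta]_n\Psi\vdash e:[\sigma/\hat\Delta]_nT$; $\;\Gamma\vdash(\sigma;y^n):(\Delta,x{:}(\Psi\vdash^n T))$ if $\Gamma(y)=([\sigma/\hat\Delta]_n\Psi\vdash^n[\sigma/\hat\Delta]_nT)$; $\;\Gamma\vdash(\sigma,\hat\Psi^n.T):(\Delta,\alpha{:}(\Psi\vdash^n *))$ if $\Gamma\lfloor_n,\Psi\vdash T$; $\;\Gamma\vdash(\sigma;\beta^n):(\Delta,\alpha{:}(\Psi\vdash^n *))$ if $\Gamma(\beta)=(\Psi\vdash^n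 *)$. **Statement.** Let $\Gamma_1,\Phi,\Gamma_0$ be contexts and $\sigma$ a substitution with $\Gamma_1,\Phi\vdash\sigma:\Gamma_0$, where $\Gamma_0$ is a context extending $\Gamma_1$. 1. If $\vdash\Gamma_1,\Gamma_0,\Psi$, and every variable of $\Phi$ has level at least that of every variable of $\Psi$ (so that $\Gamma_1,\Phi,\Psi$ is sorted), then $\vdash\Gamma_1,\Phi,[\sigma/\hat\Gamma_0]\Psi$. 2. If $\Gamma_1,\Gamma_0\vdash S$, then $\Gamma_1,\Phi\vdash[\sigma/\hat\Gamma_0]S$. 3. If $\Gamma_1,\Gamma_0\vdash e:S$, then $\Gamma_1,\Phi\vdash[\sigma/\hat\Gamma_0]e:[\sigma/\hat\Gamma_0]S$. 4. If $\Gamma_1,\Gamma_0\vdash\sigma_2:\Psi$, then $\Gamma_1,\Phi\vdash[\sigma/\hat\Gamma_0]\sigma_2:[\sigma/\hat\Gamma_0]\Psi$. -/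

import Mathlib

namespace Moebius

/-! ## Syntax

Types, terms, substitutions and contexts of the multi-level contextual calculus, up to renaming of
bound variables.  A variable is named by its sort (type or term variable), its level `n`, and a de
Bruijn index `i`: it is the `i`-th declaration, counted from the right, among the declarations of
the same sort and the same level in the context.  Thus inserting a declaration at its place in a
sorted context only renumbers the variables of its own sort and level, and replacing the part of a
context below level `n` by a local context leaves the variables of level at least `n` untouched. -/

/-- The two sorts of variables. -/
inductive VarSort where
  | ty
  | tm
deriving DecidableEq

/-- Erased contexts: sort and level of each declaration. The head of the list is the rightmost
(most recent) declaration. -/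
abbrev ECtx := List (VarSort × ℕ)

/-- Contexts that consist of type variable declarations `α : (Ψ ⊢ⁿ *)` only, hereditarily. These
are the contexts that may occur in a contextual kind. They have no free variables. -/
inductive KCtx where
  | nil
  | snoc (Φ : KCtx) (Ψ : KCtx) (n : ℕ)

mutual
/-- Types: `α[σ]`, `S → T`, `(α : (Φ ⊢ⁿ *)) → T`, and the boxed contextual type `[Φ ⊢ⁿ T]`. -/
inductive Ty where
  | tvar (n i : ℕ) (σ : Subst)
  | arr (S T : Ty)
  | all (Φ : KCtx) (n : ℕ) (T : Ty)
  | box (Φ : Ctx) (n : ℕ) (T : Ty)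
/-- Terms: `x[σ]`, `fn x. e`, `e₁ e₂`, `Λ αⁿ. e`, `e (Φ̂ⁿ. T)`, `box (Φ̂ⁿ. e)` and
`let box (Φ̂ⁿ. u) = e₁ in e₂`. -/
inductive Tm where
  | var (n i : ℕ) (σ : Subst)
  | lam (e : Tm)
  | app (e₁ e₂ : Tm)
  | tlam (n : ℕ) (e : Tm)
  | tapp (e : Tm) (Φ : ECtx) (n : ℕ) (T : Ty)
  | box (Φ : ECtx) (n : ℕ) (e : Tm)
  | letbox (Φ : ECtx) (n : ℕ) (e₁ e₂ : Tm)
/-- Substitutions: `·`, `σ, Φ̂ⁿ. e`, `σ, Φ̂ⁿ. T`, and the extension `σ; xⁿ` or `σ; αⁿ` by a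
variable of sort `s` and level `n`. -/
inductive Subst where
  | nil
  | tm (σ : Subst) (Φ : ECtx) (n : ℕ) (e : Tm)
  | ty (σ : Subst) (Φ : ECtx) (n : ℕ) (T : Ty)
  | var (σ : Subst) (s : VarSort) (n i : ℕ)
/-- Declarations `α : (Ψ ⊢ⁿ *)` and `x : (Ψ ⊢ⁿ T)`. -/
inductive Decl where
  | ty (Ψ : KCtx) (n : ℕ)
  | tm (Ψ : Ctx) (n : ℕ) (T : Ty)
/-- Contexts. -/
inductive Ctx where
  | nil
  | snoc (Γ : Ctx) (D : Decl)
end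

/-! ## Levels, erasure, appending, chopping -/

def Decl.level : Decl → ℕ
  | .ty _ n => n
  | .tm _ n _ => n

def Decl.sort : Decl → VarSort
  | .ty _ _ => .ty
  | .tm _ _ _ => .tm

def Ctx.erase : Ctx → ECtx
  | .nil => []
  | .snoc Γ D => (D.sort, D.level) :: Γ.erase

def KCtx.toCtx : KCtx → Ctx
  | .nil => .nil
  | .snoc Φ Ψ n => .snoc Φ.toCtx (.ty Ψ n)

/-- The least `n` such that all variables of the erased context have level below `n`. -/
def ECtx.level (Φ : ECtx) : ℕ := Φ.foldr (fun p m => max (p.2 + 1) m) 0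

/-- All variables of the erased context have level below `n`. -/
def ECtx.LevelLE (Φ : ECtx) (n : ℕ) : Prop := ∀ p ∈ Φ, p.2 < n

/-- Levels do not increase from left to right. -/
def ECtx.Sorted (Φ : ECtx) : Prop := Φ.Pairwise fun p q => p.2 ≤ q.2

/-- Every variable of `Φ` has level at least the level of every variable of `Ψ`: the condition
under which the appended context `Φ, Ψ` of two sorted contexts is again sorted. -/
def ECtx.Above (Φ Ψ : ECtx) : Prop := ∀ p ∈ Φ, ∀ q ∈ Ψ, q.2 ≤ p.2

/-- The context `Γ, Δ`. -/
def Ctx.append (Γ : Ctx) : Ctx → Ctx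
  | .nil => Γ
  | .snoc Δ D => .snoc (Γ.append Δ) D

instance : Append Ctx := ⟨Ctx.append⟩

/-- Chopping off all declarations below level `n` from a sorted context. -/
def Ctx.chop : Ctx → ℕ → Ctx
  | .nil, _ => .nil
  | .snoc Γ D, n => if D.level < n then Γ.chop n else .snoc Γ D

/-! ## Renaming of variables -/

/-- A renaming maps the index of a variable of given sort and level to an index (of a variable of
the same sort and level). -/
abbrev Ren := VarSort → ℕ → ℕ → ℕ

/-- Renaming from `Γ` to `Γ` with one declaration of sort `s` and level `n` added to the right of
the others of that sort and level. -/
def Ren.wk (s : VarSort) (n : ℕ) : Ren := fun s' k i => if s' = s ∧ k = n then i + 1 else i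

/-- Renaming from `Γ` to `Γ, Φ`. -/
def Ren.wks (Φ : ECtx) : Ren := fun s k i => i + Φ.count (s, k)

/-- Extension of a renaming under a binder of sort `s` and level `n`. -/
def Ren.lift (s : VarSort) (n : ℕ) (ρ : Ren) : Ren := fun s' k i =>
  if s' = s ∧ k = n then
    match i with
    | 0 => 0
    | i + 1 => ρ s' k i + 1
  else ρ s' k i

def Ren.lifts (Φ : ECtx) (ρ : Ren) : Ren := Φ.foldr (fun p ρ => ρ.lift p.1 p.2) ρ

/-- The renaming inside `Φ ⊢ⁿ -`, where all variables below level `n` belong to the local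
context. -/
def Ren.enter (n : ℕ) (ρ : Ren) : Ren := fun s k i => if k < n then i else ρ s k i

mutual
def Ty.ren (ρ : Ren) : Ty → Ty
  | .tvar n i σ => .tvar n (ρ .ty n i) (σ.ren ρ)
  | .arr S T => .arr (S.ren ρ) (T.ren ρ)
  | .all Φ n T => .all Φ n (T.ren (ρ.lift .ty n))
  | .box Φ n T => .box (Φ.ren (ρ.enter n)) n (T.ren (ρ.enter n))
def Tm.ren (ρ : Ren) : Tm → Tm
  | .var n i σ => .var n (ρ .tm n i) (σ.ren ρ)
  | .lam e => .lam (e.ren (ρ.lift .tm 0))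
  | .app e₁ e₂ => .app (e₁.ren ρ) (e₂.ren ρ)
  | .tlam n e => .tlam n (e.ren (ρ.lift .ty n))
  | .tapp e Φ n T => .tapp (e.ren ρ) Φ n (T.ren (ρ.enter n))
  | .box Φ n e => .box Φ n (e.ren (ρ.enter n))
  | .letbox Φ n e₁ e₂ => .letbox Φ n (e₁.ren ρ) (e₂.ren (ρ.lift .tm n))
def Subst.ren (ρ : Ren) : Subst → Subst
  | .nil => .nil
  | .tm σ Φ n e => .tm (σ.ren ρ) Φ n (e.ren (ρ.enter n))
  | .ty σ Φ n T => .ty (σ.ren ρ) Φ n (T.ren (ρ.enter n))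
  | .var σ s n i => .var (σ.ren ρ) s n (ρ s n i)
def Decl.ren (ρ : Ren) : Decl → Decl
  | .ty Ψ n => .ty Ψ n
  | .tm Ψ n T => .tm (Ψ.ren (ρ.enter n)) n (T.ren (ρ.enter n))
def Ctx.ren (ρ : Ren) : Ctx → Ctx
  | .nil => .nil
  | .snoc Γ D => .snoc (Γ.ren ρ) (D.ren (ρ.lifts Γ.erase))
end

/-- Adjusts the indices in a declaration when the declaration `D` is added to its context. -/
def Decl.weakenBy (D D' : Decl) : Decl := D'.ren (Ren.wk D.sort D.level)

/-- The extension `Δ` of a context `Γ`, seen as an extension of the context `Γ, Φ`. -/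
def Ctx.weaken (Φ : ECtx) (Δ : Ctx) : Ctx := Δ.ren (Ren.wks Φ)

/-- The declaration of a variable, as a declaration in the whole context. -/
def Ctx.lookup : Ctx → VarSort → ℕ → ℕ → Option Decl
  | .nil, _, _, _ => none
  | .snoc Γ D, s, n, i =>
    if s = D.sort ∧ n = D.level then
      match i with
      | 0 => some (D.weakenBy D)
      | i + 1 => (Γ.lookup s n i).map D.weakenBy
    else (Γ.lookup s n i).map D.weakenBy

/-- Insertion of a declaration into a sorted context, to the right of all declarations of the same
or a higher level. -/
def Ctx.insert : Ctx → Decl → Ctx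
  | .nil, D => .snoc .nil D
  | .snoc Γ D', D =>
    if D.level ≤ D'.level then .snoc (.snoc Γ D') D
    else .snoc (Γ.insert D) (D.weakenBy D')

/-- Merging of a sorted context `Γ` with a sorted context of further declarations over `Γ`. -/
def Ctx.merge (Γ : Ctx) : Ctx → Ctx
  | .nil => Γ
  | .snoc Δ D => (Γ.merge Δ).insert D

/-! ## Simultaneous substitution -/

/-- What a substitution assigns to a variable: a variable of the same sort and level, a contextual
type `Φ̂. T`, or a contextual term `Φ̂. e`. -/
inductive Img where
  | var (i : ℕ)
  | ty (Φ : ECtx) (T : Ty)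
  | tm (Φ : ECtx) (e : Tm)

/-- Renaming of the image of a variable of sort `s` and level `n`. -/
def Img.ren (s : VarSort) (n : ℕ) (ρ : Ren) : Img → Img
  | .var i => .var (ρ s n i)
  | .ty Φ T => .ty Φ (T.ren (ρ.enter n))
  | .tm Φ e => .tm Φ (e.ren (ρ.enter n))

/-- A substitution as a lookup function for all variables, those outside its domain included. -/
abbrev Env := VarSort → ℕ → ℕ → Img

/-- Extension of the domain by one variable of sort `s` and level `n`. -/
def Env.cons (s : VarSort) (n : ℕ) (a : Img) (E : Env) : Env := fun s' k i =>
  if s' = s ∧ k = n then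
    match i with
    | 0 => a
    | i + 1 => E s' k i
  else E s' k i

/-- Lookup in `σ/Ψ̂`, where the block `Ψ̂` of variables of a context `Γ, Ψ` is replaced by a block
`Φ̂`, the result lying in `Γ, Φ`. Variables outside `Ψ̂` stand for themselves. -/
def Subst.env (Φ : ECtx) : Subst → ECtx → Env
  | .tm σ Ξ _ e, (s, k) :: Ψ => (σ.env Φ Ψ).cons s k (.tm Ξ e)
  | .ty σ Ξ _ T, (s, k) :: Ψ => (σ.env Φ Ψ).cons s k (.ty Ξ T)
  | .var σ _ _ i, (s, k) :: Ψ => (σ.env Φ Ψ).cons s k (.var i)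
  | _, _ => fun s k i => .var (Ren.wks Φ s k i)

/-- Extension of a substitution by the identity on one bound variable, inserted at its place. -/
def Env.lift (s : VarSort) (n : ℕ) (E : Env) : Env :=
  Env.cons s n (.var 0) fun s' k i => (E s' k i).ren s' k (Ren.wk s n)

def Env.lifts (Φ : ECtx) (E : Env) : Env := Φ.foldr (fun p E => E.lift p.1 p.2) E

/-- The substitution inside `Φ ⊢ⁿ -`: chopped below level `n`, and then extended by the identity on
the local context, to which all variables below level `n` belong. -/
def Env.enter (n : ℕ) (E : Env) : Env := fun s k i => if k < n then .var i else E s k i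

/- Application of a substitution. All variables of level at least `ℓ` have variables as images; the
number `ℓ` is the level of the domain. If a variable of level `n` is replaced by a contextual
object, then the substitution attached to the variable is applied to that object, and the level of
its domain is `n < ℓ`. (In the remaining cases, which do not occur for a substitution of level `ℓ`
that respects sorts, the variable is left alone.) -/
mutual
def Ty.subst (ℓ : ℕ) (E : Env) : Ty → Ty
  | .tvar n i σ =>
    match E .ty n i with
    | .var j => .tvar n j (σ.subst ℓ E)
    | .ty Φ T => if n < ℓ then T.subst n ((σ.subst ℓ E).env [] Φ) else .tvar n i (σ.subst ℓ E)
    | .tm _ _ => .tvar n i (σ.subst ℓ E)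
  | .arr S T => .arr (S.subst ℓ E) (T.subst ℓ E)
  | .all Φ n T => .all Φ n (T.subst ℓ (E.lift .ty n))
  | .box Φ n T => .box (Φ.subst ℓ (E.enter n)) n (T.subst ℓ (E.enter n))
termination_by T => (ℓ, sizeOf T)
def Tm.subst (ℓ : ℕ) (E : Env) : Tm → Tm
  | .var n i σ =>
    match E .tm n i with
    | .var j => .var n j (σ.subst ℓ E)
    | .tm Φ e => if n < ℓ then e.subst n ((σ.subst ℓ E).env [] Φ) else .var n i (σ.subst ℓ E)
    | .ty _ _ => .var n i (σ.subst ℓ E)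
  | .lam e => .lam (e.subst ℓ (E.lift .tm 0))
  | .app e₁ e₂ => .app (e₁.subst ℓ E) (e₂.subst ℓ E)
  | .tlam n e => .tlam n (e.subst ℓ (E.lift .ty n))
  | .tapp e Φ n T => .tapp (e.subst ℓ E) Φ n (T.subst ℓ (E.enter n))
  | .box Φ n e => .box Φ n (e.subst ℓ (E.enter n))
  | .letbox Φ n e₁ e₂ => .letbox Φ n (e₁.subst ℓ E) (e₂.subst ℓ (E.lift .tm n))
termination_by e => (ℓ, sizeOf e)
def Subst.subst (ℓ : ℕ) (E : Env) : Subst → Subst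
  | .nil => .nil
  | .tm σ Φ n e => .tm (σ.subst ℓ E) Φ n (e.subst ℓ (E.enter n))
  | .ty σ Φ n T => .ty (σ.subst ℓ E) Φ n (T.subst ℓ (E.enter n))
  | .var σ s n i =>
    match E s n i with
    | .var j => .var (σ.subst ℓ E) s n j
    | .ty Φ T => .ty (σ.subst ℓ E) Φ n T
    | .tm Φ e => .tm (σ.subst ℓ E) Φ n e
termination_by σ => (ℓ, sizeOf σ)
def Decl.subst (ℓ : ℕ) (E : Env) : Decl → Decl
  | .ty Ψ n => .ty Ψ n
  | .tm Ψ n T => .tm (Ψ.subst ℓ (E.enter n)) n (T.subst ℓ (E.enter n))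
termination_by D => (ℓ, sizeOf D)
def Ctx.subst (ℓ : ℕ) (E : Env) : Ctx → Ctx
  | .nil => .nil
  | .snoc Γ D => .snoc (Γ.subst ℓ E) (D.subst ℓ (E.lifts Γ.erase))
termination_by Γ => (ℓ, sizeOf Γ)
end

/-- `[σ/Ψ̂]T`, from a context `Γ, Ψ` to a context `Γ, Φ`. -/
def Ty.simSubst (Φ : ECtx) (σ : Subst) (Ψ : ECtx) (T : Ty) : Ty := T.subst Ψ.level (σ.env Φ Ψ)

/-- `[σ/Ψ̂]e`, from a context `Γ, Ψ` to a context `Γ, Φ`. -/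
def Tm.simSubst (Φ : ECtx) (σ : Subst) (Ψ : ECtx) (e : Tm) : Tm := e.subst Ψ.level (σ.env Φ Ψ)

/-- `[σ/Ψ̂]σ'`, from a context `Γ, Ψ` to a context `Γ, Φ`. -/
def Subst.simSubst (Φ : ECtx) (σ : Subst) (Ψ : ECtx) (σ' : Subst) : Subst :=
  σ'.subst Ψ.level (σ.env Φ Ψ)

/-- `[σ/Ψ̂]Δ`, from a context `Γ, Ψ` to a context `Γ, Φ`. -/
def Ctx.simSubst (Φ : ECtx) (σ : Subst) (Ψ : ECtx) (Δ : Ctx) : Ctx :=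
  Δ.subst Ψ.level (σ.env Φ Ψ)

/-- `[(σ/Ψ̂) chopped below n, id(Φ̂)/Φ̂]T` for `T` in a local context `Φ` of level `n`. -/
def Ty.simSubstLocal (n : ℕ) (σ : Subst) (Ψ : ECtx) (T : Ty) : Ty :=
  T.subst Ψ.level ((σ.env [] Ψ).enter n)

/-- `[(σ/Ψ̂) chopped below n]Φ` for a local context `Φ` of level `n`. -/
def Ctx.simSubstLocal (n : ℕ) (σ : Subst) (Ψ : ECtx) (Φ : Ctx) : Ctx :=
  Φ.subst Ψ.level ((σ.env [] Ψ).enter n)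

/-- `[(Φ̂ⁿ. T)/αⁿ]S`, where `α` is the rightmost type variable of level `n`. -/
def Ty.single (S : Ty) (Φ : ECtx) (n : ℕ) (T : Ty) : Ty :=
  S.simSubst [] (.ty .nil Φ n T) [(.ty, n)]

/-! ## Typing

The judgments are about well-formed contexts only: a judgment over `Γ` presupposes that `Γ` is well
formed, and the judgment `Γ ⊢ σ : Ψ` presupposes that `Ψ` is a sorted context whose declarations
are well formed over `Γ`. The rules state these presuppositions as premises. -/

mutual
/-- `⊢ Γ`: the context `Γ` is (sorted and) well formed. -/
inductive WfCtx : Ctx → Prop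
  | nil : WfCtx .nil
  | tm {Γ Φ : Ctx} {n : ℕ} {T : Ty} :
      WfCtx Γ → (∀ p ∈ Γ.erase, n ≤ p.2) → Φ.erase.LevelLE n →
      WfCtx (Γ.chop n ++ Φ) → WfTy (Γ.chop n ++ Φ) T →
      WfCtx (.snoc Γ (.tm Φ n T))
  | ty {Γ : Ctx} {Φ : KCtx} {n : ℕ} :
      WfCtx Γ → (∀ p ∈ Γ.erase, n ≤ p.2) → Φ.toCtx.erase.LevelLE n →
      WfCtx (Γ.chop n ++ Φ.toCtx) →
      WfCtx (.snoc Γ (.ty Φ n))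
/-- `Γ ⊢ T`: the type `T` is well kinded. -/
inductive WfTy : Ctx → Ty → Prop
  | tvar {Γ : Ctx} {n i : ℕ} {Φ : KCtx} {σ : Subst} :
      WfCtx Γ → Γ.lookup .ty n i = some (.ty Φ n) → WfSubst Γ σ Φ.toCtx →
      WfTy Γ (.tvar n i σ)
  | arr {Γ : Ctx} {S T : Ty} :
      WfCtx Γ → WfTy Γ S → WfTy Γ T → WfTy Γ (.arr S T)
  | all {Γ : Ctx} {Φ : KCtx} {n : ℕ} {T : Ty} :
      WfCtx Γ → WfCtx (Γ.chop n ++ Φ.toCtx) → WfTy (Γ.insert (.ty Φ n)) T →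
      WfTy Γ (.all Φ n T)
  | box {Γ Φ : Ctx} {n : ℕ} {T : Ty} :
      WfCtx Γ → 0 < n → Φ.erase.LevelLE n →
      WfCtx (Γ.chop n ++ Φ) → WfTy (Γ.chop n ++ Φ) T →
      WfTy Γ (.box Φ n T)
/-- `Γ ⊢ e : T`. -/
inductive WfTm : Ctx → Tm → Ty → Prop
  | var {Γ : Ctx} {n i : ℕ} {Φ : Ctx} {T : Ty} {σ : Subst} :
      WfCtx Γ → Γ.lookup .tm n i = some (.tm Φ n T) → WfSubst Γ σ Φ →
      WfTm Γ (.var n i σ) (T.simSubst [] σ Φ.erase)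
  | lam {Γ : Ctx} {S T : Ty} {e : Tm} :
      WfCtx Γ → WfTm (.snoc Γ (.tm .nil 0 S)) e (T.ren (Ren.wk .tm 0)) →
      WfTm Γ (.lam e) (.arr S T)
  | app {Γ : Ctx} {S T : Ty} {e₁ e₂ : Tm} :
      WfCtx Γ → WfTm Γ e₁ (.arr S T) → WfTm Γ e₂ S → WfTm Γ (.app e₁ e₂) T
  | tlam {Γ : Ctx} {Φ : KCtx} {n : ℕ} {T : Ty} {e : Tm} :
      WfCtx Γ → WfTm (Γ.insert (.ty Φ n)) e T → WfTm Γ (.tlam n e) (.all Φ n T)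
  | tapp {Γ : Ctx} {Φ : KCtx} {n : ℕ} {S T : Ty} {e : Tm} :
      WfCtx Γ → WfTm Γ e (.all Φ n S) → WfTy (Γ.chop n ++ Φ.toCtx) T →
      WfTm Γ (.tapp e Φ.toCtx.erase n T) (S.single Φ.toCtx.erase n T)
  | box {Γ Φ : Ctx} {n : ℕ} {T : Ty} {e : Tm} :
      WfCtx Γ → 0 < n → Φ.erase.LevelLE n → WfTm (Γ.chop n ++ Φ) e T →
      WfTm Γ (.box Φ.erase n e) (.box Φ n T)
  | letbox {Γ Φ : Ctx} {n : ℕ} {S T : Ty} {e₁ e₂ : Tm} :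
      WfCtx Γ → 0 < n → WfTm Γ e₁ (.box Φ n S) →
      WfTm (Γ.insert (.tm Φ n S)) e₂ (T.ren (Ren.wk .tm n)) →
      WfTm Γ (.letbox Φ.erase n e₁ e₂) T
/-- `Γ ⊢ σ : Ψ`. -/
inductive WfSubst : Ctx → Subst → Ctx → Prop
  | nil {Γ : Ctx} : WfCtx Γ → WfSubst Γ .nil .nil
  | tm {Γ Δ Ψ : Ctx} {n : ℕ} {T : Ty} {σ : Subst} {e : Tm} :
      (Ctx.snoc Δ (.tm Ψ n T)).erase.Sorted → WfCtx (Γ.merge (.snoc Δ (.tm Ψ n T))) →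
      WfSubst Γ σ Δ →
      WfTm (Γ.chop n ++ Ψ.simSubstLocal n σ Δ.erase) e (T.simSubstLocal n σ Δ.erase) →
      WfSubst Γ (.tm σ Ψ.erase n e) (.snoc Δ (.tm Ψ n T))
  | tmVar {Γ Δ Ψ : Ctx} {n i : ℕ} {T : Ty} {σ : Subst} :
      (Ctx.snoc Δ (.tm Ψ n T)).erase.Sorted → WfCtx (Γ.merge (.snoc Δ (.tm Ψ n T))) →
      WfSubst Γ σ Δ →
      Γ.lookup .tm n i =
        some (.tm (Ψ.simSubstLocal n σ Δ.erase) n (T.simSubstLocal n σ Δ.erase)) →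
      WfSubst Γ (.var σ .tm n i) (.snoc Δ (.tm Ψ n T))
  | ty {Γ Δ : Ctx} {Ψ : KCtx} {n : ℕ} {σ : Subst} {T : Ty} :
      (Ctx.snoc Δ (.ty Ψ n)).erase.Sorted → WfCtx (Γ.merge (.snoc Δ (.ty Ψ n))) →
      WfSubst Γ σ Δ → WfTy (Γ.chop n ++ Ψ.toCtx) T →
      WfSubst Γ (.ty σ Ψ.toCtx.erase n T) (.snoc Δ (.ty Ψ n))
  | tyVar {Γ Δ : Ctx} {Ψ : KCtx} {n i : ℕ} {σ : Subst} :
      (Ctx.snoc Δ (.ty Ψ n)).erase.Sorted → WfCtx (Γ.merge (.snoc Δ (.ty Ψ n))) →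
      WfSubst Γ σ Δ → Γ.lookup .ty n i = some (.ty Ψ n) →
      WfSubst Γ (.var σ .ty n i) (.snoc Δ (.ty Ψ n))
end

end Moebius

namespace Moebius

/-! ## Renamings -/

-- Hereditary substitution terminates because replacing a variable of level `n` by a contextual
-- object only starts a substitution whose domain has level `n`, below the level `ℓ` of the current
-- domain. The metatheory follows the same order: each property is proved by structural or
-- derivation induction at a fixed `ℓ`, and smaller levels are needed only where a variable is
-- replaced by an object.
--
-- The equational part needs no types. A shape keeps the sorts, levels and local contexts of
-- declarations and forgets their types, so it is invariant under renaming and substitution. On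
-- syntax that is well scoped with respect to shapes, substitution preserves scoping (`substSc`),
-- commutes with renaming (`renSubst`) and composes (`substComp`). Composition goes by induction on
-- the sum of the two levels: at a replaced variable the two sides apply the same two smaller
-- substitutions in opposite orders. The consequences are the interchange laws
-- `Decl.Sc.subst_env_comm`, `Ty.Sc.simSubst_subst` and `Ty.Sc.single_subst`, which say that
-- substituting in a type that a rule has computed by substitution yields the type that the rule
-- computes afterwards.
--
-- For typing, a context is replaced by its lookup function. Variables are named by sort, level and
-- index, so `snoc`, `insert` and `merge` all become adding declarations to the function, and
-- chopping becomes forgetting low levels; sortedness disappears from the substitution argument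
-- except inside declared contexts. In the judgments `DeclOk`, `ExtOk`, `TyOk`, `TmOk`, `SubOk` the
-- presuppositions on the ambient context are dropped and derivations carry a size. Substitution for
-- these (`substOk`) is an induction on the level and then on the size. Passing under a binder
-- requires weakening the images, hence renaming derivations. The circle is broken at level `0`,
-- where all images are variables: that case gives renaming, and renaming gives binders at every
-- level.
--
-- The translations `WfTm.ok` and `TmOk.wf`, with their analogues, connect the two systems. The way
-- back uses that renaming does not increase sizes. Finally, `[σ/Γ̂₀]` from `Γ₁, Γ₀` to `Γ₁, Φ`
-- factors as a weakening by `Φ` under `Γ₀`, followed by the substitution of `σ` for the weakened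
-- block (`Subst.Sc.env_precomp`), and each factor preserves typing.

theorem Ren.wk_cases (s : VarSort) (n : ℕ) (s' : VarSort) (k i : ℕ) :
    (s' = s ∧ k = n ∧ i = 0) ∨ ∃ j, i = Ren.wk s n s' k j := by
  by_cases h : s' = s ∧ k = n
  · cases i with
    | zero => exact .inl ⟨h.1, h.2, rfl⟩
    | succ j => exact .inr ⟨j, by simp [Ren.wk, h]⟩
  · exact .inr ⟨i, by simp [Ren.wk, h]⟩

@[simp] theorem Ren.lift_zero (s : VarSort) (n : ℕ) (ρ : Ren) : ρ.lift s n s n 0 = 0 := by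
  simp [Ren.lift]

@[simp] theorem Ren.lift_wk (s : VarSort) (n : ℕ) (ρ : Ren) (s' : VarSort) (k i : ℕ) :
    ρ.lift s n s' k (Ren.wk s n s' k i) = Ren.wk s n s' k (ρ s' k i) := by
  by_cases h : s' = s ∧ k = n <;> simp [Ren.lift, Ren.wk, h]

/-- Every variable is either the newest one of its sort and level or the weakening of an older one.
Equations between functions extended under a binder are reduced to these two cases throughout. -/
theorem vext {α : Type} (s : VarSort) (n : ℕ) {f g : VarSort → ℕ → ℕ → α}
    (h0 : f s n 0 = g s n 0)
    (h : ∀ s' k i, f s' k (Ren.wk s n s' k i) = g s' k (Ren.wk s n s' k i)) : f = g := by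
  funext s' k i
  obtain ⟨rfl, rfl, rfl⟩ | ⟨j, rfl⟩ := Ren.wk_cases s n s' k i
  · exact h0
  · exact h _ _ _

/-- The identity renaming. -/
def Ren.id : Ren := fun _ _ i => i

/-- First `ρ`, then `ρ'`. -/
def Ren.comp (ρ' ρ : Ren) : Ren := fun s k i => ρ' s k (ρ s k i)

@[simp] theorem Ren.lift_id (s : VarSort) (n : ℕ) : Ren.id.lift s n = Ren.id :=
  vext s n (by simp [Ren.id]) (by simp [Ren.id])

@[simp] theorem Ren.lifts_id (Φ : ECtx) : Ren.id.lifts Φ = Ren.id := by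
  induction Φ with
  | nil => rfl
  | cons p Φ ih => simp_all [Ren.lifts]

@[simp] theorem Ren.enter_id (n : ℕ) : Ren.id.enter n = Ren.id := by
  funext s k i; simp [Ren.enter, Ren.id]

theorem Ren.lift_comp (s : VarSort) (n : ℕ) (ρ' ρ : Ren) :
    (ρ'.comp ρ).lift s n = (ρ'.lift s n).comp (ρ.lift s n) :=
  vext s n (by simp [Ren.comp]) (by simp [Ren.comp])

theorem Ren.lifts_comp (Φ : ECtx) (ρ' ρ : Ren) :
    (ρ'.comp ρ).lifts Φ = (ρ'.lifts Φ).comp (ρ.lifts Φ) := by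
  induction Φ with
  | nil => rfl
  | cons p Φ ih => simp_all [Ren.lifts, Ren.lift_comp]

theorem Ren.enter_comp (n : ℕ) (ρ' ρ : Ren) :
    (ρ'.comp ρ).enter n = (ρ'.enter n).comp (ρ.enter n) := by
  funext s k i
  by_cases h : k < n <;> simp [Ren.enter, Ren.comp, h]

theorem Ren.enter_enter {m n : ℕ} (h : m ≤ n) (ρ : Ren) : (ρ.enter m).enter n = ρ.enter n := by
  funext s k i
  by_cases hk : k < n
  · simp [Ren.enter, hk]
  · simp [Ren.enter, hk, show ¬ k < m by omega]

@[simp] theorem Decl.level_ren (ρ : Ren) (D : Decl) : (D.ren ρ).level = D.level := by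
  cases D <;> simp [Decl.ren, Decl.level]

@[simp] theorem Decl.sort_ren (ρ : Ren) (D : Decl) : (D.ren ρ).sort = D.sort := by
  cases D <;> simp [Decl.ren, Decl.sort]

@[simp] theorem Ctx.erase_ren (ρ : Ren) : ∀ Γ : Ctx, (Γ.ren ρ).erase = Γ.erase
  | .nil => by simp [Ctx.ren, Ctx.erase]
  | .snoc Γ D => by simp [Ctx.ren, Ctx.erase, Ctx.erase_ren ρ Γ]

mutual
theorem Ty.ren_id : ∀ T : Ty, T.ren Ren.id = T
  | .tvar n i σ => by simp [Ty.ren, Subst.ren_id σ]; rfl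
  | .arr S T => by simp [Ty.ren, Ty.ren_id S, Ty.ren_id T]
  | .all Φ n T => by simp [Ty.ren, Ty.ren_id T]
  | .box Φ n T => by simp [Ty.ren, Ctx.ren_id Φ, Ty.ren_id T]
theorem Tm.ren_id : ∀ e : Tm, e.ren Ren.id = e
  | .var n i σ => by simp [Tm.ren, Subst.ren_id σ]; rfl
  | .lam e => by simp [Tm.ren, Tm.ren_id e]
  | .app e₁ e₂ => by simp [Tm.ren, Tm.ren_id e₁, Tm.ren_id e₂]
  | .tlam n e => by simp [Tm.ren, Tm.ren_id e]
  | .tapp e Φ n T => by simp [Tm.ren, Tm.ren_id e, Ty.ren_id T]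
  | .box Φ n e => by simp [Tm.ren, Tm.ren_id e]
  | .letbox Φ n e₁ e₂ => by simp [Tm.ren, Tm.ren_id e₁, Tm.ren_id e₂]
theorem Subst.ren_id : ∀ σ : Subst, σ.ren Ren.id = σ
  | .nil => by simp [Subst.ren]
  | .tm σ Φ n e => by simp [Subst.ren, Subst.ren_id σ, Tm.ren_id e]
  | .ty σ Φ n T => by simp [Subst.ren, Subst.ren_id σ, Ty.ren_id T]
  | .var σ s n i => by simp [Subst.ren, Subst.ren_id σ]; rfl
theorem Decl.ren_id : ∀ D : Decl, D.ren Ren.id = D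
  | .ty Ψ n => by simp [Decl.ren]
  | .tm Ψ n T => by simp [Decl.ren, Ctx.ren_id Ψ, Ty.ren_id T]
theorem Ctx.ren_id : ∀ Γ : Ctx, Γ.ren Ren.id = Γ
  | .nil => by simp [Ctx.ren]
  | .snoc Γ D => by simp [Ctx.ren, Ctx.ren_id Γ, Decl.ren_id D]
end

mutual
theorem Ty.ren_ren (ρ ρ' : Ren) : ∀ T : Ty, (T.ren ρ).ren ρ' = T.ren (ρ'.comp ρ)
  | .tvar n i σ => by simp [Ty.ren, Subst.ren_ren ρ ρ' σ]; rfl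
  | .arr S T => by simp [Ty.ren, Ty.ren_ren ρ ρ' S, Ty.ren_ren ρ ρ' T]
  | .all Φ n T => by simp [Ty.ren, Ty.ren_ren _ _ T, Ren.lift_comp]
  | .box Φ n T => by simp [Ty.ren, Ctx.ren_ren _ _ Φ, Ty.ren_ren _ _ T, Ren.enter_comp]
theorem Tm.ren_ren (ρ ρ' : Ren) : ∀ e : Tm, (e.ren ρ).ren ρ' = e.ren (ρ'.comp ρ)
  | .var n i σ => by simp [Tm.ren, Subst.ren_ren _ _ σ]; rfl
  | .lam e => by simp [Tm.ren, Tm.ren_ren _ _ e, Ren.lift_comp]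
  | .app e₁ e₂ => by simp [Tm.ren, Tm.ren_ren _ _ e₁, Tm.ren_ren _ _ e₂]
  | .tlam n e => by simp [Tm.ren, Tm.ren_ren _ _ e, Ren.lift_comp]
  | .tapp e Φ n T => by simp [Tm.ren, Tm.ren_ren _ _ e, Ty.ren_ren _ _ T, Ren.enter_comp]
  | .box Φ n e => by simp [Tm.ren, Tm.ren_ren _ _ e, Ren.enter_comp]
  | .letbox Φ n e₁ e₂ => by
    simp [Tm.ren, Tm.ren_ren _ _ e₁, Tm.ren_ren _ _ e₂, Ren.lift_comp]
theorem Subst.ren_ren (ρ ρ' : Ren) : ∀ σ : Subst, (σ.ren ρ).ren ρ' = σ.ren (ρ'.comp ρ)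
  | .nil => by simp [Subst.ren]
  | .tm σ Φ n e => by simp [Subst.ren, Subst.ren_ren _ _ σ, Tm.ren_ren _ _ e, Ren.enter_comp]
  | .ty σ Φ n T => by simp [Subst.ren, Subst.ren_ren _ _ σ, Ty.ren_ren _ _ T, Ren.enter_comp]
  | .var σ s n i => by simp [Subst.ren, Subst.ren_ren _ _ σ]; rfl
theorem Decl.ren_ren (ρ ρ' : Ren) : ∀ D : Decl, (D.ren ρ).ren ρ' = D.ren (ρ'.comp ρ)
  | .ty Ψ n => by simp [Decl.ren]
  | .tm Ψ n T => by simp [Decl.ren, Ctx.ren_ren _ _ Ψ, Ty.ren_ren _ _ T, Ren.enter_comp]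
theorem Ctx.ren_ren (ρ ρ' : Ren) : ∀ Γ : Ctx, (Γ.ren ρ).ren ρ' = Γ.ren (ρ'.comp ρ)
  | .nil => by simp [Ctx.ren]
  | .snoc Γ D => by
    simp [Ctx.ren, Ctx.ren_ren _ _ Γ, Decl.ren_ren _ _ D, Ren.lifts_comp]
end

/-! ## Lookup functions -/

/-- Extension of a lookup function by a value for a new rightmost variable. -/
def vcons {α : Type} (s : VarSort) (n : ℕ) (a : α) (f : VarSort → ℕ → ℕ → α) :
    VarSort → ℕ → ℕ → α := fun s' k i =>
  if s' = s ∧ k = n then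
    match i with
    | 0 => a
    | i + 1 => f s' k i
  else f s' k i

@[simp] theorem vcons_zero {α : Type} (s : VarSort) (n : ℕ) (a : α)
    (f : VarSort → ℕ → ℕ → α) : vcons s n a f s n 0 = a := by
  simp [vcons]

@[simp] theorem vcons_wk {α : Type} (s : VarSort) (n : ℕ) (a : α) (f : VarSort → ℕ → ℕ → α)
    (s' : VarSort) (k i : ℕ) : vcons s n a f s' k (Ren.wk s n s' k i) = f s' k i := by
  by_cases h : s' = s ∧ k = n <;> simp [vcons, Ren.wk, h]

theorem vcons_of_ne {α : Type} {s : VarSort} {n : ℕ} {a : α} {f : VarSort → ℕ → ℕ → α}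
    {s' : VarSort} {k i : ℕ} (h : ¬ (s' = s ∧ k = n)) : vcons s n a f s' k i = f s' k i := by
  simp [vcons, h]

/-! ## Environments -/

theorem Env.cons_eq (s : VarSort) (n : ℕ) (a : Img) (E : Env) : E.cons s n a = vcons s n a E := rfl

/-- Renaming followed by an environment. -/
def Env.precomp (E : Env) (ρ : Ren) : Env := fun s k i => E s k (ρ s k i)

/-- The environment of a renaming. -/
def Ren.env (ρ : Ren) : Env := fun s k i => .var (ρ s k i)

@[simp] theorem Env.lift_zero (s : VarSort) (n : ℕ) (E : Env) : E.lift s n s n 0 = .var 0 := by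
  simp [Env.lift, Env.cons_eq]

@[simp] theorem Env.lift_wk (s : VarSort) (n : ℕ) (E : Env) (s' : VarSort) (k i : ℕ) :
    E.lift s n s' k (Ren.wk s n s' k i) = (E s' k i).ren s' k (Ren.wk s n) := by
  simp [Env.lift, Env.cons_eq]

theorem Env.lift_precomp (s : VarSort) (n : ℕ) (E : Env) (ρ : Ren) :
    (E.precomp ρ).lift s n = (E.lift s n).precomp (ρ.lift s n) :=
  vext s n (by simp [Env.precomp]) (by simp [Env.precomp])

theorem Env.lifts_precomp (Φ : ECtx) (E : Env) (ρ : Ren) :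
    (E.precomp ρ).lifts Φ = (E.lifts Φ).precomp (ρ.lifts Φ) := by
  induction Φ with
  | nil => rfl
  | cons p Φ ih => simp_all [Ren.lifts, Env.lifts, Env.lift_precomp]

theorem Env.enter_precomp (n : ℕ) (E : Env) (ρ : Ren) :
    (E.precomp ρ).enter n = (E.enter n).precomp (ρ.enter n) := by
  funext s k i
  by_cases h : k < n <;> simp [Env.enter, Ren.enter, Env.precomp, h]

theorem Env.enter_enter {m n : ℕ} (h : m ≤ n) (E : Env) : (E.enter m).enter n = E.enter n := by
  funext s k i
  by_cases hk : k < n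
  · simp [Env.enter, hk]
  · simp [Env.enter, hk, show ¬ k < m by omega]

theorem Ren.env_lift (s : VarSort) (n : ℕ) (ρ : Ren) : ρ.env.lift s n = (ρ.lift s n).env :=
  vext s n (by simp [Ren.env]) (by simp [Ren.env, Img.ren])

theorem Ren.env_lifts (Φ : ECtx) (ρ : Ren) : ρ.env.lifts Φ = (ρ.lifts Φ).env := by
  induction Φ with
  | nil => rfl
  | cons p Φ ih => simp_all [Ren.lifts, Env.lifts, Ren.env_lift]

theorem Ren.env_enter (n : ℕ) (ρ : Ren) : ρ.env.enter n = (ρ.enter n).env := by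
  funext s k i
  by_cases h : k < n <;> simp [Env.enter, Ren.enter, Ren.env, h]

@[simp] theorem Decl.level_subst (ℓ : ℕ) (E : Env) (D : Decl) : (D.subst ℓ E).level = D.level := by
  cases D <;> simp [Decl.subst, Decl.level]

@[simp] theorem Decl.sort_subst (ℓ : ℕ) (E : Env) (D : Decl) : (D.subst ℓ E).sort = D.sort := by
  cases D <;> simp [Decl.subst, Decl.sort]

@[simp] theorem Ctx.erase_subst (ℓ : ℕ) (E : Env) : ∀ Γ : Ctx, (Γ.subst ℓ E).erase = Γ.erase
  | .nil => by simp [Ctx.subst, Ctx.erase]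
  | .snoc Γ D => by simp [Ctx.subst, Ctx.erase, Ctx.erase_subst ℓ E Γ]

/-- The image of a variable of sort `s` and level `n` is a variable, or a contextual object of that
sort and `n < ℓ`. -/
def Img.Reg (ℓ : ℕ) (s : VarSort) (n : ℕ) : Img → Prop
  | .var _ => True
  | .ty _ _ => s = .ty ∧ n < ℓ
  | .tm _ _ => s = .tm ∧ n < ℓ

/-- The environment respects sorts, and its domain has level `ℓ`. -/
def Env.Reg (ℓ : ℕ) (E : Env) : Prop := ∀ s n i, (E s n i).Reg ℓ s n

theorem Img.Reg.ren {ℓ : ℕ} {s : VarSort} {n : ℕ} {a : Img} (h : a.Reg ℓ s n) (s' : VarSort)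
    (n' : ℕ) (ρ : Ren) : (a.ren s' n' ρ).Reg ℓ s n := by
  cases a <;> exact h

theorem Env.Reg.lift {ℓ : ℕ} {E : Env} (h : E.Reg ℓ) (s : VarSort) (n : ℕ) :
    (E.lift s n).Reg ℓ := by
  intro s' k i
  obtain ⟨rfl, rfl, rfl⟩ | ⟨j, rfl⟩ := Ren.wk_cases s n s' k i
  · simp [Img.Reg]
  · simpa using (h s' k j).ren _ _ _

theorem Env.Reg.lifts {ℓ : ℕ} {E : Env} (h : E.Reg ℓ) (Φ : ECtx) : (E.lifts Φ).Reg ℓ := by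
  induction Φ with
  | nil => exact h
  | cons p Φ ih => exact ih.lift _ _

theorem Env.Reg.enter {ℓ : ℕ} {E : Env} (h : E.Reg ℓ) (n : ℕ) : (E.enter n).Reg ℓ := by
  intro s k i
  by_cases hk : k < n
  · simp [Env.enter, hk, Img.Reg]
  · simpa [Env.enter, hk] using h s k i

theorem Ren.env_reg (ℓ : ℕ) (ρ : Ren) : ρ.env.Reg ℓ := fun _ _ _ => trivial

-- Substitution after renaming, and substitution by variables

mutual
-- Regularity excludes the default branches of substitution. Those leave the variable alone, and
-- would return the renamed index on one side and the original one on the other.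
theorem Ty.subst_ren (ℓ : ℕ) (E : Env) (ρ : Ren) (hE : E.Reg ℓ) :
    ∀ T : Ty, (T.ren ρ).subst ℓ E = T.subst ℓ (E.precomp ρ)
  | .tvar n i σ => by
    have h := hE .ty n (ρ .ty n i)
    simp only [Ty.ren, Ty.subst, Subst.subst_ren ℓ E ρ hE σ, Env.precomp]
    generalize E .ty n (ρ .ty n i) = a at h
    cases a <;> simp_all [Img.Reg]
  | .arr S T => by simp [Ty.ren, Ty.subst, Ty.subst_ren _ _ _ hE S, Ty.subst_ren _ _ _ hE T]
  | .all Φ n T => by simp [Ty.ren, Ty.subst, Ty.subst_ren _ _ _ (hE.lift _ _) T, Env.lift_precomp]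
  | .box Φ n T => by
    simp [Ty.ren, Ty.subst, Ctx.subst_ren _ _ _ (hE.enter _) Φ, Ty.subst_ren _ _ _ (hE.enter _) T, Env.enter_precomp]
theorem Tm.subst_ren (ℓ : ℕ) (E : Env) (ρ : Ren) (hE : E.Reg ℓ) :
    ∀ e : Tm, (e.ren ρ).subst ℓ E = e.subst ℓ (E.precomp ρ)
  | .var n i σ => by
    have h := hE .tm n (ρ .tm n i)
    simp only [Tm.ren, Tm.subst, Subst.subst_ren ℓ E ρ hE σ, Env.precomp]
    generalize E .tm n (ρ .tm n i) = a at h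
    cases a <;> simp_all [Img.Reg]
  | .lam e => by simp [Tm.ren, Tm.subst, Tm.subst_ren _ _ _ (hE.lift _ _) e, Env.lift_precomp]
  | .app e₁ e₂ => by simp [Tm.ren, Tm.subst, Tm.subst_ren _ _ _ hE e₁, Tm.subst_ren _ _ _ hE e₂]
  | .tlam n e => by simp [Tm.ren, Tm.subst, Tm.subst_ren _ _ _ (hE.lift _ _) e, Env.lift_precomp]
  | .tapp e Φ n T => by
    simp [Tm.ren, Tm.subst, Tm.subst_ren _ _ _ hE e, Ty.subst_ren _ _ _ (hE.enter _) T, Env.enter_precomp]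
  | .box Φ n e => by simp [Tm.ren, Tm.subst, Tm.subst_ren _ _ _ (hE.enter _) e, Env.enter_precomp]
  | .letbox Φ n e₁ e₂ => by
    simp [Tm.ren, Tm.subst, Tm.subst_ren _ _ _ hE e₁, Tm.subst_ren _ _ _ (hE.lift _ _) e₂, Env.lift_precomp]
theorem Subst.subst_ren (ℓ : ℕ) (E : Env) (ρ : Ren) (hE : E.Reg ℓ) :
    ∀ σ : Subst, (σ.ren ρ).subst ℓ E = σ.subst ℓ (E.precomp ρ)
  | .nil => by simp [Subst.ren, Subst.subst]
  | .tm σ Φ n e => by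
    simp [Subst.ren, Subst.subst, Subst.subst_ren _ _ _ hE σ, Tm.subst_ren _ _ _ (hE.enter _) e,
      Env.enter_precomp]
  | .ty σ Φ n T => by
    simp [Subst.ren, Subst.subst, Subst.subst_ren _ _ _ hE σ, Ty.subst_ren _ _ _ (hE.enter _) T,
      Env.enter_precomp]
  | .var σ s n i => by simp only [Subst.ren, Subst.subst, Subst.subst_ren _ _ _ hE σ]; rfl
theorem Decl.subst_ren (ℓ : ℕ) (E : Env) (ρ : Ren) (hE : E.Reg ℓ) :
    ∀ D : Decl, (D.ren ρ).subst ℓ E = D.subst ℓ (E.precomp ρ)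
  | .ty Ψ n => by simp [Decl.ren, Decl.subst]
  | .tm Ψ n T => by
    simp [Decl.ren, Decl.subst, Ctx.subst_ren _ _ _ (hE.enter _) Ψ, Ty.subst_ren _ _ _ (hE.enter _) T, Env.enter_precomp]
theorem Ctx.subst_ren (ℓ : ℕ) (E : Env) (ρ : Ren) (hE : E.Reg ℓ) :
    ∀ Γ : Ctx, (Γ.ren ρ).subst ℓ E = Γ.subst ℓ (E.precomp ρ)
  | .nil => by simp [Ctx.ren, Ctx.subst]
  | .snoc Γ D => by
    simp [Ctx.ren, Ctx.subst, Ctx.subst_ren _ _ _ hE Γ, Decl.subst_ren _ _ _ (hE.lifts _) D, Env.lifts_precomp]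
end

mutual
-- With only variables as images no hereditary step ever occurs, so the level is irrelevant. Every
-- result about substitution thereby specializes to renaming.
theorem Ty.subst_env (ℓ : ℕ) (ρ : Ren) : ∀ T : Ty, T.subst ℓ ρ.env = T.ren ρ
  | .tvar n i σ => by
    rw [Ty.subst, Subst.subst_env ℓ ρ σ]; rfl
  | .arr S T => by simp [Ty.ren, Ty.subst, Ty.subst_env _ _ S, Ty.subst_env _ _ T]
  | .all Φ n T => by simp [Ty.ren, Ty.subst, Ty.subst_env _ _ T, Ren.env_lift]
  | .box Φ n T => by
    simp [Ty.ren, Ty.subst, Ctx.subst_env _ _ Φ, Ty.subst_env _ _ T, Ren.env_enter]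
theorem Tm.subst_env (ℓ : ℕ) (ρ : Ren) : ∀ e : Tm, e.subst ℓ ρ.env = e.ren ρ
  | .var n i σ => by
    rw [Tm.subst, Subst.subst_env ℓ ρ σ]; rfl
  | .lam e => by simp [Tm.ren, Tm.subst, Tm.subst_env _ _ e, Ren.env_lift]
  | .app e₁ e₂ => by simp [Tm.ren, Tm.subst, Tm.subst_env _ _ e₁, Tm.subst_env _ _ e₂]
  | .tlam n e => by simp [Tm.ren, Tm.subst, Tm.subst_env _ _ e, Ren.env_lift]
  | .tapp e Φ n T => by
    simp [Tm.ren, Tm.subst, Tm.subst_env _ _ e, Ty.subst_env _ _ T, Ren.env_enter]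
  | .box Φ n e => by simp [Tm.ren, Tm.subst, Tm.subst_env _ _ e, Ren.env_enter]
  | .letbox Φ n e₁ e₂ => by
    simp [Tm.ren, Tm.subst, Tm.subst_env _ _ e₁, Tm.subst_env _ _ e₂, Ren.env_lift]
theorem Subst.subst_env (ℓ : ℕ) (ρ : Ren) : ∀ σ : Subst, σ.subst ℓ ρ.env = σ.ren ρ
  | .nil => by simp [Subst.ren, Subst.subst]
  | .tm σ Φ n e => by
    simp [Subst.ren, Subst.subst, Subst.subst_env _ _ σ, Tm.subst_env _ _ e, Ren.env_enter]
  | .ty σ Φ n T => by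
    simp [Subst.ren, Subst.subst, Subst.subst_env _ _ σ, Ty.subst_env _ _ T, Ren.env_enter]
  | .var σ s n i => by rw [Subst.subst, Subst.subst_env _ _ σ]; rfl
theorem Decl.subst_env (ℓ : ℕ) (ρ : Ren) : ∀ D : Decl, D.subst ℓ ρ.env = D.ren ρ
  | .ty Ψ n => by simp [Decl.ren, Decl.subst]
  | .tm Ψ n T => by
    simp [Decl.ren, Decl.subst, Ctx.subst_env _ _ Ψ, Ty.subst_env _ _ T, Ren.env_enter]
theorem Ctx.subst_env (ℓ : ℕ) (ρ : Ren) : ∀ Γ : Ctx, Γ.subst ℓ ρ.env = Γ.ren ρ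
  | .nil => by simp [Ctx.ren, Ctx.subst]
  | .snoc Γ D => by
    simp [Ctx.ren, Ctx.subst, Ctx.subst_env _ _ Γ, Decl.subst_env _ _ D, Ren.env_lifts]
end

/-! ## Shapes -/

/-- The shape of a context: sort, level and shape of the local context of each declaration. -/
inductive Sh where
  | nil
  | snoc (Δ : Sh) (s : VarSort) (n : ℕ) (Ψ : Sh)

def Sh.erase : Sh → ECtx
  | .nil => []
  | .snoc Δ s n _ => (s, n) :: Δ.erase

def KCtx.sh : KCtx → Sh
  | .nil => .nil
  | .snoc Φ Ψ n => .snoc Φ.sh .ty n Ψ.sh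

mutual
def Decl.sh : Decl → Sh
  | .ty Ψ _ => Ψ.sh
  | .tm Ψ _ _ => Ψ.sh
def Ctx.sh : Ctx → Sh
  | .nil => .nil
  | .snoc Γ D => .snoc Γ.sh D.sort D.level D.sh
end

@[simp] theorem KCtx.sh_toCtx : ∀ Φ : KCtx, Φ.toCtx.sh = Φ.sh
  | .nil => rfl
  | .snoc Φ Ψ n => by
    simp [KCtx.toCtx, Ctx.sh, KCtx.sh_toCtx Φ, Decl.sh, Decl.sort, Decl.level, KCtx.sh]

@[simp] theorem Ctx.erase_sh : ∀ Γ : Ctx, Γ.sh.erase = Γ.erase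
  | .nil => by simp [Ctx.sh, Sh.erase, Ctx.erase]
  | .snoc Γ D => by simp [Ctx.sh, Sh.erase, Ctx.erase, Ctx.erase_sh Γ]

mutual
@[simp] theorem Decl.sh_ren (ρ : Ren) : ∀ D : Decl, (D.ren ρ).sh = D.sh
  | .ty Ψ n => by simp [Decl.ren, Decl.sh]
  | .tm Ψ n T => by simp [Decl.ren, Decl.sh, Ctx.sh_ren _ Ψ]
@[simp] theorem Ctx.sh_ren (ρ : Ren) : ∀ Γ : Ctx, (Γ.ren ρ).sh = Γ.sh
  | .nil => by simp [Ctx.ren, Ctx.sh]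
  | .snoc Γ D => by simp [Ctx.ren, Ctx.sh, Ctx.sh_ren _ Γ, Decl.sh_ren _ D]
end

mutual
-- Substitution changes the types in a local context but not its variables. This invariance is what
-- allows scoping to be formulated without types.
@[simp] theorem Decl.sh_subst (ℓ : ℕ) (E : Env) : ∀ D : Decl, (D.subst ℓ E).sh = D.sh
  | .ty Ψ n => by simp [Decl.subst, Decl.sh]
  | .tm Ψ n T => by simp [Decl.subst, Decl.sh, Ctx.sh_subst _ _ Ψ]
@[simp] theorem Ctx.sh_subst (ℓ : ℕ) (E : Env) : ∀ Γ : Ctx, (Γ.subst ℓ E).sh = Γ.sh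
  | .nil => by simp [Ctx.subst, Ctx.sh]
  | .snoc Γ D => by simp [Ctx.subst, Ctx.sh, Ctx.sh_subst _ _ Γ, Decl.sh_subst _ _ D]
end

/-- The shapes of the local contexts of the variables in scope. -/
abbrev SCtx := VarSort → ℕ → ℕ → Option Sh

def SCtx.cons (s : VarSort) (n : ℕ) (Ψ : Sh) (G : SCtx) : SCtx := vcons s n (some Ψ) G

def SCtx.conss (G : SCtx) : Sh → SCtx
  | .nil => G
  | .snoc Δ s n Ψ => (G.conss Δ).cons s n Ψ

def SCtx.enter (n : ℕ) (G : SCtx) : SCtx := fun s k i => if k < n then none else G s k i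

def Sh.look (Ψ : Sh) : SCtx := SCtx.conss (fun _ _ _ => none) Ψ

/-- The scope inside `Ψ ⊢ⁿ -`. -/
def SCtx.loc (G : SCtx) (n : ℕ) (Ψ : Sh) : SCtx :=
  fun s k i => if k < n then Ψ.look s k i else G s k i

def SCtx.precomp (G : SCtx) (ρ : Ren) : SCtx := fun s k i => G s k (ρ s k i)

@[simp] theorem SCtx.cons_zero (s : VarSort) (n : ℕ) (Ψ : Sh) (G : SCtx) :
    G.cons s n Ψ s n 0 = some Ψ := by simp [SCtx.cons]

@[simp] theorem SCtx.cons_wk (s : VarSort) (n : ℕ) (Ψ : Sh) (G : SCtx) (s' : VarSort) (k i : ℕ) :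
    G.cons s n Ψ s' k (Ren.wk s n s' k i) = G s' k i := by simp [SCtx.cons]

theorem SCtx.cons_precomp_lift (s : VarSort) (n : ℕ) (Ψ : Sh) (G : SCtx) (ρ : Ren) :
    (G.cons s n Ψ).precomp (ρ.lift s n) = (G.precomp ρ).cons s n Ψ :=
  vext s n (by simp [SCtx.precomp]) (by simp [SCtx.precomp])

theorem SCtx.cons_precomp_wk (s : VarSort) (n : ℕ) (Ψ : Sh) (G : SCtx) :
    (G.cons s n Ψ).precomp (Ren.wk s n) = G := by
  funext s k i; simp [SCtx.precomp]

theorem SCtx.conss_precomp (Δ : Sh) (G : SCtx) (ρ : Ren) :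
    (G.conss Δ).precomp (ρ.lifts Δ.erase) = (G.precomp ρ).conss Δ := by
  induction Δ with
  | nil => rfl
  | snoc Δ s n Ψ ih _ =>
    simp only [SCtx.conss, ← ih, ← SCtx.cons_precomp_lift]; rfl

theorem SCtx.enter_precomp (n : ℕ) (G : SCtx) (ρ : Ren) :
    (G.enter n).precomp (ρ.enter n) = (G.precomp ρ).enter n := by
  funext s k i
  by_cases h : k < n <;> simp [SCtx.precomp, SCtx.enter, Ren.enter, h]

theorem SCtx.loc_precomp (n : ℕ) (Ψ : Sh) (G : SCtx) (ρ : Ren) :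
    (G.loc n Ψ).precomp (ρ.enter n) = (G.precomp ρ).loc n Ψ := by
  funext s k i
  by_cases h : k < n <;> simp [SCtx.precomp, SCtx.loc, Ren.enter, h]

theorem SCtx.enter_enter {m n : ℕ} (h : m ≤ n) (G : SCtx) : (G.enter m).enter n = G.enter n := by
  funext s k i
  by_cases hk : k < n
  · simp [SCtx.enter, hk]
  · simp [SCtx.enter, hk, show ¬ k < m by omega]

theorem SCtx.enter_loc {m n : ℕ} (h : m ≤ n) (G : SCtx) (Ψ : Sh) :
    (G.enter m).loc n Ψ = G.loc n Ψ := by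
  funext s k i
  by_cases hk : k < n
  · simp [SCtx.loc, hk]
  · simp [SCtx.enter, SCtx.loc, hk, show ¬ k < m by omega]

theorem SCtx.conss_of_look {Ψ : Sh} {s : VarSort} {k i : ℕ} {Φ : Sh} (G : SCtx)
    (h : Ψ.look s k i = some Φ) : G.conss Ψ s k i = some Φ := by
  induction Ψ generalizing i with
  | nil => simp [Sh.look, SCtx.conss] at h
  | snoc Δ s' n Ψ ih _ =>
    obtain ⟨rfl, rfl, rfl⟩ | ⟨j, rfl⟩ := Ren.wk_cases s' n s k i
    · simpa [Sh.look, SCtx.conss] using h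
    · simp only [Sh.look, SCtx.conss, SCtx.cons_wk] at h ⊢
      exact ih h

theorem SCtx.conss_of_le {Ψ : Sh} {n : ℕ} (hΨ : Ψ.erase.LevelLE n) (G : SCtx) {k : ℕ}
    (h : n ≤ k) (s : VarSort) (i : ℕ) : G.conss Ψ s k i = G s k i := by
  induction Ψ with
  | nil => rfl
  | snoc Δ s' m Ψ ih _ =>
    have hm : m < n := hΨ (s', m) (by simp [Sh.erase])
    rw [SCtx.conss, SCtx.cons, vcons_of_ne (by omega)]
    exact ih fun p hp => hΨ p (by simp [Sh.erase, hp])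

/-- The incremental and the pointwise description of the scope inside a local context: since the
local context lies below `n`, it supplies exactly the low part, and the high part is inherited. -/
theorem SCtx.conss_enter {Ψ : Sh} {n : ℕ} (hΨ : Ψ.erase.LevelLE n) (G : SCtx) :
    (G.enter n).conss Ψ = G.loc n Ψ := by
  funext s k i
  by_cases h : k < n
  -- Below `n` both sides search only the local context, whatever its levels are; the level bound is
  -- discarded so that it does not obstruct the induction.
  · simp only [SCtx.loc, h, if_true]
    clear hΨ
    induction Ψ generalizing i with
    | nil => simp [SCtx.conss, SCtx.enter, h, Sh.look]
    | snoc Δ s' m Ψ ih _ =>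
      obtain ⟨rfl, rfl, rfl⟩ | ⟨j, rfl⟩ := Ren.wk_cases s' m s k i
      · simp [SCtx.conss, Sh.look]
      · simpa [Sh.look, SCtx.conss] using ih j
  · rw [SCtx.conss_of_le hΨ _ (by omega)]
    simp [SCtx.loc, SCtx.enter, h]

/-- Only an implication: `conss` keeps the variables of `G` below `n`, which `loc` hides. -/
theorem SCtx.conss_of_loc {Ψ : Sh} {n : ℕ} (hΨ : Ψ.erase.LevelLE n) {G : SCtx} {s : VarSort}
    {k i : ℕ} {Φ : Sh} (h : G.loc n Ψ s k i = some Φ) : G.conss Ψ s k i = some Φ := by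
  by_cases hk : k < n
  · simp only [SCtx.loc, hk, if_true] at h
    exact SCtx.conss_of_look _ h
  · rw [SCtx.conss_of_le hΨ _ (by omega)]
    simpa [SCtx.loc, hk] using h

/-! ## Well-scoped syntax -/

mutual
/-- All variables of `T` are in scope, with substitutions that fit their local contexts. -/
def Ty.Sc (G : SCtx) : Ty → Prop
  | .tvar n i σ => ∃ Ψ, G .ty n i = some Ψ ∧ Ψ.erase.LevelLE n ∧ σ.Sc G Ψ
  | .arr S T => S.Sc G ∧ T.Sc G
  | .all Φ n T => Φ.toCtx.erase.LevelLE n ∧ T.Sc (G.cons .ty n Φ.sh)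
  | .box Φ n T => Φ.erase.LevelLE n ∧ Φ.Sc (G.enter n) ∧ T.Sc (G.loc n Φ.sh)
def Tm.Sc (G : SCtx) : Tm → Prop
  | .var n i σ => ∃ Ψ, G .tm n i = some Ψ ∧ Ψ.erase.LevelLE n ∧ σ.Sc G Ψ
  | .lam e => e.Sc (G.cons .tm 0 .nil)
  | .app e₁ e₂ => e₁.Sc G ∧ e₂.Sc G
  | .tlam n e => ∃ Ψ, e.Sc (G.cons .ty n Ψ)
  | .tapp e Φ n T => e.Sc G ∧ ∃ Ψ : Sh, Φ = Ψ.erase ∧ T.Sc (G.loc n Ψ)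
  | .box Φ n e => ∃ Ψ : Sh, Φ = Ψ.erase ∧ e.Sc (G.loc n Ψ)
  | .letbox Φ n e₁ e₂ => e₁.Sc G ∧ ∃ Ψ : Sh, Φ = Ψ.erase ∧ e₂.Sc (G.cons .tm n Ψ)
def Subst.Sc (G : SCtx) : Subst → Sh → Prop
  | .nil, Δ => Δ = .nil
  | .tm σ Φ n e, Δ => ∃ Δ' Ψ, Δ = .snoc Δ' .tm n Ψ ∧ Φ = Ψ.erase ∧ σ.Sc G Δ' ∧ e.Sc (G.loc n Ψ)
  | .ty σ Φ n T, Δ => ∃ Δ' Ψ, Δ = .snoc Δ' .ty n Ψ ∧ Φ = Ψ.erase ∧ σ.Sc G Δ' ∧ T.Sc (G.loc n Ψ)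
  | .var σ s n i, Δ => ∃ Δ' Ψ, Δ = .snoc Δ' s n Ψ ∧ σ.Sc G Δ' ∧ G s n i = some Ψ
def Decl.Sc (G : SCtx) : Decl → Prop
  | .ty Ψ n => Ψ.toCtx.erase.LevelLE n
  | .tm Ψ n T => Ψ.erase.LevelLE n ∧ Ψ.Sc (G.enter n) ∧ T.Sc (G.loc n Ψ.sh)
def Ctx.Sc (G : SCtx) : Ctx → Prop
  | .nil => True
  | .snoc Γ D => Γ.Sc G ∧ D.Sc (G.conss Γ.sh)
end

mutual
theorem Ty.sc_ren (G : SCtx) (ρ : Ren) : ∀ T : Ty, (T.ren ρ).Sc G ↔ T.Sc (G.precomp ρ)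
  | .tvar n i σ => by simp only [Ty.ren, Ty.Sc, Subst.sc_ren G ρ σ]; rfl
  | .arr S T => by simp [Ty.ren, Ty.Sc, Ty.sc_ren _ _ S, Ty.sc_ren _ _ T]
  | .all Φ n T => by simp [Ty.ren, Ty.Sc, Ty.sc_ren _ _ T, SCtx.cons_precomp_lift]
  | .box Φ n T => by
    simp [Ty.ren, Ty.Sc, Ctx.sc_ren _ _ Φ, Ty.sc_ren _ _ T, SCtx.enter_precomp, SCtx.loc_precomp]
theorem Tm.sc_ren (G : SCtx) (ρ : Ren) : ∀ e : Tm, (e.ren ρ).Sc G ↔ e.Sc (G.precomp ρ)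
  | .var n i σ => by simp only [Tm.ren, Tm.Sc, Subst.sc_ren G ρ σ]; rfl
  | .lam e => by simp [Tm.ren, Tm.Sc, Tm.sc_ren _ _ e, SCtx.cons_precomp_lift]
  | .app e₁ e₂ => by simp [Tm.ren, Tm.Sc, Tm.sc_ren _ _ e₁, Tm.sc_ren _ _ e₂]
  | .tlam n e => by simp [Tm.ren, Tm.Sc, Tm.sc_ren _ _ e, SCtx.cons_precomp_lift]
  | .tapp e Φ n T => by
    simp [Tm.ren, Tm.Sc, Tm.sc_ren _ _ e, Ty.sc_ren _ _ T, SCtx.loc_precomp]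
  | .box Φ n e => by simp [Tm.ren, Tm.Sc, Tm.sc_ren _ _ e, SCtx.loc_precomp]
  | .letbox Φ n e₁ e₂ => by
    simp [Tm.ren, Tm.Sc, Tm.sc_ren _ _ e₁, Tm.sc_ren _ _ e₂, SCtx.cons_precomp_lift]
theorem Subst.sc_ren (G : SCtx) (ρ : Ren) :
    ∀ (σ : Subst) (Δ : Sh), (σ.ren ρ).Sc G Δ ↔ σ.Sc (G.precomp ρ) Δ
  | .nil, Δ => by simp [Subst.ren, Subst.Sc]
  | .tm σ Φ n e, Δ => by
    simp [Subst.ren, Subst.Sc, Subst.sc_ren _ _ σ, Tm.sc_ren _ _ e, SCtx.loc_precomp]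
  | .ty σ Φ n T, Δ => by
    simp [Subst.ren, Subst.Sc, Subst.sc_ren _ _ σ, Ty.sc_ren _ _ T, SCtx.loc_precomp]
  | .var σ s n i, Δ => by simp [Subst.ren, Subst.Sc, Subst.sc_ren _ _ σ, SCtx.precomp]
theorem Decl.sc_ren (G : SCtx) (ρ : Ren) : ∀ D : Decl, (D.ren ρ).Sc G ↔ D.Sc (G.precomp ρ)
  | .ty Ψ n => by simp [Decl.ren, Decl.Sc]
  | .tm Ψ n T => by
    simp [Decl.ren, Decl.Sc, Ctx.sc_ren _ _ Ψ, Ty.sc_ren _ _ T, SCtx.enter_precomp,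
      SCtx.loc_precomp]
theorem Ctx.sc_ren (G : SCtx) (ρ : Ren) : ∀ Γ : Ctx, (Γ.ren ρ).Sc G ↔ Γ.Sc (G.precomp ρ)
  | .nil => by simp [Ctx.ren, Ctx.Sc]
  | .snoc Γ D => by
    simp [Ctx.ren, Ctx.Sc, Ctx.sc_ren _ _ Γ, Decl.sc_ren _ _ D, ← SCtx.conss_precomp]
end

/-! ## Images -/

/-- Substitution in the image of a variable of sort `s` and level `n`. -/
def Img.subst (s : VarSort) (n ℓ : ℕ) (E : Env) : Img → Img
  | .var i => E s n i
  | .ty Φ T => .ty Φ (T.subst ℓ (E.enter n))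
  | .tm Φ e => .tm Φ (e.subst ℓ (E.enter n))

/-- The image of a variable of sort `s` and level `n`, with local context of shape `Ψ`, is well
scoped. -/
def Img.Sc (G : SCtx) (s : VarSort) (n : ℕ) (Ψ : Sh) : Img → Prop
  | .var j => G s n j = some Ψ
  | .ty Φ T => s = .ty ∧ Φ = Ψ.erase ∧ T.Sc (G.loc n Ψ)
  | .tm Φ e => s = .tm ∧ Φ = Ψ.erase ∧ e.Sc (G.loc n Ψ)

theorem Img.Sc.reg {G : SCtx} {s : VarSort} {n : ℕ} {Ψ : Sh} {a : Img} (h : a.Sc G s n Ψ) {ℓ : ℕ}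
    (hn : n < ℓ) : a.Reg ℓ s n := by
  cases a <;> simp_all [Img.Sc, Img.Reg]

theorem Img.sc_ren (G : SCtx) (s : VarSort) (n : ℕ) (Ψ : Sh) (ρ : Ren) (a : Img) :
    (a.ren s n ρ).Sc G s n Ψ ↔ a.Sc (G.precomp ρ) s n Ψ := by
  cases a <;> simp [Img.ren, Img.Sc, Ty.sc_ren, Tm.sc_ren, SCtx.loc_precomp, SCtx.precomp]

theorem Img.ren_ren (s : VarSort) (n : ℕ) (ρ ρ' : Ren) (a : Img) :
    (a.ren s n ρ).ren s n ρ' = a.ren s n (ρ'.comp ρ) := by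
  cases a <;> simp [Img.ren, Ty.ren_ren, Tm.ren_ren, Ren.enter_comp, Ren.comp]

theorem Img.ren_of_enter {s : VarSort} {n : ℕ} {ρ : Ren} (h : ∀ s k i, n ≤ k → ρ s k i = i)
    (a : Img) : a.ren s n ρ = a := by
  have h' : ρ.enter n = Ren.id := by
    funext s k i
    by_cases hk : k < n <;> simp [Ren.enter, Ren.id, hk]
    exact h s k i (by omega)
  cases a <;> simp [Img.ren, h', Ty.ren_id, Tm.ren_id, h]

theorem Img.subst_ren (s : VarSort) (n ℓ : ℕ) {E : Env} (hE : E.Reg ℓ) (ρ : Ren) (a : Img) :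
    (a.ren s n ρ).subst s n ℓ E = a.subst s n ℓ (E.precomp ρ) := by
  cases a <;> simp [Img.ren, Img.subst, Ty.subst_ren _ _ _ (hE.enter _),
    Tm.subst_ren _ _ _ (hE.enter _), Env.enter_precomp, Env.precomp]

theorem Img.subst_env (s : VarSort) (n ℓ : ℕ) (ρ : Ren) (a : Img) :
    a.subst s n ℓ ρ.env = a.ren s n ρ := by
  cases a <;> simp [Img.ren, Img.subst, Ren.env_enter, Ty.subst_env, Tm.subst_env]
  rfl

theorem Img.Reg.subst {ℓ₁ ℓ₂ ℓ : ℕ} (h₁ : ℓ₁ ≤ ℓ) (h₂ : ℓ₂ ≤ ℓ) {s : VarSort} {n : ℕ} {a : Img}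
    (ha : a.Reg ℓ₁ s n) {E : Env} (hE : E.Reg ℓ₂) : (a.subst s n ℓ₂ E).Reg ℓ s n := by
  cases a with
  | var i =>
    have := hE s n i
    revert this
    simp only [Img.subst]
    cases E s n i <;> simp +contextual [Img.Reg] <;> omega
  | ty Φ T => simp_all [Img.subst, Img.Reg]; omega
  | tm Φ T => simp_all [Img.subst, Img.Reg]; omega

/-- Extension of a substitution by the image of a variable of sort `s` and level `n`. -/
def Subst.snoc (σ : Subst) (s : VarSort) (n : ℕ) : Img → Subst
  | .var i => .var σ s n i
  | .ty Φ T => .ty σ Φ n T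
  | .tm Φ e => .tm σ Φ n e

theorem Subst.env_snoc (Φ : ECtx) (σ : Subst) (s : VarSort) (n : ℕ) (a : Img) (Ψ : ECtx) :
    (σ.snoc s n a).env Φ ((s, n) :: Ψ) = (σ.env Φ Ψ).cons s n a := by
  cases a <;> simp [Subst.snoc, Subst.env]

@[simp] theorem Subst.env_nil (Φ : ECtx) : Subst.nil.env Φ [] = (Ren.wks Φ).env := by
  simp [Subst.env]; rfl

@[simp] theorem Ren.wks_nil : Ren.wks [] = Ren.id := by
  funext s k i; simp [Ren.wks, Ren.id]

theorem Subst.ren_snoc (ρ : Ren) (σ : Subst) (s : VarSort) (n : ℕ) (a : Img) :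
    (σ.snoc s n a).ren ρ = (σ.ren ρ).snoc s n (a.ren s n ρ) := by
  cases a <;> simp [Subst.snoc, Subst.ren, Img.ren]

theorem Subst.subst_snoc (ℓ : ℕ) (E : Env) (σ : Subst) (s : VarSort) (n : ℕ) (a : Img) :
    (σ.snoc s n a).subst ℓ E = (σ.subst ℓ E).snoc s n (a.subst s n ℓ E) := by
  cases a with
  | var i =>
    cases h : E s n i <;> simp [Subst.snoc, Subst.subst, Img.subst, h]
  | ty Φ T => simp [Subst.snoc, Subst.subst, Img.subst]
  | tm Φ e => simp [Subst.snoc, Subst.subst, Img.subst]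

theorem Subst.Sc.snoc {G : SCtx} {σ : Subst} {Δ : Sh} {s : VarSort} {n : ℕ} {Ψ : Sh} {a : Img}
    (hσ : σ.Sc G Δ) (ha : a.Sc G s n Ψ) : (σ.snoc s n a).Sc G (.snoc Δ s n Ψ) := by
  cases a with
  | var i => exact ⟨_, _, rfl, hσ, ha⟩
  | ty Φ T => obtain ⟨rfl, h1, h2⟩ := ha; exact ⟨_, _, rfl, h1, hσ, h2⟩
  | tm Φ e => obtain ⟨rfl, h1, h2⟩ := ha; exact ⟨_, _, rfl, h1, hσ, h2⟩

theorem Subst.Sc.exists_snoc {G : SCtx} {σ : Subst} {Δ : Sh} {s : VarSort} {n : ℕ} {Ψ : Sh}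
    (h : σ.Sc G (.snoc Δ s n Ψ)) :
    ∃ (σ' : Subst) (a : Img), σ = σ'.snoc s n a ∧ σ'.Sc G Δ ∧ a.Sc G s n Ψ := by
  cases σ with
  | nil => simp [Subst.Sc] at h
  | tm σ Φ m e =>
    obtain ⟨Δ', Ψ', heq, h1, h2, h3⟩ := h
    cases heq
    exact ⟨σ, .tm Φ e, rfl, h2, rfl, h1, h3⟩
  | ty σ Φ m e =>
    obtain ⟨Δ', Ψ', heq, h1, h2, h3⟩ := h
    cases heq
    exact ⟨σ, .ty Φ e, rfl, h2, rfl, h1, h3⟩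
  | var σ s i n =>
    obtain ⟨Δ', Ψ', heq, h1, h2⟩ := h
    cases heq
    exact ⟨σ, .var n, rfl, h1, h2⟩

theorem Subst.Sc.eq_nil {G : SCtx} {σ : Subst} (h : σ.Sc G .nil) : σ = .nil := by
  cases σ <;> simp [Subst.Sc] at h ⊢

/-- A substitution that fits `Δ`, decomposed along `Δ`. -/
theorem Subst.Sc.rec' {G : SCtx} {P : Subst → Sh → Prop} (hnil : P .nil .nil)
    (hsnoc : ∀ σ Δ s n Ψ a, σ.Sc G Δ → a.Sc G s n Ψ → P σ Δ → P (σ.snoc s n a) (.snoc Δ s n Ψ))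
    {σ : Subst} {Δ : Sh} (h : σ.Sc G Δ) : P σ Δ := by
  induction Δ generalizing σ with
  | nil => rw [h.eq_nil]; exact hnil
  | snoc Δ s n Ψ ih _ =>
    obtain ⟨σ', a, rfl, h1, h2⟩ := h.exists_snoc
    exact hsnoc _ _ _ _ _ _ h1 h2 (ih h1)

theorem Env.Reg.cons {ℓ : ℕ} {E : Env} (h : E.Reg ℓ) {s : VarSort} {n : ℕ} {a : Img}
    (ha : a.Reg ℓ s n) : (E.cons s n a).Reg ℓ := by
  intro s' k i
  obtain ⟨rfl, rfl, rfl⟩ | ⟨j, rfl⟩ := Ren.wk_cases s n s' k i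
  · simpa [Env.cons_eq] using ha
  · simpa [Env.cons_eq] using h s' k j

theorem Subst.Sc.env_reg {G : SCtx} {σ : Subst} {Δ : Sh} (h : σ.Sc G Δ) {ℓ : ℕ}
    (hΔ : Δ.erase.LevelLE ℓ) (Φ : ECtx) : (σ.env Φ Δ.erase).Reg ℓ := by
  revert hΔ
  refine h.rec' (P := fun σ Δ => Δ.erase.LevelLE ℓ → (σ.env Φ Δ.erase).Reg ℓ) ?_ ?_
  · intro _; simpa [Sh.erase] using Ren.env_reg _ _
  · intro σ Δ s n Ψ a _ ha ih hΔ
    rw [Sh.erase, Subst.env_snoc]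
    exact (ih fun p hp => hΔ p (by simp [Sh.erase, hp])).cons
      (ha.reg (hΔ (s, n) (by simp [Sh.erase])))

/-! ## Well-scoped environments -/

/-- `E` maps the variables in scope in `G` to well-scoped images in `G'`. -/
def Env.Sc (G : SCtx) (E : Env) (G' : SCtx) : Prop :=
  ∀ s n i Ψ, G s n i = some Ψ → (E s n i).Sc G' s n Ψ

theorem Env.Sc.lift {G G' : SCtx} {E : Env} (h : E.Sc G G') (s : VarSort) (n : ℕ) (Ψ : Sh) :
    (E.lift s n).Sc (G.cons s n Ψ) (G'.cons s n Ψ) := by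
  intro s' k i Φ hi
  obtain ⟨rfl, rfl, rfl⟩ | ⟨j, rfl⟩ := Ren.wk_cases s n s' k i
  · simpa [Img.Sc] using hi
  · rw [Env.lift_wk, Img.sc_ren, SCtx.cons_precomp_wk]
    exact h _ _ _ _ (by simpa using hi)

theorem Env.Sc.lifts {G G' : SCtx} {E : Env} (h : E.Sc G G') (Ψ : Sh) :
    (E.lifts Ψ.erase).Sc (G.conss Ψ) (G'.conss Ψ) := by
  induction Ψ with
  | nil => exact h
  | snoc Δ s n Ψ ih _ => exact ih.lift s n Ψ

/-- The body of an image of level `k` takes all variables below `k` from its own local context, so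
replacing the ambient variables below `n ≤ k` cannot be noticed by it. -/
theorem Img.Sc.loc {G : SCtx} {s : VarSort} {k : ℕ} {Φ : Sh} {a : Img}
    (h : a.Sc G s k Φ) {n : ℕ} (hn : n ≤ k) (Ψ : Sh) : a.Sc (G.loc n Ψ) s k Φ := by
  have : (G.loc n Ψ).loc k Φ = G.loc k Φ := by
    funext s' k' i
    by_cases hk : k' < k
    · simp [SCtx.loc, hk]
    · simp [SCtx.loc, hk, show ¬ k' < n by omega]
  cases a <;> simp_all [Img.Sc]
  simpa [SCtx.loc, show ¬ k < n by omega] using h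

theorem Env.Sc.loc {G G' : SCtx} {E : Env} (h : E.Sc G G') (n : ℕ) (Ψ : Sh) :
    (E.enter n).Sc (G.loc n Ψ) (G'.loc n Ψ) := by
  intro s k i Φ hi
  by_cases hk : k < n
  · simp only [SCtx.loc, hk, if_true] at hi
    simpa [Env.enter, SCtx.loc, hk, Img.Sc] using hi
  · simp only [SCtx.loc, hk, if_false] at hi
    simp only [Env.enter, hk, if_false]
    exact (h _ _ _ _ hi).loc (by omega) _

theorem SCtx.loc_nil (G : SCtx) (n : ℕ) : G.loc n .nil = G.enter n := by
  funext s k i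
  simp [SCtx.loc, SCtx.enter, Sh.look, SCtx.conss]

theorem Env.Sc.enter {G G' : SCtx} {E : Env} (h : E.Sc G G') (n : ℕ) :
    (E.enter n).Sc (G.enter n) (G'.enter n) := by
  simpa only [SCtx.loc_nil] using h.loc n .nil

theorem Subst.Sc.env_sc {G : SCtx} {σ : Subst} {Δ : Sh} (h : σ.Sc G Δ) :
    (σ.env [] Δ.erase).Sc (G.conss Δ) G := by
  refine h.rec' (P := fun σ Δ => (σ.env [] Δ.erase).Sc (G.conss Δ) G) ?_ ?_
  · intro s n i Ψ hi
    simpa [Sh.erase, Ren.env, Ren.id, Img.Sc, SCtx.conss] using hi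
  · intro σ Δ s n Ψ a _ ha ih
    rw [Sh.erase, Subst.env_snoc]
    intro s' k i Φ hi
    obtain ⟨rfl, rfl, rfl⟩ | ⟨j, rfl⟩ := Ren.wk_cases s n s' k i
    · simp only [SCtx.conss, SCtx.cons_zero, Option.some.injEq] at hi
      subst hi
      simpa [Env.cons_eq] using ha
    · simpa [Env.cons_eq] using ih _ _ _ _ (by simpa [SCtx.conss] using hi)

theorem Env.Sc.mono {G₁ G G' : SCtx} {E : Env} (h : E.Sc G G')
    (hG : ∀ s n i Ψ, G₁ s n i = some Ψ → G s n i = some Ψ) : E.Sc G₁ G' :=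
  fun s n i Ψ hi => h s n i Ψ (hG _ _ _ _ hi)

theorem Subst.Sc.env_sc_loc {G : SCtx} {σ : Subst} {Δ : Sh} (h : σ.Sc G Δ) {n : ℕ}
    (hΔ : Δ.erase.LevelLE n) : (σ.env [] Δ.erase).Sc (G.loc n Δ) G :=
  h.env_sc.mono fun _ _ _ _ => SCtx.conss_of_loc hΔ

/-! ## Environments that agree -/

/-- Equality on the variables in scope only. The environments compared below, such as `lifts` and
`enter`, can differ on variables that do not exist. -/
def Env.Agree (G : SCtx) (E E' : Env) : Prop := ∀ s n i Ψ, G s n i = some Ψ → E s n i = E' s n i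

theorem Env.Agree.lift {G : SCtx} {E E' : Env} (h : Env.Agree G E E') (s : VarSort) (n : ℕ)
    (Ψ : Sh) : Env.Agree (G.cons s n Ψ) (E.lift s n) (E'.lift s n) := by
  intro s' k i Φ hi
  obtain ⟨rfl, rfl, rfl⟩ | ⟨j, rfl⟩ := Ren.wk_cases s n s' k i
  · simp
  · rw [Env.lift_wk, Env.lift_wk, h _ _ _ _ (by simpa using hi)]

theorem Env.Agree.lifts {G : SCtx} {E E' : Env} (h : Env.Agree G E E') (Ψ : Sh) :
    Env.Agree (G.conss Ψ) (E.lifts Ψ.erase) (E'.lifts Ψ.erase) := by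
  induction Ψ with
  | nil => exact h
  | snoc Δ s n Ψ ih _ => exact ih.lift s n Ψ

theorem Env.Agree.loc {G : SCtx} {E E' : Env} (h : Env.Agree G E E') (n : ℕ) (Ψ : Sh) :
    Env.Agree (G.loc n Ψ) (E.enter n) (E'.enter n) := by
  intro s k i Φ hi
  by_cases hk : k < n
  · simp [Env.enter, hk]
  · simp only [SCtx.loc, hk, if_false] at hi
    simpa [Env.enter, hk] using h _ _ _ _ hi

theorem Env.Agree.enter {G : SCtx} {E E' : Env} (h : Env.Agree G E E') (n : ℕ) :
    Env.Agree (G.enter n) (E.enter n) (E'.enter n) := by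
  simpa only [SCtx.loc_nil] using h.loc n .nil

theorem Env.lifts_of_look {Ψ : Sh} {s : VarSort} {k i : ℕ} {Φ : Sh} (E : Env)
    (h : Ψ.look s k i = some Φ) : E.lifts Ψ.erase s k i = .var i := by
  induction Ψ generalizing i with
  | nil => simp [Sh.look, SCtx.conss] at h
  | snoc Δ s' n Ψ ih _ =>
    change (Env.lift s' n (E.lifts Δ.erase)) s k i = _
    obtain ⟨rfl, rfl, rfl⟩ | ⟨j, rfl⟩ := Ren.wk_cases s' n s k i
    · simp
    · rw [Env.lift_wk, ih (by simpa [Sh.look, SCtx.conss] using h)]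
      rfl

theorem Env.lifts_of_le {Ψ : ECtx} {n : ℕ} (hΨ : Ψ.LevelLE n) (E : Env) {k : ℕ}
    (h : n ≤ k) (s : VarSort) (i : ℕ) : E.lifts Ψ s k i = E s k i := by
  induction Ψ generalizing i with
  | nil => rfl
  | cons p Ψ ih =>
    have hm : p.2 < n := hΨ p (by simp)
    change (Env.lift p.1 p.2 (E.lifts Ψ)) s k i = _
    have : i = Ren.wk p.1 p.2 s k i := by simp [Ren.wk, show k ≠ p.2 by omega]
    rw [this, Env.lift_wk, ih (fun p hp => hΨ p (by simp [hp])), ← this]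
    apply Img.ren_of_enter
    intro s' k' i hk
    simp [Ren.wk, show k' ≠ p.2 by omega]

/-- Two ways of entering a local context: binder by binder, or by chopping and adding the identity.
Below `n` only local variables are in scope, and both fix them. From `n` on, lifting merely weakens
the images by variables of level below `n`, which leaves these images unchanged. -/
theorem Env.lifts_agree_enter {Ψ : Sh} {n : ℕ} (hΨ : Ψ.erase.LevelLE n) (E : Env) (G : SCtx) :
    Env.Agree (G.loc n Ψ) (E.lifts Ψ.erase) (E.enter n) := by
  intro s k i Φ hi
  by_cases hk : k < n
  · simp only [SCtx.loc, hk, if_true] at hi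
    rw [Env.lifts_of_look E hi]
    simp [Env.enter, hk]
  · rw [Env.lifts_of_le hΨ E (by omega)]
    simp [Env.enter, hk]

-- Independence of the level parameter and of values outside the scope

mutual
-- The level serves as a bound for termination and has no influence on the result: whenever an
-- object replaces a variable of level `n`, regularity gives both `n < ℓ` and `n < ℓ'`, and the
-- nested substitution is performed at level `n` on both sides.
theorem Ty.subst_congr {ℓ ℓ' : ℕ} {G : SCtx} {E E' : Env} (hE : E.Reg ℓ) (hE' : E'.Reg ℓ')
    (h : Env.Agree G E E') : ∀ T : Ty, T.Sc G → T.subst ℓ E = T.subst ℓ' E'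
  | .tvar n i σ, ⟨Ψ, h1, h2, h3⟩ => by
    have hr := hE .ty n i
    have hr' := hE' .ty n i
    rw [Ty.subst, Ty.subst, Subst.subst_congr hE hE' h σ _ h3]
    rw [← h _ _ _ _ h1] at hr' ⊢
    generalize E .ty n i = a at hr hr'
    cases a <;> simp_all [Img.Reg]
  | .arr S T, ⟨h1, h2⟩ => by
    simp [Ty.subst, Ty.subst_congr hE hE' h S h1, Ty.subst_congr hE hE' h T h2]
  | .all Φ n T, ⟨h1, h2⟩ => by
    simp [Ty.subst, Ty.subst_congr (hE.lift _ _) (hE'.lift _ _) (h.lift _ _ _) T h2]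
  | .box Φ n T, ⟨h1, h2, h3⟩ => by
    simp [Ty.subst, Ty.subst_congr (hE.enter _) (hE'.enter _) (h.loc _ _) T h3,
      Ctx.subst_congr (hE.enter _) (hE'.enter _) (h.enter _) Φ h2]
theorem Tm.subst_congr {ℓ ℓ' : ℕ} {G : SCtx} {E E' : Env} (hE : E.Reg ℓ) (hE' : E'.Reg ℓ')
    (h : Env.Agree G E E') : ∀ e : Tm, e.Sc G → e.subst ℓ E = e.subst ℓ' E'
  | .var n i σ, ⟨Ψ, h1, h2, h3⟩ => by
    have hr := hE .tm n i
    have hr' := hE' .tm n i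
    rw [Tm.subst, Tm.subst, Subst.subst_congr hE hE' h σ _ h3]
    rw [← h _ _ _ _ h1] at hr' ⊢
    generalize E .tm n i = a at hr hr'
    cases a <;> simp_all [Img.Reg]
  | .lam e, h1 => by
    simp [Tm.subst, Tm.subst_congr (hE.lift _ _) (hE'.lift _ _) (h.lift _ _ _) e h1]
  | .app e₁ e₂, ⟨h1, h2⟩ => by
    simp [Tm.subst, Tm.subst_congr hE hE' h e₁ h1, Tm.subst_congr hE hE' h e₂ h2]
  | .tlam n e, ⟨Ψ, h1⟩ => by
    simp [Tm.subst, Tm.subst_congr (hE.lift _ _) (hE'.lift _ _) (h.lift _ _ _) e h1]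
  | .tapp e Φ n T, ⟨h1, Ψ, _, h2⟩ => by
    simp [Tm.subst, Ty.subst_congr (hE.enter _) (hE'.enter _) (h.loc _ _) T h2,
      Tm.subst_congr hE hE' h e h1]
  | .box Φ n e, ⟨Ψ, _, h2⟩ => by
    simp [Tm.subst, Tm.subst_congr (hE.enter _) (hE'.enter _) (h.loc _ _) e h2]
  | .letbox Φ n e₁ e₂, ⟨h1, Ψ, _, h2⟩ => by
    simp [Tm.subst, Tm.subst_congr (hE.lift _ _) (hE'.lift _ _) (h.lift _ _ _) e₂ h2,
      Tm.subst_congr hE hE' h e₁ h1]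
theorem Subst.subst_congr {ℓ ℓ' : ℕ} {G : SCtx} {E E' : Env} (hE : E.Reg ℓ) (hE' : E'.Reg ℓ')
    (h : Env.Agree G E E') : ∀ (σ : Subst) (Δ : Sh), σ.Sc G Δ → σ.subst ℓ E = σ.subst ℓ' E'
  | .nil, _, _ => by simp [Subst.subst]
  | .tm σ Φ n e, _, ⟨Δ, Ψ, _, _, h1, h2⟩ => by
    simp [Subst.subst, Subst.subst_congr hE hE' h σ _ h1,
      Tm.subst_congr (hE.enter _) (hE'.enter _) (h.loc _ _) e h2]
  | .ty σ Φ n T, _, ⟨Δ, Ψ, _, _, h1, h2⟩ => by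
    simp [Subst.subst, Subst.subst_congr hE hE' h σ _ h1,
      Ty.subst_congr (hE.enter _) (hE'.enter _) (h.loc _ _) T h2]
  | .var σ s n i, _, ⟨Δ, Ψ, _, h1, h2⟩ => by
    simp only [Subst.subst, Subst.subst_congr hE hE' h σ _ h1, h _ _ _ _ h2]
theorem Decl.subst_congr {ℓ ℓ' : ℕ} {G : SCtx} {E E' : Env} (hE : E.Reg ℓ) (hE' : E'.Reg ℓ')
    (h : Env.Agree G E E') : ∀ D : Decl, D.Sc G → D.subst ℓ E = D.subst ℓ' E'
  | .ty Ψ n, _ => by simp [Decl.subst]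
  | .tm Ψ n T, ⟨h1, h2, h3⟩ => by
    simp [Decl.subst, Ty.subst_congr (hE.enter _) (hE'.enter _) (h.loc _ _) T h3,
      Ctx.subst_congr (hE.enter _) (hE'.enter _) (h.enter _) Ψ h2]
theorem Ctx.subst_congr {ℓ ℓ' : ℕ} {G : SCtx} {E E' : Env} (hE : E.Reg ℓ) (hE' : E'.Reg ℓ')
    (h : Env.Agree G E E') : ∀ Γ : Ctx, Γ.Sc G → Γ.subst ℓ E = Γ.subst ℓ' E'
  | .nil, _ => by simp [Ctx.subst]
  | .snoc Γ D, ⟨h1, h2⟩ => by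
    have h' := h.lifts Γ.sh
    rw [Ctx.erase_sh] at h'
    simp [Ctx.subst, Ctx.subst_congr hE hE' h Γ h1,
      Decl.subst_congr (hE.lifts _) (hE'.lifts _) h' D h2]
end

/-! ## Substitution preserves scoping -/

/-- Substitutions whose domain has level `ℓ` preserve scoping. -/
def SubstSc (ℓ : ℕ) : Prop :=
  (∀ (G G' : SCtx) (E : Env) (T : Ty), E.Reg ℓ → E.Sc G G' → T.Sc G → (T.subst ℓ E).Sc G') ∧
  (∀ (G G' : SCtx) (E : Env) (e : Tm), E.Reg ℓ → E.Sc G G' → e.Sc G → (e.subst ℓ E).Sc G')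

mutual
-- Structural induction with the smaller levels as a hypothesis. Only a replaced variable uses it:
-- the substituted `σ` is an environment of level `n` on the scope of the replacing object.
theorem Ty.sc_subst_of {ℓ : ℕ} (ih : ∀ n < ℓ, SubstSc n) {G G' : SCtx} {E : Env}
    (hr : E.Reg ℓ) (hE : E.Sc G G') : ∀ T : Ty, T.Sc G → (T.subst ℓ E).Sc G'
  | .tvar n i σ, ⟨Ψ, h1, h2, h3⟩ => by
    have hσ := Subst.sc_subst_of ih hr hE σ _ h3
    have hi := hE _ _ _ _ h1
    have hr' := hr .ty n i
    rw [Ty.subst]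
    generalize E .ty n i = a at hi hr'
    cases a with
    | var j => exact ⟨Ψ, hi, h2, hσ⟩
    | ty Φ T =>
      obtain ⟨_, rfl, hT⟩ := hi
      simp only [hr'.2, if_true]
      exact (ih n hr'.2).1 _ _ _ T (hσ.env_reg h2 _) (hσ.env_sc_loc h2) hT
    | tm Φ e => simp [Img.Sc] at hi
  | .arr S T, ⟨h1, h2⟩ => by
    rw [Ty.subst]
    exact ⟨Ty.sc_subst_of ih hr hE S h1, Ty.sc_subst_of ih hr hE T h2⟩
  | .all Φ n T, ⟨h1, h2⟩ => by
    rw [Ty.subst]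
    exact ⟨h1, Ty.sc_subst_of ih (hr.lift _ _) (hE.lift _ _ _) T h2⟩
  | .box Φ n T, ⟨h1, h2, h3⟩ => by
    rw [Ty.subst]
    refine ⟨by simpa using h1, Ctx.sc_subst_of ih (hr.enter _) (hE.enter _) Φ h2, ?_⟩
    rw [Ctx.sh_subst]
    exact Ty.sc_subst_of ih (hr.enter _) (hE.loc _ _) T h3
theorem Tm.sc_subst_of {ℓ : ℕ} (ih : ∀ n < ℓ, SubstSc n) {G G' : SCtx} {E : Env}
    (hr : E.Reg ℓ) (hE : E.Sc G G') : ∀ e : Tm, e.Sc G → (e.subst ℓ E).Sc G'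
  | .var n i σ, ⟨Ψ, h1, h2, h3⟩ => by
    have hσ := Subst.sc_subst_of ih hr hE σ _ h3
    have hi := hE _ _ _ _ h1
    have hr' := hr .tm n i
    rw [Tm.subst]
    generalize E .tm n i = a at hi hr'
    cases a with
    | var j => exact ⟨Ψ, hi, h2, hσ⟩
    | tm Φ e =>
      obtain ⟨_, rfl, hT⟩ := hi
      simp only [hr'.2, if_true]
      exact (ih n hr'.2).2 _ _ _ e (hσ.env_reg h2 _) (hσ.env_sc_loc h2) hT
    | ty Φ T => simp [Img.Sc] at hi
  | .lam e, h1 => by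
    rw [Tm.subst]
    exact Tm.sc_subst_of ih (hr.lift _ _) (hE.lift _ _ _) e h1
  | .app e₁ e₂, ⟨h1, h2⟩ => by
    rw [Tm.subst]
    exact ⟨Tm.sc_subst_of ih hr hE e₁ h1, Tm.sc_subst_of ih hr hE e₂ h2⟩
  | .tlam n e, ⟨Ψ, h1⟩ => by
    rw [Tm.subst]
    exact ⟨Ψ, Tm.sc_subst_of ih (hr.lift _ _) (hE.lift _ _ _) e h1⟩
  | .tapp e Φ n T, ⟨h1, Ψ, h2, h3⟩ => by
    rw [Tm.subst]
    exact ⟨Tm.sc_subst_of ih hr hE e h1, Ψ, h2, Ty.sc_subst_of ih (hr.enter _) (hE.loc _ _) T h3⟩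
  | .box Φ n e, ⟨Ψ, h2, h3⟩ => by
    rw [Tm.subst]
    exact ⟨Ψ, h2, Tm.sc_subst_of ih (hr.enter _) (hE.loc _ _) e h3⟩
  | .letbox Φ n e₁ e₂, ⟨h1, Ψ, h2, h3⟩ => by
    rw [Tm.subst]
    exact ⟨Tm.sc_subst_of ih hr hE e₁ h1, Ψ, h2,
      Tm.sc_subst_of ih (hr.lift _ _) (hE.lift _ _ _) e₂ h3⟩
theorem Subst.sc_subst_of {ℓ : ℕ} (ih : ∀ n < ℓ, SubstSc n) {G G' : SCtx} {E : Env}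
    (hr : E.Reg ℓ) (hE : E.Sc G G') :
    ∀ (σ : Subst) (Δ : Sh), σ.Sc G Δ → (σ.subst ℓ E).Sc G' Δ
  | .nil, _, h => by
    rw [Subst.subst]; exact h
  | .tm σ Φ n e, _, ⟨Δ, Ψ, h1, h2, h3, h4⟩ => by
    rw [Subst.subst]
    exact ⟨Δ, Ψ, h1, h2, Subst.sc_subst_of ih hr hE σ _ h3,
      Tm.sc_subst_of ih (hr.enter _) (hE.loc _ _) e h4⟩
  | .ty σ Φ n T, _, ⟨Δ, Ψ, h1, h2, h3, h4⟩ => by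
    rw [Subst.subst]
    exact ⟨Δ, Ψ, h1, h2, Subst.sc_subst_of ih hr hE σ _ h3,
      Ty.sc_subst_of ih (hr.enter _) (hE.loc _ _) T h4⟩
  | .var σ s n i, _, ⟨Δ, Ψ, h1, h3, h4⟩ => by
    have := Subst.subst_snoc ℓ E σ s n (.var i)
    rw [Subst.snoc] at this
    rw [this, h1]
    exact (Subst.sc_subst_of ih hr hE σ _ h3).snoc (hE _ _ _ _ h4)
theorem Decl.sc_subst_of {ℓ : ℕ} (ih : ∀ n < ℓ, SubstSc n) {G G' : SCtx} {E : Env}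
    (hr : E.Reg ℓ) (hE : E.Sc G G') : ∀ D : Decl, D.Sc G → (D.subst ℓ E).Sc G'
  | .ty Ψ n, h => by
    rw [Decl.subst]; exact h
  | .tm Φ n T, ⟨h1, h2, h3⟩ => by
    rw [Decl.subst]
    refine ⟨by simpa using h1, Ctx.sc_subst_of ih (hr.enter _) (hE.enter _) Φ h2, ?_⟩
    rw [Ctx.sh_subst]
    exact Ty.sc_subst_of ih (hr.enter _) (hE.loc _ _) T h3
theorem Ctx.sc_subst_of {ℓ : ℕ} (ih : ∀ n < ℓ, SubstSc n) {G G' : SCtx} {E : Env}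
    (hr : E.Reg ℓ) (hE : E.Sc G G') : ∀ Γ : Ctx, Γ.Sc G → (Γ.subst ℓ E).Sc G'
  | .nil, _ => by
    rw [Ctx.subst]; trivial
  | .snoc Γ D, ⟨h1, h2⟩ => by
    rw [Ctx.subst]
    refine ⟨Ctx.sc_subst_of ih hr hE Γ h1, ?_⟩
    have h' := hE.lifts Γ.sh
    rw [Ctx.erase_sh] at h'
    rw [Ctx.sh_subst]
    exact Decl.sc_subst_of ih (hr.lifts _) h' D h2
end

theorem substSc (ℓ : ℕ) : SubstSc ℓ := by
  induction ℓ using Nat.strong_induction_on with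
  | _ ℓ ih =>
    exact ⟨fun _ _ _ T hr hE h => Ty.sc_subst_of ih hr hE T h,
      fun _ _ _ e hr hE h => Tm.sc_subst_of ih hr hE e h⟩

theorem Ty.Sc.subst {ℓ : ℕ} {G G' : SCtx} {E : Env} {T : Ty} (h : T.Sc G) (hr : E.Reg ℓ)
    (hE : E.Sc G G') : (T.subst ℓ E).Sc G' :=
  Ty.sc_subst_of (fun n _ => substSc n) hr hE T h

theorem Tm.Sc.subst {ℓ : ℕ} {G G' : SCtx} {E : Env} {e : Tm} (h : e.Sc G) (hr : E.Reg ℓ)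
    (hE : E.Sc G G') : (e.subst ℓ E).Sc G' :=
  Tm.sc_subst_of (fun n _ => substSc n) hr hE e h

theorem Subst.Sc.subst {ℓ : ℕ} {G G' : SCtx} {E : Env} {σ : Subst} {Δ : Sh} (h : σ.Sc G Δ)
    (hr : E.Reg ℓ) (hE : E.Sc G G') : (σ.subst ℓ E).Sc G' Δ :=
  Subst.sc_subst_of (fun n _ => substSc n) hr hE σ Δ h

theorem Decl.Sc.subst {ℓ : ℕ} {G G' : SCtx} {E : Env} {D : Decl} (h : D.Sc G)
    (hr : E.Reg ℓ) (hE : E.Sc G G') : (D.subst ℓ E).Sc G' :=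
  Decl.sc_subst_of (fun n _ => substSc n) hr hE D h

theorem Ctx.Sc.subst {ℓ : ℕ} {G G' : SCtx} {E : Env} {Γ : Ctx} (h : Γ.Sc G)
    (hr : E.Reg ℓ) (hE : E.Sc G G') : (Γ.subst ℓ E).Sc G' :=
  Ctx.sc_subst_of (fun n _ => substSc n) hr hE Γ h

/-! ## Renaming after substitution -/

/-- An environment followed by a renaming. -/
def Env.postren (E : Env) (ρ : Ren) : Env := fun s k i => (E s k i).ren s k ρ

theorem Env.Reg.postren {ℓ : ℕ} {E : Env} (h : E.Reg ℓ) (ρ : Ren) : (E.postren ρ).Reg ℓ :=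
  fun s k i => (h s k i).ren _ _ _

theorem Ren.lift_comp_wk (s : VarSort) (n : ℕ) (ρ : Ren) :
    (ρ.lift s n).comp (Ren.wk s n) = (Ren.wk s n).comp ρ := by
  funext s' k i; simp [Ren.comp]

theorem Env.lift_postren (s : VarSort) (n : ℕ) (E : Env) (ρ : Ren) :
    (E.postren ρ).lift s n = (E.lift s n).postren (ρ.lift s n) :=
  vext s n (by simp [Env.postren, Img.ren])
    (by simp [Env.postren, Img.ren_ren, Ren.lift_comp_wk])

theorem Env.lifts_postren (Φ : ECtx) (E : Env) (ρ : Ren) :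
    (E.postren ρ).lifts Φ = (E.lifts Φ).postren (ρ.lifts Φ) := by
  induction Φ with
  | nil => rfl
  | cons p Φ ih => simp_all [Ren.lifts, Env.lifts, Env.lift_postren]

theorem Img.ren_enter {n k : ℕ} (h : n ≤ k) (s : VarSort) (ρ : Ren) (a : Img) :
    a.ren s k (ρ.enter n) = a.ren s k ρ := by
  cases a <;> simp [Img.ren, Ren.enter_enter h]
  simp [Ren.enter, show ¬ k < n by omega]

theorem Env.enter_postren (n : ℕ) (E : Env) (ρ : Ren) :
    (E.postren ρ).enter n = (E.enter n).postren (ρ.enter n) := by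
  funext s k i
  by_cases h : k < n
  · simp [Env.enter, Ren.enter, Env.postren, h, Img.ren]
  · simp [Env.enter, Env.postren, h, Img.ren_enter (not_lt.1 h)]

/-- Naturality of `σ/Δ̂`: renaming its result amounts to renaming under `Δ̂` and then using the
renamed `σ`. -/
theorem Subst.Sc.env_postren {G : SCtx} {σ : Subst} {Δ : Sh} (h : σ.Sc G Δ) (ρ : Ren) :
    (σ.env [] Δ.erase).postren ρ =
      Env.precomp ((σ.ren ρ).env [] Δ.erase) (ρ.lifts Δ.erase) := by
  refine h.rec' (P := fun σ Δ => (σ.env [] Δ.erase).postren ρ =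
    Env.precomp ((σ.ren ρ).env [] Δ.erase) (ρ.lifts Δ.erase)) ?_ ?_
  · funext s k i
    simp [Sh.erase, Env.postren, Ren.env, Img.ren, Subst.ren, Env.precomp, Ren.id, Ren.lifts]
  · intro σ Δ s n Ψ a _ _ ih
    rw [Subst.ren_snoc, Sh.erase, Subst.env_snoc, Subst.env_snoc]
    refine vext s n ?_ fun s' k i => ?_
    · simp [Env.postren, Env.precomp, Ren.lifts, Env.cons_eq]
    · have := congrFun (congrFun (congrFun ih s') k) i
      simpa [Env.postren, Env.precomp, Ren.lifts, Env.cons_eq] using this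

theorem Ren.lifts_eq_enter {Ψ : Sh} {n : ℕ} (hΨ : Ψ.erase.LevelLE n) (ρ : Ren) {G : SCtx}
    {s : VarSort} {k i : ℕ} {Φ : Sh} (h : G.loc n Ψ s k i = some Φ) :
    ρ.lifts Ψ.erase s k i = ρ.enter n s k i := by
  have := Env.lifts_agree_enter hΨ ρ.env G _ _ _ _ h
  rw [Ren.env_lifts, Ren.env_enter] at this
  simpa [Ren.env] using this

/-- Renaming commutes with substitutions whose domain has level `ℓ`. -/
def RenSubst (ℓ : ℕ) : Prop :=
  (∀ (G G' : SCtx) (E : Env) (ρ : Ren) (T : Ty), E.Reg ℓ → E.Sc G G' → T.Sc G →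
    (T.subst ℓ E).ren ρ = T.subst ℓ (E.postren ρ)) ∧
  (∀ (G G' : SCtx) (E : Env) (ρ : Ren) (e : Tm), E.Reg ℓ → E.Sc G G' → e.Sc G →
    (e.subst ℓ E).ren ρ = e.subst ℓ (E.postren ρ))

theorem Subst.Sc.agree_postren {G : SCtx} {σ : Subst} {Ψ : Sh} (h : σ.Sc G Ψ) {n : ℕ}
    (hΨ : Ψ.erase.LevelLE n) (ρ : Ren) :
    Env.Agree (G.loc n Ψ) ((σ.env [] Ψ.erase).postren ρ)
      (Env.precomp ((σ.ren ρ).env [] Ψ.erase) (ρ.enter n)) := by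
  intro s k i Φ hi
  rw [h.env_postren]
  simp only [Env.precomp, Ren.lifts_eq_enter hΨ ρ hi]

theorem Env.Reg.precomp {ℓ : ℕ} {E : Env} (h : E.Reg ℓ) (ρ : Ren) : (E.precomp ρ).Reg ℓ :=
  fun s k i => h s k (ρ s k i)

theorem Subst.env_reg_of_ren {G : SCtx} {σ : Subst} {Ψ : Sh} (h : σ.Sc G Ψ) {n : ℕ}
    (hΨ : Ψ.erase.LevelLE n) (ρ : Ren) : ((σ.ren ρ).env [] Ψ.erase).Reg n := by
  revert hΨ
  refine h.rec' (P := fun σ Ψ => Ψ.erase.LevelLE n → ((σ.ren ρ).env [] Ψ.erase).Reg n) ?_ ?_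
  · intro _; simpa [Sh.erase, Subst.ren] using Ren.env_reg _ _
  · intro σ Δ s m Ψ a _ ha ih hΔ
    rw [Sh.erase, Subst.ren_snoc, Subst.env_snoc]
    exact (ih fun p hp => hΔ p (by simp [Sh.erase, hp])).cons
      ((ha.reg (hΔ (s, m) (by simp [Sh.erase]))).ren _ _ _)

mutual
-- At a replaced variable both sides become substitutions of level `n` in the same object: the left
-- by the induction hypothesis, the right by absorbing the renaming of the object into the
-- environment. These environments agree in scope by `Subst.Sc.agree_postren`.
theorem Ty.ren_subst_of {ℓ : ℕ} (ih : ∀ n < ℓ, RenSubst n) {G G' : SCtx} {E : Env}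
    (ρ : Ren) (hr : E.Reg ℓ) (hE : E.Sc G G') :
    ∀ T : Ty, T.Sc G → (T.subst ℓ E).ren ρ = T.subst ℓ (E.postren ρ)
  | .tvar n i σ, ⟨Ψ, h1, h2, h3⟩ => by
    have hσ := h3.subst hr hE
    have hi := hE _ _ _ _ h1
    have hr' := hr .ty n i
    rw [Ty.subst, Ty.subst, ← Subst.ren_subst_of ih ρ hr hE σ _ h3, Env.postren]
    generalize E .ty n i = a at hi hr'
    cases a with
    | var j => simp [Img.ren, Ty.ren]
    | ty Φ T =>
      obtain ⟨_, rfl, hT⟩ := hi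
      simp only [hr'.2, if_true, Img.ren]
      have hσ' := (hσ.env_reg h2 [])
      have hreg := Subst.env_reg_of_ren hσ h2 ρ
      rw [(ih n hr'.2).1 _ _ _ ρ T hσ' (hσ.env_sc_loc h2) hT, Ty.subst_ren _ _ _ hreg]
      exact Ty.subst_congr (hσ'.postren _) (hreg.precomp _) (hσ.agree_postren h2 ρ) T hT
    | tm Φ e => simp [Img.Sc] at hi
  | .arr S T, ⟨h1, h2⟩ => by
    simp [Ty.subst, Ty.ren, Ty.ren_subst_of ih ρ hr hE S h1, Ty.ren_subst_of ih ρ hr hE T h2]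
  | .all Φ n T, ⟨h1, h2⟩ => by
    simp [Ty.subst, Ty.ren, Ty.ren_subst_of ih _ (hr.lift _ _) (hE.lift _ _ _) T h2,
      Env.lift_postren]
  | .box Φ n T, ⟨h1, h2, h3⟩ => by
    simp [Ty.subst, Ty.ren, Ty.ren_subst_of ih _ (hr.enter _) (hE.loc _ _) T h3,
      Ctx.ren_subst_of ih _ (hr.enter _) (hE.enter _) Φ h2, Env.enter_postren]
theorem Tm.ren_subst_of {ℓ : ℕ} (ih : ∀ n < ℓ, RenSubst n) {G G' : SCtx} {E : Env}
    (ρ : Ren) (hr : E.Reg ℓ) (hE : E.Sc G G') :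
    ∀ e : Tm, e.Sc G → (e.subst ℓ E).ren ρ = e.subst ℓ (E.postren ρ)
  | .var n i σ, ⟨Ψ, h1, h2, h3⟩ => by
    have hσ := h3.subst hr hE
    have hi := hE _ _ _ _ h1
    have hr' := hr .tm n i
    rw [Tm.subst, Tm.subst, ← Subst.ren_subst_of ih ρ hr hE σ _ h3, Env.postren]
    generalize E .tm n i = a at hi hr'
    cases a with
    | var j => simp [Img.ren, Tm.ren]
    | tm Φ e =>
      obtain ⟨_, rfl, hT⟩ := hi
      simp only [hr'.2, if_true, Img.ren]
      have hσ' := (hσ.env_reg h2 [])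
      have hreg := Subst.env_reg_of_ren hσ h2 ρ
      rw [(ih n hr'.2).2 _ _ _ ρ e hσ' (hσ.env_sc_loc h2) hT, Tm.subst_ren _ _ _ hreg]
      exact Tm.subst_congr (hσ'.postren _) (hreg.precomp _) (hσ.agree_postren h2 ρ) e hT
    | ty Φ e => simp [Img.Sc] at hi
  | .lam e, h1 => by
    simp [Tm.subst, Tm.ren, Tm.ren_subst_of ih _ (hr.lift _ _) (hE.lift _ _ _) e h1,
      Env.lift_postren]
  | .app e₁ e₂, ⟨h1, h2⟩ => by
    simp [Tm.subst, Tm.ren, Tm.ren_subst_of ih ρ hr hE e₁ h1, Tm.ren_subst_of ih ρ hr hE e₂ h2]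
  | .tlam n e, ⟨Ψ, h1⟩ => by
    simp [Tm.subst, Tm.ren, Tm.ren_subst_of ih _ (hr.lift _ _) (hE.lift _ _ _) e h1,
      Env.lift_postren]
  | .tapp e Φ n T, ⟨h1, Ψ, h2, h3⟩ => by
    simp [Tm.subst, Tm.ren, Ty.ren_subst_of ih _ (hr.enter _) (hE.loc _ _) T h3,
      Tm.ren_subst_of ih ρ hr hE e h1, Env.enter_postren]
  | .box Φ n e, ⟨Ψ, h2, h3⟩ => by
    simp [Tm.subst, Tm.ren, Tm.ren_subst_of ih _ (hr.enter _) (hE.loc _ _) e h3,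
      Env.enter_postren]
  | .letbox Φ n e₁ e₂, ⟨h1, Ψ, h2, h3⟩ => by
    simp [Tm.subst, Tm.ren, Tm.ren_subst_of ih _ (hr.lift _ _) (hE.lift _ _ _) e₂ h3,
      Tm.ren_subst_of ih ρ hr hE e₁ h1, Env.lift_postren]
theorem Subst.ren_subst_of {ℓ : ℕ} (ih : ∀ n < ℓ, RenSubst n) {G G' : SCtx} {E : Env}
    (ρ : Ren) (hr : E.Reg ℓ) (hE : E.Sc G G') :
    ∀ (σ : Subst) (Δ : Sh), σ.Sc G Δ → (σ.subst ℓ E).ren ρ = σ.subst ℓ (E.postren ρ)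
  | .nil, _, h => by
    simp [Subst.subst, Subst.ren]
  | .tm σ Φ n e, _, ⟨Δ, Ψ, h1, h2, h3, h4⟩ => by
    simp [Subst.subst, Subst.ren, Subst.ren_subst_of ih ρ hr hE σ _ h3,
      Tm.ren_subst_of ih _ (hr.enter _) (hE.loc _ _) e h4, Env.enter_postren]
  | .ty σ Φ n T, _, ⟨Δ, Ψ, h1, h2, h3, h4⟩ => by
    simp [Subst.subst, Subst.ren, Subst.ren_subst_of ih ρ hr hE σ _ h3,
      Ty.ren_subst_of ih _ (hr.enter _) (hE.loc _ _) T h4, Env.enter_postren]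
  | .var σ s n i, _, ⟨Δ, Ψ, h1, h3, h4⟩ => by
    have := Subst.subst_snoc ℓ E σ s n (.var i)
    rw [Subst.snoc] at this
    have h' := Subst.subst_snoc ℓ (E.postren ρ) σ s n (.var i)
    rw [Subst.snoc] at h'
    rw [this, h', Subst.ren_snoc, Subst.ren_subst_of ih ρ hr hE σ _ h3]
    rfl
theorem Decl.ren_subst_of {ℓ : ℕ} (ih : ∀ n < ℓ, RenSubst n) {G G' : SCtx} {E : Env}
    (ρ : Ren) (hr : E.Reg ℓ) (hE : E.Sc G G') :
    ∀ D : Decl, D.Sc G → (D.subst ℓ E).ren ρ = D.subst ℓ (E.postren ρ)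
  | .ty Ψ n, h => by
    simp [Decl.subst, Decl.ren]
  | .tm Φ n T, ⟨h1, h2, h3⟩ => by
    simp [Decl.subst, Decl.ren, Ty.ren_subst_of ih _ (hr.enter _) (hE.loc _ _) T h3,
      Ctx.ren_subst_of ih _ (hr.enter _) (hE.enter _) Φ h2, Env.enter_postren]
theorem Ctx.ren_subst_of {ℓ : ℕ} (ih : ∀ n < ℓ, RenSubst n) {G G' : SCtx} {E : Env}
    (ρ : Ren) (hr : E.Reg ℓ) (hE : E.Sc G G') :
    ∀ Γ : Ctx, Γ.Sc G → (Γ.subst ℓ E).ren ρ = Γ.subst ℓ (E.postren ρ)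
  | .nil, _ => by
    simp [Ctx.subst, Ctx.ren]
  | .snoc Γ D, ⟨h1, h2⟩ => by
    have h' := hE.lifts Γ.sh
    rw [Ctx.erase_sh] at h'
    simp [Ctx.subst, Ctx.ren, Ctx.ren_subst_of ih ρ hr hE Γ h1,
      Decl.ren_subst_of ih _ (hr.lifts _) h' D h2, Env.lifts_postren]
end

theorem renSubst (ℓ : ℕ) : RenSubst ℓ := by
  induction ℓ using Nat.strong_induction_on with
  | _ ℓ ih =>
    exact ⟨fun _ _ _ ρ T hr hE h => Ty.ren_subst_of ih ρ hr hE T h,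
      fun _ _ _ ρ e hr hE h => Tm.ren_subst_of ih ρ hr hE e h⟩

theorem Img.ren_subst {ℓ : ℕ} {G G' : SCtx} {E : Env} (ρ : Ren) (hr : E.Reg ℓ)
    (hE : E.Sc G G') {s : VarSort} {n : ℕ} {Ψ : Sh} {a : Img} (h : a.Sc G s n Ψ) :
    (a.subst s n ℓ E).ren s n ρ = a.subst s n ℓ (E.postren ρ) := by
  cases a with
  | var i => rfl
  | ty Φ T =>
    simp only [Img.subst, Img.ren, Env.enter_postren]
    rw [(renSubst ℓ).1 _ _ _ _ T (hr.enter _) (hE.loc _ _) h.2.2]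
  | tm Φ e =>
    simp only [Img.subst, Img.ren, Env.enter_postren]
    rw [(renSubst ℓ).2 _ _ _ _ e (hr.enter _) (hE.loc _ _) h.2.2]

theorem Env.lift_precomp_wk (s : VarSort) (n : ℕ) (E : Env) :
    (E.lift s n).precomp (Ren.wk s n) = E.postren (Ren.wk s n) := by
  funext s' k i
  simp [Env.precomp, Env.postren]

/-- Weakening commutes with substitution. -/
theorem Img.Sc.subst_wk {ℓ : ℕ} {G G' : SCtx} {E : Env} (hr : E.Reg ℓ) (hE : E.Sc G G')
    {s : VarSort} {n : ℕ} {Ψ : Sh} {a : Img} (h : a.Sc G s n Ψ) (s' : VarSort) (m : ℕ) :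
    (a.ren s n (Ren.wk s' m)).subst s n ℓ (E.lift s' m) =
      (a.subst s n ℓ E).ren s n (Ren.wk s' m) := by
  rw [Img.subst_ren _ _ _ (hr.lift _ _), Env.lift_precomp_wk, Img.ren_subst _ hr hE h]

theorem Ty.Sc.subst_wk {ℓ : ℕ} {G G' : SCtx} {E : Env} (hr : E.Reg ℓ) (hE : E.Sc G G')
    {T : Ty} (h : T.Sc G) (s : VarSort) (n : ℕ) :
    (T.ren (Ren.wk s n)).subst ℓ (E.lift s n) = (T.subst ℓ E).ren (Ren.wk s n) := by
  rw [Ty.subst_ren _ _ _ (hr.lift _ _), Env.lift_precomp_wk, (renSubst ℓ).1 _ _ _ _ T hr hE h]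

theorem Decl.Sc.subst_wk {ℓ : ℕ} {G G' : SCtx} {E : Env} (hr : E.Reg ℓ) (hE : E.Sc G G')
    {D : Decl} (h : D.Sc G) (s : VarSort) (n : ℕ) :
    (D.ren (Ren.wk s n)).subst ℓ (E.lift s n) = (D.subst ℓ E).ren (Ren.wk s n) := by
  rw [Decl.subst_ren _ _ _ (hr.lift _ _), Env.lift_precomp_wk,
    Decl.ren_subst_of (fun n _ => renSubst n) _ hr hE D h]

/-! ## Composition of substitutions -/

/-- First `E₁`, then `E₂`, the domain of the latter having level `ℓ`. -/
def Env.comp (ℓ : ℕ) (E₂ E₁ : Env) : Env := fun s k i => (E₁ s k i).subst s k ℓ E₂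

/-- The interchange law at the level of environments: `E` after `σ/Ψ̂` is the same as `E` carried
under `Ψ̂`, followed by the substituted `σ`. -/
theorem Subst.Sc.env_comp {ℓ ℓ' : ℕ} {G G' : SCtx} {E : Env} (hr : E.Reg ℓ) (hE : E.Sc G G')
    {σ : Subst} {Ψ : Sh} (h : σ.Sc G Ψ) (hΨ : Ψ.erase.LevelLE ℓ') :
    Env.comp ℓ E (σ.env [] Ψ.erase) =
      Env.comp ℓ' ((σ.subst ℓ E).env [] Ψ.erase) (E.lifts Ψ.erase) := by
  revert hΨ
  refine h.rec' (P := fun σ Ψ => Ψ.erase.LevelLE ℓ' → Env.comp ℓ E (σ.env [] Ψ.erase) =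
      Env.comp ℓ' ((σ.subst ℓ E).env [] Ψ.erase) (E.lifts Ψ.erase)) ?_ ?_
  · intro _
    funext s k i
    simp [Sh.erase, Env.comp, Subst.subst, Img.subst_env, Env.lifts]
    rw [Img.ren_of_enter (by simp [Ren.id])]
    simp [Ren.env, Img.subst, Ren.id]
  · intro σ Δ s n Ψ a hσ ha ih hΔ
    have hΔ' : Δ.erase.LevelLE ℓ' := fun p hp => hΔ p (by simp [Sh.erase, hp])
    have hreg := ((hσ.snoc ha).subst hr hE).env_reg hΔ []
    rw [Subst.subst_snoc, Sh.erase, Subst.env_snoc] at *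
    rw [Subst.env_snoc]
    refine vext s n ?_ fun s' k i => ?_
    · simp [Env.comp, Env.cons_eq, Env.lifts, Img.subst]
    · have := congrFun (congrFun (congrFun (ih hΔ') s') k) i
      simp only [Env.comp, Env.cons_eq, vcons_wk, Env.lifts, List.foldr_cons,
        Env.lift_wk] at this ⊢
      rw [Env.cons_eq] at hreg
      -- A weakened image does not mention the newest variable, so the last entry of the extended
      -- substitution cancels against the weakening.
      rw [this, Img.subst_ren _ _ _ hreg]
      congr 1
      funext s' k i
      simp [Env.precomp]

/-- On the scope `G`, the environment `E₃` is the composition of `E₁` and `E₂`. -/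
structure Comp (G G' G'' : SCtx) (ℓ₁ ℓ₂ ℓ₃ : ℕ) (E₁ E₂ E₃ : Env) : Prop where
  reg₁ : E₁.Reg ℓ₁
  reg₂ : E₂.Reg ℓ₂
  reg₃ : E₃.Reg ℓ₃
  sc₁ : E₁.Sc G G'
  sc₂ : E₂.Sc G' G''
  agree : Env.Agree G E₃ (Env.comp ℓ₂ E₂ E₁)
  le₁ : ℓ₁ ≤ ℓ₃
  le₂ : ℓ₂ ≤ ℓ₃

/-- Under a binder the images of `E₁` are weakened before `E₂` acts on them. Hence composition
presupposes that substitution commutes with weakening, which is where `renSubst` enters. -/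
theorem Comp.lift {G G' G'' : SCtx} {ℓ₁ ℓ₂ ℓ₃ : ℕ} {E₁ E₂ E₃ : Env}
    (h : Comp G G' G'' ℓ₁ ℓ₂ ℓ₃ E₁ E₂ E₃) (s : VarSort) (n : ℕ) (Ψ : Sh) :
    Comp (G.cons s n Ψ) (G'.cons s n Ψ) (G''.cons s n Ψ) ℓ₁ ℓ₂ ℓ₃ (E₁.lift s n) (E₂.lift s n)
      (E₃.lift s n) := by
  refine ⟨h.reg₁.lift _ _, h.reg₂.lift _ _, h.reg₃.lift _ _, h.sc₁.lift _ _ _, h.sc₂.lift _ _ _,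
    ?_, h.le₁, h.le₂⟩
  intro s' k i Φ hi
  obtain ⟨rfl, rfl, rfl⟩ | ⟨j, rfl⟩ := Ren.wk_cases s n s' k i
  · simp [Env.comp, Img.subst]
  · simp only [Env.comp, Env.lift_wk]
    rw [SCtx.cons_wk] at hi
    rw [(h.sc₁ _ _ _ _ hi).subst_wk h.reg₂ h.sc₂, h.agree _ _ _ _ hi]
    rfl

theorem Comp.lifts {G G' G'' : SCtx} {ℓ₁ ℓ₂ ℓ₃ : ℕ} {E₁ E₂ E₃ : Env}
    (h : Comp G G' G'' ℓ₁ ℓ₂ ℓ₃ E₁ E₂ E₃) (Ψ : Sh) :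
    Comp (G.conss Ψ) (G'.conss Ψ) (G''.conss Ψ) ℓ₁ ℓ₂ ℓ₃ (E₁.lifts Ψ.erase) (E₂.lifts Ψ.erase)
      (E₃.lifts Ψ.erase) := by
  induction Ψ with
  | nil => exact h
  | snoc Δ s n Ψ ih _ => exact ih.lift s n Ψ

theorem Img.subst_enter {n k : ℕ} (h : n ≤ k) (s : VarSort) (ℓ : ℕ) (E : Env) (a : Img) :
    a.subst s k ℓ (E.enter n) = a.subst s k ℓ E := by
  cases a <;> simp [Img.subst, Env.enter_enter h]
  simp [Env.enter, show ¬ k < n by omega]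

theorem Comp.loc {G G' G'' : SCtx} {ℓ₁ ℓ₂ ℓ₃ : ℕ} {E₁ E₂ E₃ : Env}
    (h : Comp G G' G'' ℓ₁ ℓ₂ ℓ₃ E₁ E₂ E₃) (n : ℕ) (Ψ : Sh) :
    Comp (G.loc n Ψ) (G'.loc n Ψ) (G''.loc n Ψ) ℓ₁ ℓ₂ ℓ₃ (E₁.enter n) (E₂.enter n)
      (E₃.enter n) := by
  refine ⟨h.reg₁.enter _, h.reg₂.enter _, h.reg₃.enter _, h.sc₁.loc _ _, h.sc₂.loc _ _,
    ?_, h.le₁, h.le₂⟩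
  intro s k i Φ hi
  by_cases hk : k < n
  · simp [Env.enter, Env.comp, hk, Img.subst]
  · simp only [SCtx.loc, hk, if_false] at hi
    rw [Env.comp, Img.subst_enter (by omega)]
    simpa [Env.enter, hk, Env.comp] using h.agree _ _ _ _ hi

theorem Comp.enter {G G' G'' : SCtx} {ℓ₁ ℓ₂ ℓ₃ : ℕ} {E₁ E₂ E₃ : Env}
    (h : Comp G G' G'' ℓ₁ ℓ₂ ℓ₃ E₁ E₂ E₃) (n : ℕ) :
    Comp (G.enter n) (G'.enter n) (G''.enter n) ℓ₁ ℓ₂ ℓ₃ (E₁.enter n) (E₂.enter n)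
      (E₃.enter n) := by
  simpa only [SCtx.loc_nil] using h.loc n .nil

/-- Substitutions whose domains have levels `ℓ₁` and `ℓ₂` compose. -/
def SubstComp (ℓ₁ ℓ₂ : ℕ) : Prop :=
  (∀ (G G' G'' : SCtx) (E₁ E₂ E₃ : Env) (ℓ₃ : ℕ) (T : Ty), Comp G G' G'' ℓ₁ ℓ₂ ℓ₃ E₁ E₂ E₃ →
    T.Sc G → (T.subst ℓ₁ E₁).subst ℓ₂ E₂ = T.subst ℓ₃ E₃) ∧
  (∀ (G G' G'' : SCtx) (E₁ E₂ E₃ : Env) (ℓ₃ : ℕ) (e : Tm), Comp G G' G'' ℓ₁ ℓ₂ ℓ₃ E₁ E₂ E₃ →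
    e.Sc G → (e.subst ℓ₁ E₁).subst ℓ₂ E₂ = e.subst ℓ₃ E₃)

theorem Env.Reg.comp {ℓ₁ ℓ₂ ℓ : ℕ} (h₁ : ℓ₁ ≤ ℓ) (h₂ : ℓ₂ ≤ ℓ) {E₁ E₂ : Env} (hE₁ : E₁.Reg ℓ₁)
    (hE₂ : E₂.Reg ℓ₂) : (Env.comp ℓ₂ E₂ E₁).Reg ℓ :=
  fun s k i => (hE₁ s k i).subst h₁ h₂ hE₂

/-- Substituting for the local context, and then in the result. -/
theorem Comp.env_left {ℓ : ℕ} {G G' : SCtx} {E : Env} (hr : E.Reg ℓ) (hE : E.Sc G G')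
    {σ : Subst} {Ψ : Sh} (h : σ.Sc G Ψ) {n ℓ₃ : ℕ} (hΨ : Ψ.erase.LevelLE n) (h₁ : n ≤ ℓ₃)
    (h₂ : ℓ ≤ ℓ₃) :
    Comp (G.loc n Ψ) G G' n ℓ ℓ₃ (σ.env [] Ψ.erase) E (Env.comp ℓ E (σ.env [] Ψ.erase)) :=
  ⟨h.env_reg hΨ _, hr, (h.env_reg hΨ _).comp h₁ h₂ hr, h.env_sc_loc hΨ, hE,
    fun _ _ _ _ _ => rfl, h₁, h₂⟩

/-- The same composition, with the substitution under the local context first. -/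
theorem Comp.env_right {ℓ : ℕ} {G G' : SCtx} {E : Env} (hr : E.Reg ℓ) (hE : E.Sc G G')
    {σ : Subst} {Ψ : Sh} (h : σ.Sc G Ψ) {n ℓ₃ : ℕ} (hΨ : Ψ.erase.LevelLE n) (h₁ : n ≤ ℓ₃)
    (h₂ : ℓ ≤ ℓ₃) :
    Comp (G.loc n Ψ) (G'.loc n Ψ) G' ℓ n ℓ₃ (E.enter n) ((σ.subst ℓ E).env [] Ψ.erase)
      (Env.comp ℓ E (σ.env [] Ψ.erase)) := by
  have hσ := h.subst hr hE
  refine ⟨hr.enter _, hσ.env_reg hΨ _, (h.env_reg hΨ _).comp h₁ h₂ hr, hE.loc _ _,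
    hσ.env_sc_loc hΨ, ?_, h₂, h₁⟩
  intro s k i Φ hi
  rw [h.env_comp hr hE hΨ]
  simp only [Env.comp, Env.lifts_agree_enter hΨ E G _ _ _ _ hi]

mutual
-- The critical case is a variable of level `n` that `E₁` replaces by an object `T`. One side
-- substitutes `σ` in `T` at level `n` and then applies `E₂`; the other applies `E₂` to `T` and then
-- substitutes the twice substituted `σ`. Both equal one substitution in `T`, by the composition
-- property for `(n, ℓ₂)` and for `(ℓ₂, n)`.
theorem Ty.subst_subst_of {ℓ₁ ℓ₂ ℓ₃ : ℕ}
    (ih : ∀ n < ℓ₁, SubstComp n ℓ₂ ∧ SubstComp ℓ₂ n) {G G' G'' : SCtx} {E₁ E₂ E₃ : Env}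
    (h : Comp G G' G'' ℓ₁ ℓ₂ ℓ₃ E₁ E₂ E₃) :
    ∀ T : Ty, T.Sc G → (T.subst ℓ₁ E₁).subst ℓ₂ E₂ = T.subst ℓ₃ E₃
  | .tvar n i σ, ⟨Ψ, h1, h2, h3⟩ => by
    have hσ := h3.subst h.reg₁ h.sc₁
    have hi := h.sc₁ _ _ _ _ h1
    have hr := h.reg₁ .ty n i
    have ha := h.agree _ _ _ _ h1
    have h12 := h.le₁
    have h23 := h.le₂
    rw [Ty.subst, Ty.subst, ← Subst.subst_subst_of ih h σ _ h3, ha, Env.comp]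
    generalize E₁ .ty n i = a at hi hr
    cases a with
    | var j =>
      have hr := h.reg₂ .ty n j
      simp only [Ty.subst, Img.subst]
      generalize E₂ .ty n j = b at hr
      cases b with
      | var k => rfl
      -- The bound `ℓ₂ ≤ ℓ₃` ensures that the composite also performs the replacement instead of
      -- taking the default branch.
      | ty Φ T => simp [hr.2, show n < ℓ₃ from lt_of_lt_of_le hr.2 h23]
      | tm Φ T => simp [Img.Reg] at hr
    | ty Φ T =>
      obtain ⟨_, rfl, hT⟩ := hi
      have hn : n < ℓ₃ := lt_of_lt_of_le hr.2 h12
      simp only [hr.2, hn, if_true, Img.subst]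
      rw [(ih n hr.2).1.1 _ _ _ _ _ _ _ T (Comp.env_left h.reg₂ h.sc₂ hσ h2 hn.le h23) hT,
        (ih n hr.2).2.1 _ _ _ _ _ _ _ T (Comp.env_right h.reg₂ h.sc₂ hσ h2 hn.le h23) hT]
    | tm Φ e => simp [Img.Sc] at hi
  | .arr S T, ⟨h1, h2⟩ => by
    simp [Ty.subst, Ty.subst_subst_of ih h S h1, Ty.subst_subst_of ih h T h2]
  | .all Φ n T, ⟨h1, h2⟩ => by
    simp [Ty.subst, Ty.subst_subst_of ih (h.lift _ _ _) T h2]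
  | .box Φ n T, ⟨h1, h2, h3⟩ => by
    simp [Ty.subst, Ty.subst_subst_of ih (h.loc _ _) T h3,
      Ctx.subst_subst_of ih (h.enter _) Φ h2]
theorem Tm.subst_subst_of {ℓ₁ ℓ₂ ℓ₃ : ℕ}
    (ih : ∀ n < ℓ₁, SubstComp n ℓ₂ ∧ SubstComp ℓ₂ n) {G G' G'' : SCtx} {E₁ E₂ E₃ : Env}
    (h : Comp G G' G'' ℓ₁ ℓ₂ ℓ₃ E₁ E₂ E₃) :
    ∀ e : Tm, e.Sc G → (e.subst ℓ₁ E₁).subst ℓ₂ E₂ = e.subst ℓ₃ E₃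
  | .var n i σ, ⟨Ψ, h1, h2, h3⟩ => by
    have hσ := h3.subst h.reg₁ h.sc₁
    have hi := h.sc₁ _ _ _ _ h1
    have hr := h.reg₁ .tm n i
    have ha := h.agree _ _ _ _ h1
    have h12 := h.le₁
    have h23 := h.le₂
    rw [Tm.subst, Tm.subst, ← Subst.subst_subst_of ih h σ _ h3, ha, Env.comp]
    generalize E₁ .tm n i = a at hi hr
    cases a with
    | var j =>
      have hr := h.reg₂ .tm n j
      simp only [Tm.subst, Img.subst]
      generalize E₂ .tm n j = b at hr
      cases b with
      | var k => rfl
      | tm Φ T => simp [hr.2, show n < ℓ₃ from lt_of_lt_of_le hr.2 h23]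
      | ty Φ T => simp [Img.Reg] at hr
    | tm Φ T =>
      obtain ⟨_, rfl, hT⟩ := hi
      have hn : n < ℓ₃ := lt_of_lt_of_le hr.2 h12
      simp only [hr.2, hn, if_true, Img.subst]
      rw [(ih n hr.2).1.2 _ _ _ _ _ _ _ T (Comp.env_left h.reg₂ h.sc₂ hσ h2 hn.le h23) hT,
        (ih n hr.2).2.2 _ _ _ _ _ _ _ T (Comp.env_right h.reg₂ h.sc₂ hσ h2 hn.le h23) hT]
    | ty Φ e => simp [Img.Sc] at hi
  | .lam e, h1 => by
    simp [Tm.subst, Tm.subst_subst_of ih (h.lift _ _ _) e h1]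
  | .app e₁ e₂, ⟨h1, h2⟩ => by
    simp [Tm.subst, Tm.subst_subst_of ih h e₁ h1, Tm.subst_subst_of ih h e₂ h2]
  | .tlam n e, ⟨Ψ, h1⟩ => by
    simp [Tm.subst, Tm.subst_subst_of ih (h.lift _ _ _) e h1]
  | .tapp e Φ n T, ⟨h1, Ψ, h2, h3⟩ => by
    simp [Tm.subst, Ty.subst_subst_of ih (h.loc _ _) T h3, Tm.subst_subst_of ih h e h1]
  | .box Φ n e, ⟨Ψ, h2, h3⟩ => by
    simp [Tm.subst, Tm.subst_subst_of ih (h.loc _ _) e h3]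
  | .letbox Φ n e₁ e₂, ⟨h1, Ψ, h2, h3⟩ => by
    simp [Tm.subst, Tm.subst_subst_of ih (h.lift _ _ _) e₂ h3, Tm.subst_subst_of ih h e₁ h1]
theorem Subst.subst_subst_of {ℓ₁ ℓ₂ ℓ₃ : ℕ}
    (ih : ∀ n < ℓ₁, SubstComp n ℓ₂ ∧ SubstComp ℓ₂ n) {G G' G'' : SCtx} {E₁ E₂ E₃ : Env}
    (h : Comp G G' G'' ℓ₁ ℓ₂ ℓ₃ E₁ E₂ E₃) :
    ∀ (σ : Subst) (Δ : Sh), σ.Sc G Δ → (σ.subst ℓ₁ E₁).subst ℓ₂ E₂ = σ.subst ℓ₃ E₃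
  | .nil, _, _ => by
    simp [Subst.subst]
  | .tm σ Φ n e, _, ⟨Δ, Ψ, h1, h2, h3, h4⟩ => by
    simp [Subst.subst, Subst.subst_subst_of ih h σ _ h3, Tm.subst_subst_of ih (h.loc _ _) e h4]
  | .ty σ Φ n T, _, ⟨Δ, Ψ, h1, h2, h3, h4⟩ => by
    simp [Subst.subst, Subst.subst_subst_of ih h σ _ h3, Ty.subst_subst_of ih (h.loc _ _) T h4]
  | .var σ s n i, _, ⟨Δ, Ψ, h1, h3, h4⟩ => by
    have := Subst.subst_snoc ℓ₁ E₁ σ s n (.var i)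
    rw [Subst.snoc] at this
    have h' := Subst.subst_snoc ℓ₃ E₃ σ s n (.var i)
    rw [Subst.snoc] at h'
    rw [this, h', Subst.subst_snoc, Subst.subst_subst_of ih h σ _ h3, Img.subst, Img.subst,
      h.agree _ _ _ _ h4]
    rfl
theorem Decl.subst_subst_of {ℓ₁ ℓ₂ ℓ₃ : ℕ}
    (ih : ∀ n < ℓ₁, SubstComp n ℓ₂ ∧ SubstComp ℓ₂ n) {G G' G'' : SCtx} {E₁ E₂ E₃ : Env}
    (h : Comp G G' G'' ℓ₁ ℓ₂ ℓ₃ E₁ E₂ E₃) :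
    ∀ D : Decl, D.Sc G → (D.subst ℓ₁ E₁).subst ℓ₂ E₂ = D.subst ℓ₃ E₃
  | .ty Ψ n, _ => by
    simp [Decl.subst]
  | .tm Φ n T, ⟨h1, h2, h3⟩ => by
    simp [Decl.subst, Ty.subst_subst_of ih (h.loc _ _) T h3,
      Ctx.subst_subst_of ih (h.enter _) Φ h2]
theorem Ctx.subst_subst_of {ℓ₁ ℓ₂ ℓ₃ : ℕ}
    (ih : ∀ n < ℓ₁, SubstComp n ℓ₂ ∧ SubstComp ℓ₂ n) {G G' G'' : SCtx} {E₁ E₂ E₃ : Env}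
    (h : Comp G G' G'' ℓ₁ ℓ₂ ℓ₃ E₁ E₂ E₃) :
    ∀ Γ : Ctx, Γ.Sc G → (Γ.subst ℓ₁ E₁).subst ℓ₂ E₂ = Γ.subst ℓ₃ E₃
  | .nil, _ => by
    simp [Ctx.subst]
  | .snoc Γ D, ⟨h1, h2⟩ => by
    have h' := h.lifts Γ.sh
    rw [Ctx.erase_sh] at h'
    simp [Ctx.subst, Ctx.subst_subst_of ih h Γ h1, Decl.subst_subst_of ih h' D h2]
end

/-- The two levels exchange places in the critical case, so the induction is on their sum, which is
symmetric and drops because `n < ℓ₁`. -/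
theorem substComp (ℓ₁ ℓ₂ : ℕ) : SubstComp ℓ₁ ℓ₂ := by
  induction hN : ℓ₁ + ℓ₂ using Nat.strong_induction_on generalizing ℓ₁ ℓ₂ with
  | _ N IH =>
    have ih : ∀ n < ℓ₁, SubstComp n ℓ₂ ∧ SubstComp ℓ₂ n := fun n hn =>
      ⟨IH (n + ℓ₂) (by omega) _ _ rfl, IH (ℓ₂ + n) (by omega) _ _ rfl⟩
    exact ⟨fun _ _ _ _ _ _ _ T h hT => Ty.subst_subst_of ih h T hT,
      fun _ _ _ _ _ _ _ e h he => Tm.subst_subst_of ih h e he⟩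

theorem Ty.Sc.subst_subst {G G' G'' : SCtx} {ℓ₁ ℓ₂ ℓ₃ : ℕ} {E₁ E₂ E₃ : Env} {T : Ty}
    (hT : T.Sc G) (h : Comp G G' G'' ℓ₁ ℓ₂ ℓ₃ E₁ E₂ E₃) :
    (T.subst ℓ₁ E₁).subst ℓ₂ E₂ = T.subst ℓ₃ E₃ :=
  (substComp _ _).1 _ _ _ _ _ _ _ T h hT

theorem Decl.Sc.subst_subst {G G' G'' : SCtx} {ℓ₁ ℓ₂ ℓ₃ : ℕ} {E₁ E₂ E₃ : Env} {D : Decl}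
    (hD : D.Sc G) (h : Comp G G' G'' ℓ₁ ℓ₂ ℓ₃ E₁ E₂ E₃) :
    (D.subst ℓ₁ E₁).subst ℓ₂ E₂ = D.subst ℓ₃ E₃ :=
  Decl.subst_subst_of (fun n _ => ⟨substComp n _, substComp _ n⟩) h D hD

/-! ## Typing without presuppositions

A context enters the rules through its lookup function only. The rules do not presuppose that it is
well formed, but contain what is needed to see that its extensions are. Derivations are
measured by their size. -/

/-- Contexts as lookup functions. -/
abbrev LCtx := VarSort → ℕ → ℕ → Option Decl

/-- The position of `D` among declarations of other levels leaves no trace here, so this one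
operation models `insert` as well as `snoc`. -/
def LCtx.cons (L : LCtx) (D : Decl) : LCtx :=
  vcons D.sort D.level (some (D.weakenBy D)) fun s k i => (L s k i).map D.weakenBy

def LCtx.conss (L : LCtx) : Ctx → LCtx
  | .nil => L
  | .snoc Δ D => (L.conss Δ).cons D

def LCtx.enter (n : ℕ) (L : LCtx) : LCtx := fun s k i => if k < n then none else L s k i

def LCtx.sh (L : LCtx) : SCtx := fun s k i => (L s k i).map Decl.sh

mutual
/-- The declaration `D` may be added to `L`, after the declarations of the same or a higher
level. -/
inductive DeclOk : ℕ → LCtx → Decl → Prop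
  | tm {a b : ℕ} {L : LCtx} {Φ : Ctx} {n : ℕ} {T : Ty} :
      Φ.erase.LevelLE n → ExtOk a (L.enter n) Φ → TyOk b ((L.enter n).conss Φ) T →
      DeclOk (a + b + 1) L (.tm Φ n T)
  | ty {a : ℕ} {L : LCtx} {Φ : KCtx} {n : ℕ} :
      Φ.toCtx.erase.LevelLE n → ExtOk a (L.enter n) Φ.toCtx → DeclOk (a + 1) L (.ty Φ n)
/-- `Δ` is a sorted context of well-formed declarations over `L`. -/
inductive ExtOk : ℕ → LCtx → Ctx → Prop
  | nil {L : LCtx} : ExtOk 1 L .nil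
  | snoc {a b : ℕ} {L : LCtx} {Δ : Ctx} {D : Decl} :
      ExtOk a L Δ → (∀ p ∈ Δ.erase, D.level ≤ p.2) → DeclOk b (L.conss Δ) D →
      ExtOk (a + b + 1) L (.snoc Δ D)
/-- `T` is well kinded over `L`. -/
inductive TyOk : ℕ → LCtx → Ty → Prop
  | tvar {a : ℕ} {L : LCtx} {n i : ℕ} {Φ : KCtx} {σ : Subst} :
      L .ty n i = some (.ty Φ n) → SubOk a L σ Φ.toCtx → TyOk (a + 1) L (.tvar n i σ)
  | arr {a b : ℕ} {L : LCtx} {S T : Ty} :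
      TyOk a L S → TyOk b L T → TyOk (a + b + 1) L (.arr S T)
  -- Rules that add a declaration to the context add `2` to the size: inserting a declaration of
  -- size `a` enlarges the context derivation by up to `a + 1`, and the total must still drop
  -- strictly in `ExtOk.wf_aux`.
  | all {a b : ℕ} {L : LCtx} {Φ : KCtx} {n : ℕ} {T : Ty} :
      DeclOk a L (.ty Φ n) → TyOk b (L.cons (.ty Φ n)) T → TyOk (a + b + 2) L (.all Φ n T)
  | box {a : ℕ} {L : LCtx} {Φ : Ctx} {n : ℕ} {T : Ty} :
      0 < n → DeclOk a L (.tm Φ n T) → TyOk (a + 1) L (.box Φ n T)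
/-- `e` has type `T` over `L`. -/
inductive TmOk : ℕ → LCtx → Tm → Ty → Prop
  | var {a : ℕ} {L : LCtx} {n i : ℕ} {Φ : Ctx} {T : Ty} {σ : Subst} :
      L .tm n i = some (.tm Φ n T) → SubOk a L σ Φ →
      TmOk (a + 1) L (.var n i σ) (T.simSubst [] σ Φ.erase)
  | lam {a b : ℕ} {L : LCtx} {S T : Ty} {e : Tm} :
      DeclOk a L (.tm .nil 0 S) → TmOk b (L.cons (.tm .nil 0 S)) e (T.ren (Ren.wk .tm 0)) →
      TmOk (a + b + 2) L (.lam e) (.arr S T)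
  | app {a b : ℕ} {L : LCtx} {S T : Ty} {e₁ e₂ : Tm} :
      TmOk a L e₁ (.arr S T) → TmOk b L e₂ S → TmOk (a + b + 1) L (.app e₁ e₂) T
  | tlam {a b : ℕ} {L : LCtx} {Φ : KCtx} {n : ℕ} {T : Ty} {e : Tm} :
      DeclOk a L (.ty Φ n) → TmOk b (L.cons (.ty Φ n)) e T →
      TmOk (a + b + 2) L (.tlam n e) (.all Φ n T)
  | tapp {a b c : ℕ} {L : LCtx} {Φ : KCtx} {n : ℕ} {S T : Ty} {e : Tm} :
      TmOk a L e (.all Φ n S) → DeclOk b L (.ty Φ n) →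
      TyOk c ((L.enter n).conss Φ.toCtx) T →
      TmOk (a + b + c + 1) L (.tapp e Φ.toCtx.erase n T) (S.single Φ.toCtx.erase n T)
  | box {a b : ℕ} {L : LCtx} {Φ : Ctx} {n : ℕ} {T : Ty} {e : Tm} :
      0 < n → Φ.erase.LevelLE n → ExtOk a (L.enter n) Φ → TmOk b ((L.enter n).conss Φ) e T →
      TmOk (a + b + 1) L (.box Φ.erase n e) (.box Φ n T)
  | letbox {a b c : ℕ} {L : LCtx} {Φ : Ctx} {n : ℕ} {S T : Ty} {e₁ e₂ : Tm} :
      0 < n → TmOk a L e₁ (.box Φ n S) → DeclOk b L (.tm Φ n S) →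
      TmOk c (L.cons (.tm Φ n S)) e₂ (T.ren (Ren.wk .tm n)) →
      TmOk (a + b + c + 2) L (.letbox Φ.erase n e₁ e₂) T
/-- `σ` has domain `Ψ` over `L`. -/
inductive SubOk : ℕ → LCtx → Subst → Ctx → Prop
  | nil {L : LCtx} : SubOk 1 L .nil .nil
  | tm {a b c d : ℕ} {L : LCtx} {Δ Ψ : Ctx} {n : ℕ} {T : Ty} {σ : Subst} {e : Tm} :
      ExtOk a L (.snoc Δ (.tm Ψ n T)) → SubOk b L σ Δ →
      ExtOk c (L.enter n) (Ψ.simSubstLocal n σ Δ.erase) →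
      TmOk d ((L.enter n).conss (Ψ.simSubstLocal n σ Δ.erase)) e (T.simSubstLocal n σ Δ.erase) →
      SubOk (a + b + c + d + 1) L (.tm σ Ψ.erase n e) (.snoc Δ (.tm Ψ n T))
  | tmVar {a b : ℕ} {L : LCtx} {Δ Ψ : Ctx} {n i : ℕ} {T : Ty} {σ : Subst} :
      ExtOk a L (.snoc Δ (.tm Ψ n T)) → SubOk b L σ Δ →
      L .tm n i = some (.tm (Ψ.simSubstLocal n σ Δ.erase) n (T.simSubstLocal n σ Δ.erase)) →
      SubOk (a + b + 1) L (.var σ .tm n i) (.snoc Δ (.tm Ψ n T))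
  | ty {a b c d : ℕ} {L : LCtx} {Δ : Ctx} {Ψ : KCtx} {n : ℕ} {σ : Subst} {T : Ty} :
      ExtOk a L (.snoc Δ (.ty Ψ n)) → SubOk b L σ Δ → ExtOk c (L.enter n) Ψ.toCtx →
      TyOk d ((L.enter n).conss Ψ.toCtx) T →
      SubOk (a + b + c + d + 1) L (.ty σ Ψ.toCtx.erase n T) (.snoc Δ (.ty Ψ n))
  | tyVar {a b : ℕ} {L : LCtx} {Δ : Ctx} {Ψ : KCtx} {n i : ℕ} {σ : Subst} :
      ExtOk a L (.snoc Δ (.ty Ψ n)) → SubOk b L σ Δ → L .ty n i = some (.ty Ψ n) →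
      SubOk (a + b + 1) L (.var σ .ty n i) (.snoc Δ (.ty Ψ n))
end

/-! ## Lookup functions of contexts -/

@[simp] theorem LCtx.cons_zero (L : LCtx) (D : Decl) :
    L.cons D D.sort D.level 0 = some (D.weakenBy D) := by simp [LCtx.cons]

@[simp] theorem LCtx.cons_wk (L : LCtx) (D : Decl) (s : VarSort) (k i : ℕ) :
    L.cons D s k (Ren.wk D.sort D.level s k i) = (L s k i).map D.weakenBy := by simp [LCtx.cons]

@[simp] theorem Decl.sh_weakenBy (D D' : Decl) : (D.weakenBy D').sh = D'.sh := by
  simp [Decl.weakenBy]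

theorem LCtx.sh_cons (L : LCtx) (D : Decl) :
    (L.cons D).sh = L.sh.cons D.sort D.level D.sh :=
  vext D.sort D.level (by simp [LCtx.sh])
    (by intro s k i; cases h : L s k i <;> simp [LCtx.sh, h])

theorem LCtx.sh_conss (L : LCtx) : ∀ Ψ : Ctx, (L.conss Ψ).sh = L.sh.conss Ψ.sh
  | .nil => by simp [LCtx.conss, Ctx.sh, SCtx.conss]
  | .snoc Δ D => by
    simp [LCtx.conss, Ctx.sh, SCtx.conss, LCtx.sh_cons, LCtx.sh_conss L Δ]

theorem LCtx.sh_enter (n : ℕ) (L : LCtx) : (L.enter n).sh = L.sh.enter n := by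
  funext s k i
  by_cases h : k < n <;> simp [LCtx.sh, LCtx.enter, SCtx.enter, h]

theorem LCtx.sh_loc {Ψ : Ctx} {n : ℕ} (h : Ψ.erase.LevelLE n) (L : LCtx) :
    ((L.enter n).conss Ψ).sh = L.sh.loc n Ψ.sh := by
  rw [LCtx.sh_conss, LCtx.sh_enter, SCtx.conss_enter (by simpa using h)]

theorem LCtx.enter_enter {m n : ℕ} (h : m ≤ n) (L : LCtx) : (L.enter m).enter n = L.enter n := by
  funext s k i
  by_cases hk : k < n
  · simp [LCtx.enter, hk]
  · simp [LCtx.enter, hk, show ¬ k < m by omega]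

/-- All declarations are well scoped, and have the sort and level under which they are found. -/
def LCtx.Wf (L : LCtx) : Prop :=
  ∀ s n i D, L s n i = some D → D.sort = s ∧ D.level = n ∧ D.Sc L.sh

theorem LCtx.Wf.cons {L : LCtx} (h : L.Wf) {D : Decl} (hD : D.Sc L.sh) : (L.cons D).Wf := by
  intro s k i D' hi
  rw [LCtx.sh_cons]
  obtain ⟨rfl, rfl, rfl⟩ | ⟨j, rfl⟩ := Ren.wk_cases D.sort D.level s k i
  · simp only [LCtx.cons_zero, Option.some.injEq] at hi
    subst hi
    simp [Decl.weakenBy, Decl.sc_ren, SCtx.cons_precomp_wk, hD]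
  · simp only [LCtx.cons_wk, Option.map_eq_some_iff] at hi
    obtain ⟨D₀, h0, rfl⟩ := hi
    obtain ⟨h1, h2, h3⟩ := h _ _ _ _ h0
    simp [Decl.weakenBy, Decl.sc_ren, SCtx.cons_precomp_wk, h1, h2, h3]

theorem LCtx.Wf.conss {L : LCtx} (h : L.Wf) : ∀ {Ψ : Ctx}, Ψ.Sc L.sh → (L.conss Ψ).Wf
  | .nil, _ => h
  | .snoc Δ D, ⟨h1, h2⟩ => by
    refine (LCtx.Wf.conss h h1).cons ?_
    rwa [LCtx.sh_conss]

/-- A declaration of level `m` refers to ambient variables of level at least `m` only, so forgetting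
those below `n ≤ m` is harmless. -/
theorem Decl.sc_enter {G : SCtx} {n : ℕ} {D : Decl} (h : n ≤ D.level) :
    D.Sc (G.enter n) ↔ D.Sc G := by
  cases D with
  | ty Ψ m => simp [Decl.Sc]
  | tm Ψ m T =>
    rw [Decl.level] at h
    simp [Decl.Sc, SCtx.enter_enter h, SCtx.enter_loc h]

theorem LCtx.Wf.enter {L : LCtx} (h : L.Wf) (n : ℕ) : (L.enter n).Wf := by
  intro s k i D hi
  by_cases hk : k < n
  · simp [LCtx.enter, hk] at hi
  · obtain ⟨h1, h2, h3⟩ := h s k i D (by simpa [LCtx.enter, hk] using hi)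
    rw [LCtx.sh_enter, Decl.sc_enter (by omega)]
    exact ⟨h1, h2, h3⟩

theorem ECtx.levelLE_level (Φ : ECtx) : Φ.LevelLE Φ.level := by
  induction Φ with
  | nil => intro p hp; simp at hp
  | cons q Φ ih =>
    intro p hp
    rw [List.mem_cons] at hp
    change p.2 < max (q.2 + 1) (ECtx.level Φ)
    rcases hp with rfl | hp
    · omega
    · have := ih p hp; omega

theorem LCtx.sh_some {L : LCtx} {s : VarSort} {n i : ℕ} {Ψ : Sh} (h : L.sh s n i = some Ψ) :
    ∃ D, L s n i = some D ∧ D.sh = Ψ := by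
  simpa [LCtx.sh] using h

theorem Subst.Sc.env_reg_erase {G : SCtx} {σ : Subst} {Δ : Ctx} (h : σ.Sc G Δ.sh) {ℓ : ℕ}
    (hΔ : Δ.erase.LevelLE ℓ) : (σ.env [] Δ.erase).Reg ℓ := by
  simpa using h.env_reg (by simpa using hΔ) []

theorem Subst.Sc.env_sc_loc_erase {G : SCtx} {σ : Subst} {Δ : Ctx} (h : σ.Sc G Δ.sh) {n : ℕ}
    (hΔ : Δ.erase.LevelLE n) : (σ.env [] Δ.erase).Sc (G.loc n Δ.sh) G := by
  simpa using h.env_sc_loc (by simpa using hΔ)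

theorem Subst.Sc.env_sc_erase {G : SCtx} {σ : Subst} {Δ : Ctx} (h : σ.Sc G Δ.sh) :
    (σ.env [] Δ.erase).Sc (G.conss Δ.sh) G := by
  simpa using h.env_sc

theorem Ty.Sc.simSubst {G : SCtx} {σ : Subst} {Φ : Ctx} {n : ℕ} {T : Ty}
    (hΦ : Φ.erase.LevelLE n) (hσ : σ.Sc G Φ.sh) (hT : T.Sc (G.loc n Φ.sh)) :
    (T.simSubst [] σ Φ.erase).Sc G :=
  hT.subst (hσ.env_reg_erase (ECtx.levelLE_level _)) (hσ.env_sc_loc_erase hΦ)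

theorem Subst.Sc.single {G : SCtx} {Φ : KCtx} {n : ℕ} {T : Ty} (hT : T.Sc (G.loc n Φ.sh)) :
    (Subst.ty .nil Φ.toCtx.erase n T).Sc G (Ctx.snoc .nil (.ty Φ n)).sh := by
  refine ⟨_, _, rfl, ?_, rfl, hT⟩
  rw [← Ctx.erase_sh, KCtx.sh_toCtx]; rfl

theorem Ty.single_eq (S : Ty) (Φ : KCtx) (n : ℕ) (T : Ty) :
    S.single Φ.toCtx.erase n T = S.simSubst [] (.ty .nil Φ.toCtx.erase n T)
      (Ctx.snoc .nil (.ty Φ n)).erase := rfl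

theorem Ty.Sc.single {G : SCtx} {Φ : KCtx} {n : ℕ} {S T : Ty} (hT : T.Sc (G.loc n Φ.sh))
    (hS : S.Sc (G.cons .ty n Φ.sh)) : (S.single Φ.toCtx.erase n T).Sc G := by
  rw [Ty.single_eq]
  exact hS.subst ((Subst.Sc.single hT).env_reg_erase (ECtx.levelLE_level _))
    (Subst.Sc.single hT).env_sc_erase

theorem Ty.Sc.of_wk {G : SCtx} {s : VarSort} {n : ℕ} {Ψ : Sh} {T : Ty}
    (h : (T.ren (Ren.wk s n)).Sc (G.cons s n Ψ)) : T.Sc G := by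
  rwa [Ty.sc_ren, SCtx.cons_precomp_wk] at h

/-! ## Typed syntax is well scoped -/

/-- Derivations of size `k` have well-scoped conclusions. -/
def OkSc (k : ℕ) : Prop :=
  ∀ L : LCtx, L.Wf →
    (∀ D, DeclOk k L D → D.Sc L.sh) ∧ (∀ Ψ, ExtOk k L Ψ → Ψ.Sc L.sh) ∧
    (∀ T, TyOk k L T → T.Sc L.sh) ∧ (∀ e T, TmOk k L e T → e.Sc L.sh ∧ T.Sc L.sh) ∧
    (∀ σ Ψ, SubOk k L σ Ψ → σ.Sc L.sh Ψ.sh)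

/-- Whenever a premise lives over an extended lookup function, a smaller derivation for the added
declarations is available. The induction hypothesis for it makes the extension well scoped, and so
applies to the premise as well. -/
theorem okSc (k : ℕ) : OkSc k := by
  induction k using Nat.strong_induction_on with
  | _ k ih =>
  intro L hL
  have hloc : ∀ {a : ℕ} {n : ℕ} {Φ : Ctx}, a < k → ExtOk a (L.enter n) Φ →
      ((L.enter n).conss Φ).Wf := fun ha h =>
    (hL.enter _).conss ((ih _ ha _ (hL.enter _)).2.1 _ h)
  have hcons : ∀ {a : ℕ} {D : Decl}, a < k → DeclOk a L D → (L.cons D).Wf := fun ha h =>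
    hL.cons ((ih _ ha _ hL).1 _ h)
  refine ⟨?_, ?_, ?_, ?_, ?_⟩
  · intro D h
    cases h with
    | @tm a b _ Φ n T h1 h2 h3 =>
      have hw := hloc (by omega) h2
      refine ⟨h1, ?_, ?_⟩
      · rw [← LCtx.sh_enter]; exact (ih a (by omega) _ (hL.enter n)).2.1 _ h2
      · rw [← LCtx.sh_loc h1]; exact (ih b (by omega) _ hw).2.2.1 _ h3
    | ty h1 h2 => exact h1
  · intro Ψ h
    cases h with
    | nil => trivial
    | @snoc a b _ Δ D h1 h2 h3 =>
      have := (ih a (by omega) _ hL).2.1 _ h1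
      refine ⟨this, ?_⟩
      rw [← LCtx.sh_conss]
      exact (ih b (by omega) _ (hL.conss this)).1 _ h3
  · intro T h
    cases h with
    | @tvar a _ n i Φ σ h1 h2 =>
      refine ⟨Φ.sh, by simp [LCtx.sh, h1, Decl.sh], ?_, ?_⟩
      · rw [← KCtx.sh_toCtx, Ctx.erase_sh]; exact (hL _ _ _ _ h1).2.2
      · simpa using (ih a (by omega) _ hL).2.2.2.2 _ _ h2
    | @arr a b _ S T h1 h2 =>
      exact ⟨(ih a (by omega) _ hL).2.2.1 _ h1, (ih b (by omega) _ hL).2.2.1 _ h2⟩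
    | @all a b _ Φ n T h1 h2 =>
      refine ⟨(ih a (by omega) _ hL).1 _ h1, ?_⟩
      have := (ih b (by omega) _ (hcons (by omega) h1)).2.2.1 _ h2
      rwa [LCtx.sh_cons] at this
    | @box a _ Φ n T h1 h2 => exact (ih a (by omega) _ hL).1 _ h2
  · intro e T h
    cases h with
    | @var a _ n i Φ T σ h1 h2 =>
      obtain ⟨-, -, h3, h4, h5⟩ := hL _ _ _ _ h1
      have hσ := (ih a (by omega) _ hL).2.2.2.2 _ _ h2
      exact ⟨⟨Φ.sh, by simp [LCtx.sh, h1, Decl.sh], by simpa using h3, hσ⟩, h5.simSubst h3 hσ⟩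
    | @lam a b _ S T e h1 h2 =>
      have := (ih b (by omega) _ (hcons (by omega) h1)).2.2.2.1 _ _ h2
      rw [LCtx.sh_cons] at this
      obtain ⟨-, h4, h5⟩ := (ih a (by omega) _ hL).1 _ h1
      refine ⟨this.1, ⟨?_, Ty.Sc.of_wk this.2⟩⟩
      -- The argument of a function is declared at level `0` with an empty local context: nothing is
      -- chopped, so its type is scoped in the whole context.
      rw [Ctx.sh, SCtx.loc_nil] at h5
      have : L.sh.enter 0 = L.sh := by funext s k i; simp [SCtx.enter]
      rwa [this] at h5
    | @app a b _ S T e₁ e₂ h1 h2 =>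
      have h3 := (ih a (by omega) _ hL).2.2.2.1 _ _ h1
      have h4 := (ih b (by omega) _ hL).2.2.2.1 _ _ h2
      exact ⟨⟨h3.1, h4.1⟩, h3.2.2⟩
    | @tlam a b _ Φ n T e h1 h2 =>
      have := (ih b (by omega) _ (hcons (by omega) h1)).2.2.2.1 _ _ h2
      rw [LCtx.sh_cons] at this
      exact ⟨⟨Φ.sh, this.1⟩, (ih a (by omega) _ hL).1 _ h1, this.2⟩
    | @tapp a b c _ Φ n S T e h1 h2 h3 =>
      have h4 := (ih a (by omega) _ hL).2.2.2.1 _ _ h1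
      have h5 : Φ.toCtx.erase.LevelLE n := (ih b (by omega) _ hL).1 _ h2
      have hw : ((L.enter n).conss Φ.toCtx).Wf := by
        cases h2 with
        | ty h1 h2 => exact hloc (by omega) h2
      have h6 := (ih c (by omega) _ hw).2.2.1 _ h3
      rw [LCtx.sh_loc h5, KCtx.sh_toCtx] at h6
      exact ⟨⟨h4.1, Φ.sh, by rw [← KCtx.sh_toCtx, Ctx.erase_sh], h6⟩, Ty.Sc.single h6 h4.2.2⟩
    | @box a b _ Φ n T e h1 h2 h3 h4 =>
      have h5 := (ih b (by omega) _ (hloc (by omega) h3)).2.2.2.1 _ _ h4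
      have h6 := (ih a (by omega) _ (hL.enter n)).2.1 _ h3
      rw [LCtx.sh_loc h2] at h5
      rw [LCtx.sh_enter] at h6
      exact ⟨⟨Φ.sh, by simp, h5.1⟩, h2, h6, h5.2⟩
    | @letbox a b c _ Φ n S T e₁ e₂ h1 h2 h3 h4 =>
      have h5 := (ih a (by omega) _ hL).2.2.2.1 _ _ h2
      have h6 := (ih c (by omega) _ (hcons (by omega) h3)).2.2.2.1 _ _ h4
      rw [LCtx.sh_cons] at h6
      exact ⟨⟨h5.1, Φ.sh, by simp, h6.1⟩, Ty.Sc.of_wk h6.2⟩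
  · intro σ Ψ h
    cases h with
    | nil => rfl
    | @tm a b c d _ Δ Ψ n T σ e h1 h2 h3 h4 =>
      have hσ := (ih b (by omega) _ hL).2.2.2.2 _ _ h2
      have h5 := ((ih a (by omega) _ hL).2.1 _ h1).2.1
      have h6 := ((ih d (by omega) _ (hloc (by omega) h3)).2.2.2.1 _ _ h4).1
      rw [LCtx.sh_loc (by simpa [Ctx.simSubstLocal] using h5), Ctx.simSubstLocal,
        Ctx.sh_subst] at h6
      exact ⟨Δ.sh, Ψ.sh, rfl, by simp, hσ, h6⟩
    | @tmVar a b _ Δ Ψ n i T σ h1 h2 h3 =>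
      have hσ := (ih b (by omega) _ hL).2.2.2.2 _ _ h2
      exact ⟨Δ.sh, Ψ.sh, rfl, hσ, by simp [LCtx.sh, h3, Decl.sh, Ctx.simSubstLocal]⟩
    | @ty a b c d _ Δ Ψ n σ T h1 h2 h3 h4 =>
      have hσ := (ih b (by omega) _ hL).2.2.2.2 _ _ h2
      have h5 := ((ih a (by omega) _ hL).2.1 _ h1).2
      have h6 := (ih d (by omega) _ (hloc (by omega) h3)).2.2.1 _ h4
      rw [LCtx.sh_loc h5, KCtx.sh_toCtx] at h6
      exact ⟨Δ.sh, Ψ.sh, rfl, by rw [← KCtx.sh_toCtx, Ctx.erase_sh], hσ, h6⟩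
    | @tyVar a b _ Δ Ψ n i σ h1 h2 h3 =>
      have hσ := (ih b (by omega) _ hL).2.2.2.2 _ _ h2
      exact ⟨Δ.sh, Ψ.sh, rfl, hσ, by simp [LCtx.sh, h3, Decl.sh]⟩

theorem DeclOk.sc {k : ℕ} {L : LCtx} {D : Decl} (h : DeclOk k L D) (hL : L.Wf) : D.Sc L.sh :=
  (okSc k L hL).1 D h

theorem ExtOk.sc {k : ℕ} {L : LCtx} {Ψ : Ctx} (h : ExtOk k L Ψ) (hL : L.Wf) : Ψ.Sc L.sh :=
  (okSc k L hL).2.1 Ψ h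

theorem TyOk.sc {k : ℕ} {L : LCtx} {T : Ty} (h : TyOk k L T) (hL : L.Wf) : T.Sc L.sh :=
  (okSc k L hL).2.2.1 T h

theorem TmOk.sc {k : ℕ} {L : LCtx} {e : Tm} {T : Ty} (h : TmOk k L e T) (hL : L.Wf) :
    e.Sc L.sh ∧ T.Sc L.sh :=
  (okSc k L hL).2.2.2.1 e T h

theorem SubOk.sc {k : ℕ} {L : LCtx} {σ : Subst} {Ψ : Ctx} (h : SubOk k L σ Ψ) (hL : L.Wf) :
    σ.Sc L.sh Ψ.sh :=
  (okSc k L hL).2.2.2.2 σ Ψ h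

theorem ExtOk.wf_loc {k : ℕ} {L : LCtx} {Ψ : Ctx} {n : ℕ} (h : ExtOk k (L.enter n) Ψ)
    (hL : L.Wf) : ((L.enter n).conss Ψ).Wf :=
  (hL.enter n).conss (h.sc (hL.enter n))

/-! ## Substitution for a block of declarations commutes with substitution -/

/-- Unlike in `Comp.env_left`, the block is added to the scope instead of replacing its variables
below `n`. This form is needed for a declaration that follows a block and for the body of a type
abstraction. -/
theorem Comp.conss_left {ℓ : ℕ} {G G' : SCtx} {E : Env} (hr : E.Reg ℓ) (hE : E.Sc G G')
    {σ : Subst} {Ψ : Sh} (h : σ.Sc G Ψ) {n ℓ₃ : ℕ} (hΨ : Ψ.erase.LevelLE n) (h₁ : n ≤ ℓ₃)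
    (h₂ : ℓ ≤ ℓ₃) :
    Comp (G.conss Ψ) G G' n ℓ ℓ₃ (σ.env [] Ψ.erase) E (Env.comp ℓ E (σ.env [] Ψ.erase)) :=
  ⟨h.env_reg hΨ _, hr, (h.env_reg hΨ _).comp h₁ h₂ hr, h.env_sc, hE,
    fun _ _ _ _ _ => rfl, h₁, h₂⟩

theorem Comp.conss_right {ℓ : ℕ} {G G' : SCtx} {E : Env} (hr : E.Reg ℓ) (hE : E.Sc G G')
    {σ : Subst} {Ψ : Sh} (h : σ.Sc G Ψ) {n ℓ₃ : ℕ} (hΨ : Ψ.erase.LevelLE n) (h₁ : n ≤ ℓ₃)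
    (h₂ : ℓ ≤ ℓ₃) :
    Comp (G.conss Ψ) (G'.conss Ψ) G' ℓ n ℓ₃ (E.lifts Ψ.erase) ((σ.subst ℓ E).env [] Ψ.erase)
      (Env.comp ℓ E (σ.env [] Ψ.erase)) := by
  have hσ := h.subst hr hE
  refine ⟨hr.lifts _, hσ.env_reg hΨ _, (h.env_reg hΨ _).comp h₁ h₂ hr, hE.lifts _,
    hσ.env_sc, ?_, h₂, h₁⟩
  rw [h.env_comp hr hE hΨ]
  exact fun _ _ _ _ _ => rfl

/-- Both sides are the same composite, taken at a level above both domains. It turns the type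
demanded of the next entry of `σ` into the type demanded after `E` has been applied to everything.
-/
theorem Decl.Sc.subst_env_comm {ℓ : ℕ} {G G' : SCtx} {E : Env} (hr : E.Reg ℓ) (hE : E.Sc G G')
    {σ : Subst} {Ψ : Ctx} (h : σ.Sc G Ψ.sh) {D : Decl} (hD : D.Sc (G.conss Ψ.sh)) :
    (D.subst Ψ.erase.level (σ.env [] Ψ.erase)).subst ℓ E =
      (D.subst ℓ (E.lifts Ψ.erase)).subst Ψ.erase.level ((σ.subst ℓ E).env [] Ψ.erase) := by
  have hΨ : Ψ.sh.erase.LevelLE Ψ.erase.level := by simpa using ECtx.levelLE_level _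
  have h1 := hD.subst_subst (Comp.conss_left hr hE h hΨ (le_max_right ℓ _) (le_max_left _ _))
  have h2 := hD.subst_subst (Comp.conss_right hr hE h hΨ (le_max_right ℓ _) (le_max_left _ _))
  rw [Ctx.erase_sh] at h1 h2
  rw [h1, h2]

theorem Ty.Sc.subst_env_comm {ℓ : ℕ} {G G' : SCtx} {E : Env} (hr : E.Reg ℓ) (hE : E.Sc G G')
    {σ : Subst} {Ψ : Ctx} (h : σ.Sc G Ψ.sh) {T : Ty} (hT : T.Sc (G.conss Ψ.sh)) :
    (T.simSubst [] σ Ψ.erase).subst ℓ E =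
      (T.subst ℓ (E.lifts Ψ.erase)).simSubst [] (σ.subst ℓ E) Ψ.erase := by
  have hΨ : Ψ.sh.erase.LevelLE Ψ.erase.level := by simpa using ECtx.levelLE_level _
  have h1 := hT.subst_subst (Comp.conss_left hr hE h hΨ (le_max_right ℓ _) (le_max_left _ _))
  have h2 := hT.subst_subst (Comp.conss_right hr hE h hΨ (le_max_right ℓ _) (le_max_left _ _))
  rw [Ctx.erase_sh] at h1 h2
  rw [Ty.simSubst, Ty.simSubst, h1, h2]

/-- The typing rule for variables substitutes at the level of the erased local context, hereditary
substitution at the level `n` of the variable. Both exceed the levels of the variables replaced,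
hence the results coincide. -/
theorem Ty.Sc.simSubst_eq {G : SCtx} {σ : Subst} {Φ : Ctx} {n : ℕ} {T : Ty}
    (hΦ : Φ.erase.LevelLE n) (hσ : σ.Sc G Φ.sh) (hT : T.Sc (G.loc n Φ.sh)) :
    T.simSubst [] σ Φ.erase = T.subst n (σ.env [] Φ.erase) :=
  Ty.subst_congr (hσ.env_reg_erase (ECtx.levelLE_level _)) (hσ.env_reg_erase hΦ)
    (fun _ _ _ _ _ => rfl) T hT

theorem Ty.Sc.simSubst_subst {ℓ : ℕ} {G G' : SCtx} {E : Env} (hr : E.Reg ℓ) (hE : E.Sc G G')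
    {σ : Subst} {Φ : Ctx} {n : ℕ} (hΦ : Φ.erase.LevelLE n) (hσ : σ.Sc G Φ.sh) {T : Ty}
    (hT : T.Sc (G.loc n Φ.sh)) :
    (T.simSubst [] σ Φ.erase).subst ℓ E =
      (T.subst ℓ (E.enter n)).simSubst [] (σ.subst ℓ E) Φ.erase := by
  have hΦ' : Φ.sh.erase.LevelLE n := by simpa using hΦ
  rw [hT.simSubst_eq hΦ hσ, (hT.subst (hr.enter n) (hE.loc _ _)).simSubst_eq hΦ (hσ.subst hr hE)]
  have h1 := hT.subst_subst (Comp.env_left hr hE hσ hΦ' (le_max_right ℓ _) (le_max_left _ _))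
  have h2 := hT.subst_subst (Comp.env_right hr hE hσ hΦ' (le_max_right ℓ _) (le_max_left _ _))
  rw [Ctx.erase_sh] at h1 h2
  rw [h1, h2]

theorem Ty.Sc.single_subst {ℓ : ℕ} {G G' : SCtx} {E : Env} (hr : E.Reg ℓ) (hE : E.Sc G G')
    {Φ : KCtx} {n : ℕ} {S T : Ty} (hT : T.Sc (G.loc n Φ.sh)) (hS : S.Sc (G.cons .ty n Φ.sh)) :
    (S.single Φ.toCtx.erase n T).subst ℓ E =
      (S.subst ℓ (E.lift .ty n)).single Φ.toCtx.erase n (T.subst ℓ (E.enter n)) := by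
  rw [Ty.single_eq, Ty.single_eq,
    Ty.Sc.subst_env_comm (Ψ := Ctx.snoc .nil (.ty Φ n)) hr hE (Subst.Sc.single hT) hS]
  simp only [Subst.subst]
  rfl

/-! ## Typed environments -/

/-- The image of a variable, declared by `D` after the substitution, is well typed. -/
def TImg (ℓ : ℕ) (L : LCtx) : Img → Decl → Prop
  | .var j, D => L D.sort D.level j = some D
  | .ty Φ T, D => ∃ Ψ n a b, D = .ty Ψ n ∧ n < ℓ ∧ Φ = Ψ.toCtx.erase ∧
      ExtOk a (L.enter n) Ψ.toCtx ∧ TyOk b ((L.enter n).conss Ψ.toCtx) T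
  | .tm Φ e, D => ∃ Ψ n S a b, D = .tm Ψ n S ∧ n < ℓ ∧ Φ = Ψ.erase ∧
      ExtOk a (L.enter n) Ψ ∧ TmOk b ((L.enter n).conss Ψ) e S

/-- `E` is a well-typed environment from `L` to `L'`, with a domain of level `ℓ`. -/
structure TEnv (ℓ : ℕ) (L : LCtx) (E : Env) (L' : LCtx) : Prop where
  reg : E.Reg ℓ
  typ : ∀ s n i D, L s n i = some D → TImg ℓ L' (E s n i) (D.subst ℓ E)

/-- Typing speaks about the substituted declaration, scoping about the original one; the two have
the same shape. -/
theorem TEnv.sc {ℓ : ℕ} {L L' : LCtx} {E : Env} (h : TEnv ℓ L E L') (hL : L.Wf) (hL' : L'.Wf) :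
    E.Sc L.sh L'.sh := by
  intro s n i Ψ hi
  obtain ⟨D, hD, rfl⟩ := LCtx.sh_some hi
  obtain ⟨rfl, rfl, hsc⟩ := hL _ _ _ _ hD
  have ht := h.typ _ _ _ _ hD
  generalize E D.sort D.level i = a at ht
  cases a with
  | var j =>
    simp only [TImg, Decl.sort_subst, Decl.level_subst] at ht
    simp [Img.Sc, LCtx.sh, ht]
  | ty Φ T =>
    obtain ⟨Ψ, n, a, b, heq, hn, rfl, h1, h2⟩ := ht
    have h3 := h2.sc (h1.wf_loc hL')
    cases D with
    | tm Ψ' m S => simp [Decl.subst] at heq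
    | ty Ψ' m =>
      simp only [Decl.subst, Decl.ty.injEq] at heq
      obtain ⟨rfl, rfl⟩ := heq
      rw [LCtx.sh_loc hsc, KCtx.sh_toCtx] at h3
      exact ⟨rfl, by rw [← Ctx.erase_sh, KCtx.sh_toCtx]; rfl, h3⟩
  | tm Φ e =>
    obtain ⟨Ψ, n, S, a, b, heq, hn, rfl, h1, h2⟩ := ht
    have h3 := (h2.sc (h1.wf_loc hL')).1
    cases D with
    | ty Ψ' m => simp [Decl.subst] at heq
    | tm Ψ' m S' =>
      simp only [Decl.subst, Decl.tm.injEq] at heq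
      obtain ⟨rfl, rfl, rfl⟩ := heq
      rw [LCtx.sh_loc (by simpa using hsc.1)] at h3
      exact ⟨rfl, by simp [Decl.sh], by simpa [Decl.sh, Decl.level] using h3⟩

theorem TEnv.congr {ℓ : ℕ} {L L' : LCtx} {E E' : Env} (h : TEnv ℓ L E L') (hL : L.Wf)
    (hE' : E'.Reg ℓ) (ha : Env.Agree L.sh E E') : TEnv ℓ L E' L' := by
  refine ⟨hE', fun s n i D hD => ?_⟩
  rw [← ha s n i D.sh (by simp [LCtx.sh, hD]), ← Decl.subst_congr h.reg hE' ha D (hL _ _ _ _ hD).2.2]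
  exact h.typ _ _ _ _ hD

theorem TEnv.mono {ℓ : ℕ} {L₀ L L' : LCtx} {E : Env} (h : TEnv ℓ L E L')
    (h₀ : ∀ s n i D, L₀ s n i = some D → L s n i = some D) : TEnv ℓ L₀ E L' :=
  ⟨h.reg, fun s n i D hD => h.typ s n i D (h₀ _ _ _ _ hD)⟩

theorem TImg.enter {ℓ : ℕ} {L : LCtx} {a : Img} {D : Decl} (h : TImg ℓ L a D) {n : ℕ}
    (hn : n ≤ D.level) : TImg ℓ (L.enter n) a D := by
  cases a with
  | var j => simpa [TImg, LCtx.enter, show ¬ D.level < n by omega] using h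
  | ty Φ T =>
    obtain ⟨Ψ, m, a, b, rfl, h1, h2, h3, h4⟩ := h
    rw [Decl.level] at hn
    exact ⟨Ψ, m, a, b, rfl, h1, h2, by rwa [LCtx.enter_enter hn], by rwa [LCtx.enter_enter hn]⟩
  | tm Φ e =>
    obtain ⟨Ψ, m, S, a, b, rfl, h1, h2, h3, h4⟩ := h
    rw [Decl.level] at hn
    exact ⟨Ψ, m, S, a, b, rfl, h1, h2, by rwa [LCtx.enter_enter hn], by rwa [LCtx.enter_enter hn]⟩

theorem Decl.subst_enter {n : ℕ} {D : Decl} (h : n ≤ D.level) (ℓ : ℕ) (E : Env) :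
    D.subst ℓ (E.enter n) = D.subst ℓ E := by
  cases D with
  | ty Ψ m => simp [Decl.subst]
  | tm Ψ m T => simp [Decl.subst, Env.enter_enter (show n ≤ m from h)]

theorem TEnv.enter {ℓ : ℕ} {L L' : LCtx} {E : Env} (h : TEnv ℓ L E L') (hL : L.Wf) (n : ℕ) :
    TEnv ℓ (L.enter n) (E.enter n) (L'.enter n) := by
  refine ⟨h.reg.enter n, fun s k i D hD => ?_⟩
  by_cases hk : k < n
  · simp [LCtx.enter, hk] at hD
  · simp only [LCtx.enter, hk, if_false] at hD
    have hl : n ≤ D.level := by have := (hL _ _ _ _ hD).2.1; omega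
    rw [Decl.subst_enter hl]
    simp only [Env.enter, hk, if_false]
    exact (h.typ _ _ _ _ hD).enter (by simpa using hl)

/-- Well-typed environments with a domain of level `ℓ` can be extended under binders. -/
def LiftClosed (ℓ : ℕ) : Prop := ∀ (L L' : LCtx) (E : Env) (D : Decl), L.Wf → L'.Wf → D.Sc L.sh →
  TEnv ℓ L E L' → TEnv ℓ (L.cons D) (E.lift D.sort D.level) (L'.cons (D.subst ℓ E))

theorem TEnv.lifts {ℓ : ℕ} (hℓ : LiftClosed ℓ) {L L' : LCtx} {E : Env} (h : TEnv ℓ L E L')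
    (hL : L.Wf) (hL' : L'.Wf) : ∀ Ψ : Ctx, Ψ.Sc L.sh →
    TEnv ℓ (L.conss Ψ) (E.lifts Ψ.erase) (L'.conss (Ψ.subst ℓ E))
  | .nil, _ => by rw [Ctx.subst]; exact h
  | .snoc Δ D, ⟨h1, h2⟩ => by
    have h3 := TEnv.lifts hℓ h hL hL' Δ h1
    rw [Ctx.subst]
    exact hℓ _ _ _ D (hL.conss h1) (hL'.conss (h1.subst h.reg (h.sc hL hL')))
      (by rwa [LCtx.sh_conss]) h3

/-- The local context is passed one declaration at a time, which only requires extension under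
single binders; agreement in scope then replaces the lifted environment by the chopped one. -/
theorem TEnv.loc {ℓ : ℕ} (hℓ : LiftClosed ℓ) {L L' : LCtx} {E : Env} (h : TEnv ℓ L E L')
    (hL : L.Wf) (hL' : L'.Wf) {n : ℕ} {Ψ : Ctx} (hn : Ψ.erase.LevelLE n)
    (hΨ : Ψ.Sc (L.enter n).sh) :
    TEnv ℓ ((L.enter n).conss Ψ) (E.enter n) ((L'.enter n).conss (Ψ.subst ℓ (E.enter n))) := by
  refine ((h.enter hL n).lifts hℓ (hL.enter n) (hL'.enter n) Ψ hΨ).congr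
    ((hL.enter n).conss hΨ) (h.reg.enter n) ?_
  have := Env.lifts_agree_enter (Ψ := Ψ.sh) (n := n) (by simpa using hn) (E.enter n) L.sh
  rw [Env.enter_enter le_rfl, Ctx.erase_sh] at this
  rwa [LCtx.sh_loc hn]

theorem LCtx.conss_mono {L₀ L : LCtx} (h : ∀ s n i D, L₀ s n i = some D → L s n i = some D)
    (Ψ : Ctx) : ∀ s n i D, L₀.conss Ψ s n i = some D → L.conss Ψ s n i = some D := by
  cases Ψ with
  | nil => exact h
  | snoc Δ D =>
    intro s k i D' hi
    have ih := LCtx.conss_mono h Δ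
    simp only [LCtx.conss] at hi ⊢
    obtain ⟨rfl, rfl, rfl⟩ | ⟨j, rfl⟩ := Ren.wk_cases D.sort D.level s k i
    · simpa using hi
    · simp only [LCtx.cons_wk, Option.map_eq_some_iff] at hi ⊢
      obtain ⟨D₀, h0, rfl⟩ := hi
      exact ⟨D₀, ih _ _ _ _ h0, rfl⟩

theorem LCtx.of_enter {L : LCtx} {n : ℕ} {s : VarSort} {k i : ℕ} {D : Decl}
    (h : L.enter n s k i = some D) : L s k i = some D := by
  by_cases hk : k < n
  · simp [LCtx.enter, hk] at h
  · simpa [LCtx.enter, hk] using h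

/-- An environment extended by the image of one variable. -/
theorem TEnv.cons {ℓ : ℕ} {L L' : LCtx} {E : Env} (h : TEnv ℓ L E L') {D : Decl} {a : Img}
    (hr : a.Reg ℓ D.sort D.level) (ha : TImg ℓ L' a (D.subst ℓ E)) :
    TEnv ℓ (L.cons D) (E.cons D.sort D.level a) L' := by
  have hreg := h.reg.cons hr
  -- A declaration weakened by the new variable does not see the entry for it.
  have hpre : (E.cons D.sort D.level a).precomp (Ren.wk D.sort D.level) = E := by
    funext s k i; simp [Env.precomp, Env.cons_eq]
  refine ⟨hreg, fun s k i D' hi => ?_⟩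
  obtain ⟨rfl, rfl, rfl⟩ | ⟨j, rfl⟩ := Ren.wk_cases D.sort D.level s k i
  · simp only [LCtx.cons_zero, Option.some.injEq] at hi
    subst hi
    rw [Decl.weakenBy, Decl.subst_ren _ _ _ hreg, hpre]
    simpa [Env.cons_eq] using ha
  · simp only [LCtx.cons_wk, Option.map_eq_some_iff] at hi
    obtain ⟨D₀, h0, rfl⟩ := hi
    rw [Decl.weakenBy, Decl.subst_ren _ _ _ hreg, hpre]
    simpa [Env.cons_eq] using h.typ _ _ _ _ h0

theorem TEnv.id {L : LCtx} (hL : L.Wf) (ℓ : ℕ) : TEnv ℓ L Ren.id.env L := by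
  refine ⟨Ren.env_reg _ _, fun s k i D hD => ?_⟩
  obtain ⟨rfl, rfl, -⟩ := hL _ _ _ _ hD
  rw [Decl.subst_env, Decl.ren_id]
  exact hD

/-- The rules for substitutions type each entry against its declaration substituted by the earlier
entries, which is what an environment from the extended lookup function requires. -/
theorem SubOk.tenv {k : ℕ} {L : LCtx} {σ : Subst} {Ψ : Ctx} (h : SubOk k L σ Ψ) (hL : L.Wf)
    {ℓ : ℕ} (hΨ : Ψ.erase.LevelLE ℓ) : TEnv ℓ (L.conss Ψ) (σ.env [] Ψ.erase) L := by
  induction k using Nat.strong_induction_on generalizing σ Ψ with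
  | _ k ih =>
  -- The rules substitute at the level of the initial part `Δ`, the environment at the common bound
  -- `ℓ`; the level being irrelevant, these agree.
  have key : ∀ {a b : ℕ} {Δ : Ctx} {D : Decl} {σ : Subst}, a < k → SubOk a L σ Δ →
      ExtOk b L (.snoc Δ D) → (Ctx.snoc Δ D).erase.LevelLE ℓ →
      TEnv ℓ (L.conss Δ) (σ.env [] Δ.erase) L ∧ D.level < ℓ ∧
      D.subst ℓ (σ.env [] Δ.erase) = D.subst Δ.erase.level (σ.env [] Δ.erase) := by
    intro a b Δ D σ ha hσ hD hl
    have hl' : Δ.erase.LevelLE ℓ := fun p hp => hl p (by simp [Ctx.erase, hp])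
    refine ⟨ih a ha hσ hl', hl (D.sort, D.level) (by simp [Ctx.erase]), ?_⟩
    have hsc := hσ.sc hL
    exact Decl.subst_congr (hsc.env_reg_erase hl') (hsc.env_reg_erase (ECtx.levelLE_level _))
      (fun _ _ _ _ _ => rfl) D (hD.sc hL).2
  cases h with
  | nil => simpa [Ctx.erase, LCtx.conss] using TEnv.id hL ℓ
  | @tm a b c d _ Δ Ψ n T σ e h1 h2 h3 h4 =>
    obtain ⟨h5, h6, h7⟩ := key (by omega) h2 h1 hΨ
    have := Subst.env_snoc [] σ .tm n (.tm Ψ.erase e) Δ.erase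
    rw [Subst.snoc] at this
    simp only [Ctx.erase, Decl.sort, Decl.level, LCtx.conss]
    rw [this]
    refine TEnv.cons (D := .tm Ψ n T) h5 ⟨rfl, h6⟩ ?_
    rw [h7, Decl.subst]
    exact ⟨_, _, _, _, _, rfl, h6, by simp, h3, h4⟩
  | @tmVar a b _ Δ Ψ n i T σ h1 h2 h3 =>
    obtain ⟨h5, h6, h7⟩ := key (by omega) h2 h1 hΨ
    have := Subst.env_snoc [] σ .tm n (.var i) Δ.erase
    rw [Subst.snoc] at this
    simp only [Ctx.erase, Decl.sort, Decl.level, LCtx.conss]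
    rw [this]
    refine TEnv.cons (D := .tm Ψ n T) h5 trivial ?_
    rw [h7, Decl.subst]
    exact h3
  | @ty a b c d _ Δ Ψ n σ T h1 h2 h3 h4 =>
    obtain ⟨h5, h6, h7⟩ := key (by omega) h2 h1 hΨ
    have := Subst.env_snoc [] σ .ty n (.ty Ψ.toCtx.erase T) Δ.erase
    rw [Subst.snoc] at this
    simp only [Ctx.erase, Decl.sort, Decl.level, LCtx.conss]
    rw [this]
    refine TEnv.cons (D := .ty Ψ n) h5 ⟨rfl, h6⟩ ?_
    rw [Decl.subst]
    exact ⟨_, _, _, _, rfl, h6, rfl, h3, h4⟩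
  | @tyVar a b _ Δ Ψ n i σ h1 h2 h3 =>
    obtain ⟨h5, h6, h7⟩ := key (by omega) h2 h1 hΨ
    have := Subst.env_snoc [] σ .ty n (.var i) Δ.erase
    rw [Subst.snoc] at this
    simp only [Ctx.erase, Decl.sort, Decl.level, LCtx.conss]
    rw [this]
    refine TEnv.cons (D := .ty Ψ n) h5 trivial ?_
    rw [Decl.subst]
    exact h3

theorem SubOk.tenv_loc {k : ℕ} {L : LCtx} {σ : Subst} {Ψ : Ctx} (h : SubOk k L σ Ψ) (hL : L.Wf)
    {n : ℕ} (hΨ : Ψ.erase.LevelLE n) : TEnv n ((L.enter n).conss Ψ) (σ.env [] Ψ.erase) L :=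
  (h.tenv hL hΨ).mono (LCtx.conss_mono (fun _ _ _ _ => LCtx.of_enter) Ψ)

/-! ## Substitution preserves typing -/

@[simp] theorem KCtx.subst_toCtx (ℓ : ℕ) (E : Env) : ∀ Φ : KCtx, Φ.toCtx.subst ℓ E = Φ.toCtx
  | .nil => by simp [KCtx.toCtx, Ctx.subst]
  | .snoc Φ Ψ n => by simp [KCtx.toCtx, Ctx.subst, KCtx.subst_toCtx _ _ Φ, Decl.subst]

/-- Substitution in derivations of size `k`. The size does not grow if only variables are
substituted. -/
def SubstOk (ℓ k : ℕ) : Prop := ∀ (L L' : LCtx) (E : Env), L.Wf → L'.Wf → TEnv ℓ L E L' →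
  (∀ D, DeclOk k L D → ∃ k', (ℓ = 0 → k' ≤ k) ∧ DeclOk k' L' (D.subst ℓ E)) ∧
  (∀ Ψ, ExtOk k L Ψ → ∃ k', (ℓ = 0 → k' ≤ k) ∧ ExtOk k' L' (Ψ.subst ℓ E)) ∧
  (∀ T, TyOk k L T → ∃ k', (ℓ = 0 → k' ≤ k) ∧ TyOk k' L' (T.subst ℓ E)) ∧
  (∀ e T, TmOk k L e T → ∃ k', (ℓ = 0 → k' ≤ k) ∧ TmOk k' L' (e.subst ℓ E) (T.subst ℓ E)) ∧
  (∀ σ Ψ, SubOk k L σ Ψ → ∃ k', (ℓ = 0 → k' ≤ k) ∧ SubOk k' L' (σ.subst ℓ E) (Ψ.subst ℓ E))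

-- The inductive step for each judgment, at a fixed level of the domain

section Step

variable {ℓ k : ℕ} (hℓ : LiftClosed ℓ)
  (ih : ∀ j < k, SubstOk ℓ j) {L L' : LCtx} {E : Env} (hL : L.Wf) (hL' : L'.Wf)
  (hE : TEnv ℓ L E L')
include hℓ ih hL hL' hE

theorem DeclOk.subst_step {D : Decl} (h : DeclOk k L D) :
    ∃ k', (ℓ = 0 → k' ≤ k) ∧ DeclOk k' L' (D.subst ℓ E) := by
  cases h with
  | @tm a b _ Φ n T h1 h2 h3 =>
    obtain ⟨a', ha, h4⟩ := (ih a (by omega) _ _ _ (hL.enter n) (hL'.enter n) (hE.enter hL n)).2.1 _ h2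
    have hloc := hE.loc hℓ hL hL' h1 (h2.sc (hL.enter n))
    obtain ⟨b', hb, h5⟩ := (ih b (by omega) _ _ _ (h2.wf_loc hL) (h4.wf_loc hL') hloc).2.2.1 _ h3
    rw [Decl.subst]
    exact ⟨a' + b' + 1, fun h => by have := ha h; have := hb h; omega,
      .tm (by simpa using h1) h4 h5⟩
  | @ty a _ Φ n h1 h2 =>
    obtain ⟨a', ha, h4⟩ := (ih a (by omega) _ _ _ (hL.enter n) (hL'.enter n) (hE.enter hL n)).2.1 _ h2
    rw [KCtx.subst_toCtx] at h4
    rw [Decl.subst]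
    exact ⟨a' + 1, fun h => by have := ha h; omega, .ty h1 h4⟩

theorem ExtOk.subst_step {Ψ : Ctx} (h : ExtOk k L Ψ) :
    ∃ k', (ℓ = 0 → k' ≤ k) ∧ ExtOk k' L' (Ψ.subst ℓ E) := by
  cases h with
  | nil => rw [Ctx.subst]; exact ⟨1, fun _ => le_rfl, .nil⟩
  | @snoc a b _ Δ D h1 h2 h3 =>
    obtain ⟨a', ha, h4⟩ := (ih a (by omega) _ _ _ hL hL' hE).2.1 _ h1
    obtain ⟨b', hb, h5⟩ := (ih b (by omega) _ _ _ (hL.conss (h1.sc hL)) (hL'.conss (h4.sc hL'))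
      (hE.lifts hℓ hL hL' Δ (h1.sc hL))).1 _ h3
    rw [Ctx.subst]
    exact ⟨a' + b' + 1, fun h => by have := ha h; have := hb h; omega,
      .snoc h4 (by simpa using h2) h5⟩

/-- If a variable entry is replaced by an object, the rule for variable entries turns into the rule
for objects, with its additional premises supplied by the typing of the image. The types of entries
match by the interchange law. -/
theorem SubOk.subst_step {σ : Subst} {Ψ : Ctx} (h : SubOk k L σ Ψ) :
    ∃ k', (ℓ = 0 → k' ≤ k) ∧ SubOk k' L' (σ.subst ℓ E) (Ψ.subst ℓ E) := by
  have hsc := hE.sc hL hL'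
  cases h with
  | nil => rw [Ctx.subst, Subst.subst]; exact ⟨1, fun _ => le_rfl, .nil⟩
  | @tm a b c d _ Δ Ψ n T σ e h1 h2 h3 h4 =>
    obtain ⟨a', ha, h5⟩ := (ih a (by omega) _ _ _ hL hL' hE).2.1 _ h1
    obtain ⟨b', hb, h6⟩ := (ih b (by omega) _ _ _ hL hL' hE).2.2.2.2 _ _ h2
    obtain ⟨c', hc, h7⟩ := (ih c (by omega) _ _ _ (hL.enter n) (hL'.enter n) (hE.enter hL n)).2.1 _ h3
    have hD := (h1.sc hL).2
    have hn : (Ψ.simSubstLocal n σ Δ.erase).erase.LevelLE n := by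
      simpa [Ctx.simSubstLocal] using hD.1
    have hloc := hE.loc hℓ hL hL' hn (h3.sc (hL.enter n))
    obtain ⟨d', hd, h8⟩ := (ih d (by omega) _ _ _ (h3.wf_loc hL) (h7.wf_loc hL')
      hloc).2.2.2.1 _ _ h4
    have heq := hD.subst_env_comm hE.reg hsc (h2.sc hL)
    simp only [Decl.subst, Decl.tm.injEq, true_and] at heq
    rw [Ctx.simSubstLocal, heq.1] at h7 h8
    rw [Ty.simSubstLocal, heq.2] at h8
    rw [Ctx.subst, Decl.subst] at h5 ⊢
    rw [Subst.subst]
    have := SubOk.tm (Ψ := Ψ.subst ℓ ((E.lifts Δ.erase).enter n)) (e := e.subst ℓ (E.enter n)) h5 h6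
      (by rw [Ctx.erase_subst]; exact h7) (by rw [Ctx.erase_subst]; exact h8)
    rw [Ctx.erase_subst] at this
    exact ⟨a' + b' + c' + d' + 1,
      fun h => by have := ha h; have := hb h; have := hc h; have := hd h; omega, this⟩
  | @tmVar a b _ Δ Ψ n i T σ h1 h2 h3 =>
    obtain ⟨a', ha, h5⟩ := (ih a (by omega) _ _ _ hL hL' hE).2.1 _ h1
    obtain ⟨b', hb, h6⟩ := (ih b (by omega) _ _ _ hL hL' hE).2.2.2.2 _ _ h2
    have hD := (h1.sc hL).2
    have heq := hD.subst_env_comm hE.reg hsc (h2.sc hL)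
    have hi := hE.typ _ _ _ _ h3
    simp only [Decl.subst, Decl.tm.injEq, true_and] at heq
    rw [Decl.subst, Ctx.simSubstLocal, heq.1, Ty.simSubstLocal, heq.2] at hi
    rw [Ctx.subst, Decl.subst] at h5 ⊢
    rw [Subst.subst]
    generalize E .tm n i = x at hi
    cases x with
    | var j =>
      exact ⟨a' + b' + 1, fun h => by have := ha h; have := hb h; omega,
        .tmVar h5 h6 (by rw [Ctx.erase_subst]; exact hi)⟩
    | ty Φ' T =>
      obtain ⟨_, _, _, _, heq, -⟩ := hi
      simp at heq
    | tm Φ' e =>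
      obtain ⟨_, m, _, c, d, heq, hm, rfl, h7, h8⟩ := hi
      simp only [Decl.tm.injEq] at heq
      obtain ⟨rfl, rfl, rfl⟩ := heq
      have := SubOk.tm (Ψ := Ψ.subst ℓ ((E.lifts Δ.erase).enter n)) (e := e) h5 h6
        (by rw [Ctx.erase_subst]; exact h7) (by rw [Ctx.erase_subst]; exact h8)
      rw [Ctx.erase_subst] at this
      simp only [Ctx.erase_subst]
      -- An object image forces `0 < ℓ`, so the size bound, claimed for `ℓ = 0` only, is vacuous.
      exact ⟨_, fun h => by omega, this⟩
  | @ty a b c d _ Δ Ψ n σ T h1 h2 h3 h4 =>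
    obtain ⟨a', ha, h5⟩ := (ih a (by omega) _ _ _ hL hL' hE).2.1 _ h1
    obtain ⟨b', hb, h6⟩ := (ih b (by omega) _ _ _ hL hL' hE).2.2.2.2 _ _ h2
    obtain ⟨c', hc, h7⟩ := (ih c (by omega) _ _ _ (hL.enter n) (hL'.enter n) (hE.enter hL n)).2.1 _ h3
    have hloc := hE.loc hℓ hL hL' (h1.sc hL).2 (h3.sc (hL.enter n))
    rw [KCtx.subst_toCtx] at hloc h7
    obtain ⟨d', hd, h8⟩ := (ih d (by omega) _ _ _ (h3.wf_loc hL) (h7.wf_loc hL')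
      hloc).2.2.1 _ h4
    rw [Ctx.subst, Decl.subst] at h5 ⊢
    rw [Subst.subst]
    exact ⟨a' + b' + c' + d' + 1,
      fun h => by have := ha h; have := hb h; have := hc h; have := hd h; omega,
      .ty h5 h6 h7 h8⟩
  | @tyVar a b _ Δ Ψ n i σ h1 h2 h3 =>
    obtain ⟨a', ha, h5⟩ := (ih a (by omega) _ _ _ hL hL' hE).2.1 _ h1
    obtain ⟨b', hb, h6⟩ := (ih b (by omega) _ _ _ hL hL' hE).2.2.2.2 _ _ h2
    have hi := hE.typ _ _ _ _ h3
    rw [Decl.subst] at hi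
    rw [Ctx.subst, Decl.subst] at h5 ⊢
    rw [Subst.subst]
    generalize E .ty n i = x at hi
    cases x with
    | var j =>
      exact ⟨a' + b' + 1, fun h => by have := ha h; have := hb h; omega, .tyVar h5 h6 hi⟩
    | ty Φ' T =>
      obtain ⟨_, m, c, d, heq, hm, rfl, h7, h8⟩ := hi
      simp only [Decl.ty.injEq] at heq
      obtain ⟨rfl, rfl⟩ := heq
      exact ⟨_, fun h => by omega, .ty h5 h6 h7 h8⟩
    | tm Φ' e =>
      obtain ⟨_, _, _, _, _, heq, -⟩ := hi
      simp at heq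

variable (IH : ∀ n < ℓ, ∀ k, SubstOk n k)
include IH

/-- At a replaced variable the induction on size types the substituted `σ`, and the induction on the
level substitutes it in the image. The derivation for the image may have any size, so the smaller
level must be available for all sizes. -/
theorem TyOk.subst_step {T : Ty} (h : TyOk k L T) :
    ∃ k', (ℓ = 0 → k' ≤ k) ∧ TyOk k' L' (T.subst ℓ E) := by
  cases h with
  | @tvar a _ n i Φ σ h1 h2 =>
    obtain ⟨a', ha, h4⟩ := (ih a (by omega) _ _ _ hL hL' hE).2.2.2.2 _ _ h2
    rw [KCtx.subst_toCtx] at h4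
    have hi := hE.typ _ _ _ _ h1
    have hn : Φ.toCtx.erase.LevelLE n := (hL _ _ _ _ h1).2.2
    rw [Ty.subst]
    generalize E .ty n i = x at hi
    cases x with
    | var j =>
      rw [Decl.subst] at hi
      exact ⟨a' + 1, fun h => by have := ha h; omega, .tvar hi h4⟩
    | ty Φ' T =>
      obtain ⟨Ψ, m, b, c, heq, hm, rfl, h5, h6⟩ := hi
      simp only [Decl.subst, Decl.ty.injEq] at heq
      obtain ⟨rfl, rfl⟩ := heq
      simp only [hm, if_true]
      obtain ⟨k', -, h7⟩ := (IH n hm c _ _ _ (h5.wf_loc hL') hL' (h4.tenv_loc hL' hn)).2.2.1 _ h6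
      exact ⟨k', fun h => by omega, h7⟩
    | tm Φ' e =>
      obtain ⟨Ψ, m, S, b, c, heq, -⟩ := hi
      simp [Decl.subst] at heq
  | @arr a b _ S T h1 h2 =>
    obtain ⟨a', ha, h4⟩ := (ih a (by omega) _ _ _ hL hL' hE).2.2.1 _ h1
    obtain ⟨b', hb, h5⟩ := (ih b (by omega) _ _ _ hL hL' hE).2.2.1 _ h2
    rw [Ty.subst]
    exact ⟨a' + b' + 1, fun h => by have := ha h; have := hb h; omega, .arr h4 h5⟩
  | @all a b _ Φ n T h1 h2 =>
    obtain ⟨a', ha, h4⟩ := (ih a (by omega) _ _ _ hL hL' hE).1 _ h1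
    have hl := hℓ _ _ _ _ hL hL' (h1.sc hL) hE
    obtain ⟨b', hb, h5⟩ := (ih b (by omega) _ _ _ (hL.cons (h1.sc hL)) (hL'.cons (h4.sc hL'))
      hl).2.2.1 _ h2
    rw [Decl.subst] at h4 h5
    rw [Ty.subst]
    exact ⟨a' + b' + 2, fun h => by have := ha h; have := hb h; omega, .all h4 h5⟩
  | @box a _ Φ n T h1 h2 =>
    obtain ⟨a', ha, h4⟩ := (ih a (by omega) _ _ _ hL hL' hE).1 _ h2
    rw [Decl.subst] at h4
    rw [Ty.subst]
    exact ⟨a' + 1, fun h => by have := ha h; omega, .box h1 h4⟩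

theorem TmOk.subst_step {e : Tm} {T : Ty} (h : TmOk k L e T) :
    ∃ k', (ℓ = 0 → k' ≤ k) ∧ TmOk k' L' (e.subst ℓ E) (T.subst ℓ E) := by
  have hsc := hE.sc hL hL'
  cases h with
  | @var a _ n i Φ T σ h1 h2 =>
    obtain ⟨a', ha, h4⟩ := (ih a (by omega) _ _ _ hL hL' hE).2.2.2.2 _ _ h2
    have hi := hE.typ _ _ _ _ h1
    obtain ⟨-, -, hn, hΦ, hT⟩ := hL _ _ _ _ h1
    -- The local context of `x` refers to ambient variables of level at least `n` only, so dropping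
    -- the lower entries does not change it. This matches the domain obtained for `σ` with the
    -- declaration of the image.
    have hΦ' : Φ.subst ℓ E = Φ.subst ℓ (E.enter n) := by
      refine Ctx.subst_congr hE.reg (hE.reg.enter n) ?_ Φ hΦ
      intro s k i Ψ hk
      by_cases hkn : k < n
      · simp [SCtx.enter, hkn] at hk
      · simp [Env.enter, hkn]
    have hσ := h2.sc hL
    rw [hΦ'] at h4
    rw [hT.simSubst_subst hE.reg hsc hn hσ, Tm.subst]
    generalize E .tm n i = x at hi
    rw [Decl.subst] at hi
    cases x with
    | var j =>
      have := TmOk.var hi h4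
      rw [Ctx.erase_subst] at this
      exact ⟨a' + 1, fun h => by have := ha h; omega, this⟩
    | ty Φ' T =>
      obtain ⟨Ψ, m, b, c, heq, -⟩ := hi
      simp at heq
    | tm Φ' e =>
      obtain ⟨Ψ, m, S, b, c, heq, hm, rfl, h5, h6⟩ := hi
      simp only [Decl.tm.injEq] at heq
      obtain ⟨rfl, rfl, rfl⟩ := heq
      simp only [hm, if_true]
      obtain ⟨k', -, h7⟩ := (IH n hm c _ _ _ (h5.wf_loc hL') hL'
        (h4.tenv_loc hL' (by simpa using hn))).2.2.2.1 _ _ h6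
      rw [(hT.subst (hE.reg.enter n) (hsc.loc _ _)).simSubst_eq hn (hσ.subst hE.reg hsc)]
      rw [Ctx.erase_subst] at h7 ⊢
      exact ⟨k', fun h => by omega, h7⟩
  | @lam a b _ S T e h1 h2 =>
    obtain ⟨a', ha, h4⟩ := (ih a (by omega) _ _ _ hL hL' hE).1 _ h1
    have hl := hℓ _ _ _ _ hL hL' (h1.sc hL) hE
    obtain ⟨b', hb, h5⟩ := (ih b (by omega) _ _ _ (hL.cons (h1.sc hL)) (hL'.cons (h4.sc hL'))
      hl).2.2.2.1 _ _ h2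
    have hT := Ty.Sc.of_wk (LCtx.sh_cons L _ ▸ (h2.sc (hL.cons (h1.sc hL))).2)
    have h0 : E.enter 0 = E := by funext s k i; simp [Env.enter]
    rw [Decl.subst, Ctx.subst, h0] at h4 h5
    simp only [Decl.sort, Decl.level] at h5
    -- The result type does not depend on the bound variable: it is a weakening, and stays one after
    -- substitution.
    rw [hT.subst_wk hE.reg hsc] at h5
    rw [Tm.subst, Ty.subst]
    exact ⟨a' + b' + 2, fun h => by have := ha h; have := hb h; omega, .lam h4 h5⟩
  | @app a b _ S T e₁ e₂ h1 h2 =>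
    obtain ⟨a', ha, h4⟩ := (ih a (by omega) _ _ _ hL hL' hE).2.2.2.1 _ _ h1
    obtain ⟨b', hb, h5⟩ := (ih b (by omega) _ _ _ hL hL' hE).2.2.2.1 _ _ h2
    rw [Ty.subst] at h4
    rw [Tm.subst]
    exact ⟨a' + b' + 1, fun h => by have := ha h; have := hb h; omega, .app h4 h5⟩
  | @tlam a b _ Φ n T e h1 h2 =>
    obtain ⟨a', ha, h4⟩ := (ih a (by omega) _ _ _ hL hL' hE).1 _ h1
    have hl := hℓ _ _ _ _ hL hL' (h1.sc hL) hE
    obtain ⟨b', hb, h5⟩ := (ih b (by omega) _ _ _ (hL.cons (h1.sc hL)) (hL'.cons (h4.sc hL'))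
      hl).2.2.2.1 _ _ h2
    rw [Decl.subst] at h4 h5
    rw [Tm.subst, Ty.subst]
    exact ⟨a' + b' + 2, fun h => by have := ha h; have := hb h; omega, .tlam h4 h5⟩
  | @tapp a b c _ Φ n S T e h1 h2 h3 =>
    obtain ⟨a', ha, h4⟩ := (ih a (by omega) _ _ _ hL hL' hE).2.2.2.1 _ _ h1
    obtain ⟨b', hb, h5⟩ := (ih b (by omega) _ _ _ hL hL' hE).1 _ h2
    have hn : Φ.toCtx.erase.LevelLE n := h2.sc hL
    have hS := (h1.sc hL).2.2
    obtain ⟨d, hd⟩ : ∃ d, ExtOk d (L.enter n) Φ.toCtx := by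
      cases h2 with | ty _ h => exact ⟨_, h⟩
    have hT := h3.sc (hd.wf_loc hL)
    rw [LCtx.sh_loc hn, KCtx.sh_toCtx] at hT
    rw [Decl.subst] at h5
    obtain ⟨d', hd'⟩ : ∃ d, ExtOk d (L'.enter n) Φ.toCtx := by
      cases h5 with | ty _ h => exact ⟨_, h⟩
    have hloc := hE.loc hℓ hL hL' hn (hd.sc (hL.enter n))
    rw [KCtx.subst_toCtx] at hloc
    obtain ⟨c', hc, h6⟩ := (ih c (by omega) _ _ _ (hd.wf_loc hL) (hd'.wf_loc hL') hloc).2.2.1 _ h3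
    rw [Ty.subst] at h4
    rw [Tm.subst, Ty.Sc.single_subst hE.reg hsc hT hS]
    exact ⟨a' + b' + c' + 1,
      fun h => by have := ha h; have := hb h; have := hc h; omega, .tapp h4 h5 h6⟩
  | @box a b _ Φ n T e h1 h2 h3 h4 =>
    obtain ⟨a', ha, h5⟩ := (ih a (by omega) _ _ _ (hL.enter n) (hL'.enter n) (hE.enter hL n)).2.1 _ h3
    have hloc := hE.loc hℓ hL hL' h2 (h3.sc (hL.enter n))
    obtain ⟨b', hb, h6⟩ := (ih b (by omega) _ _ _ (h3.wf_loc hL) (h5.wf_loc hL')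
      hloc).2.2.2.1 _ _ h4
    have := TmOk.box h1 (by simpa using h2) h5 h6
    rw [Ctx.erase_subst] at this
    rw [Tm.subst, Ty.subst]
    exact ⟨a' + b' + 1, fun h => by have := ha h; have := hb h; omega, this⟩
  | @letbox a b c _ Φ n S T e₁ e₂ h1 h2 h3 h4 =>
    obtain ⟨a', ha, h5⟩ := (ih a (by omega) _ _ _ hL hL' hE).2.2.2.1 _ _ h2
    obtain ⟨b', hb, h6⟩ := (ih b (by omega) _ _ _ hL hL' hE).1 _ h3
    have hl := hℓ _ _ _ _ hL hL' (h3.sc hL) hE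
    obtain ⟨c', hc, h7⟩ := (ih c (by omega) _ _ _ (hL.cons (h3.sc hL)) (hL'.cons (h6.sc hL'))
      hl).2.2.2.1 _ _ h4
    -- Here too the type of the body is a weakening, so `u` does not escape into the type of the
    -- whole term.
    have hT := Ty.Sc.of_wk (LCtx.sh_cons L _ ▸ (h4.sc (hL.cons (h3.sc hL))).2)
    rw [Decl.subst] at h6 h7
    simp only [Decl.sort, Decl.level] at h7
    rw [hT.subst_wk hE.reg hsc] at h7
    rw [Ty.subst] at h5
    have := TmOk.letbox h1 h5 h6 h7
    rw [Ctx.erase_subst] at this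
    rw [Tm.subst]
    exact ⟨a' + b' + c' + 2,
      fun h => by have := ha h; have := hb h; have := hc h; omega, this⟩

end Step

theorem substOk_of_liftClosed {ℓ : ℕ} (hℓ : LiftClosed ℓ) (IH : ∀ n < ℓ, ∀ k, SubstOk n k)
    (k : ℕ) : SubstOk ℓ k := by
  induction k using Nat.strong_induction_on with
  | _ k ih =>
    intro L L' E hL hL' hE
    exact ⟨fun _ h => h.subst_step hℓ ih hL hL' hE, fun _ h => h.subst_step hℓ ih hL hL' hE,
      fun _ h => h.subst_step hℓ ih hL hL' hE IH, fun _ _ h => h.subst_step hℓ ih hL hL' hE IH,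
      fun _ _ h => h.subst_step hℓ ih hL hL' hE⟩

-- From renamings to substitutions of arbitrary level

theorem TImg.var_of_zero {L : LCtx} {a : Img} {D : Decl} (h : TImg 0 L a D) : ∃ j, a = .var j := by
  cases a with
  | var j => exact ⟨j, rfl⟩
  | ty Φ T => obtain ⟨_, _, _, _, _, h, _⟩ := h; omega
  | tm Φ e => obtain ⟨_, _, _, _, _, _, h, _⟩ := h; omega

/-- For the extension under a binder it is enough to weaken images. -/
theorem TEnv.lift_of {ℓ : ℕ} {L L' : LCtx} {E : Env} {D : Decl} (hL : L.Wf) (hL' : L'.Wf)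
    (hE : TEnv ℓ L E L')
    (hw : ∀ a D', D'.Sc L'.sh → TImg ℓ L' a D' →
      TImg ℓ (L'.cons (D.subst ℓ E)) (a.ren D'.sort D'.level (Ren.wk D.sort D.level))
        (D'.ren (Ren.wk D.sort D.level))) (hD : D.Sc L.sh) :
    TEnv ℓ (L.cons D) (E.lift D.sort D.level) (L'.cons (D.subst ℓ E)) := by
  have hsc := hE.sc hL hL'
  refine ⟨hE.reg.lift _ _, fun s k i D' hi => ?_⟩
  obtain ⟨rfl, rfl, rfl⟩ | ⟨j, rfl⟩ := Ren.wk_cases D.sort D.level s k i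
  · simp only [LCtx.cons_zero, Option.some.injEq] at hi
    subst hi
    rw [Decl.weakenBy, hD.subst_wk hE.reg hsc, Env.lift_zero]
    have := LCtx.cons_zero L' (D.subst ℓ E)
    simp only [Decl.weakenBy, Decl.sort_subst, Decl.level_subst] at this
    simpa [TImg] using this
  · simp only [LCtx.cons_wk, Option.map_eq_some_iff] at hi
    obtain ⟨D₀, h0, rfl⟩ := hi
    obtain ⟨rfl, rfl, h1⟩ := hL _ _ _ _ h0
    rw [Decl.weakenBy, h1.subst_wk hE.reg hsc, Env.lift_wk]
    simpa using hw _ _ (h1.subst hE.reg hsc) (hE.typ _ _ _ _ h0)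

theorem TImg.wk_var {ℓ : ℕ} {L : LCtx} {j : ℕ} {D D' : Decl} (h : TImg ℓ L (.var j) D') :
    TImg ℓ (L.cons D) ((Img.var j).ren D'.sort D'.level (Ren.wk D.sort D.level))
      (D'.ren (Ren.wk D.sort D.level)) := by
  have h : L D'.sort D'.level j = some D' := h
  simp [Img.ren, TImg, h, Decl.weakenBy]

/-- At level `0` every image is a variable, and weakening a variable requires no transformation of
derivations. This is the starting point that makes renaming available before substitution under
binders. -/
theorem liftClosed_zero : LiftClosed 0 := by
  intro L L' E D hL hL' hD hE
  refine hE.lift_of hL hL' (fun a D' _ ha => ?_) hD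
  obtain ⟨j, rfl⟩ := ha.var_of_zero
  simpa using ha.wk_var (D := D.subst 0 E)

theorem substOk_zero (k : ℕ) : SubstOk 0 k :=
  substOk_of_liftClosed liftClosed_zero (fun n hn => by omega) k

/-- The renaming `ρ` from `L` to `L'` respects the declarations. -/
def Ren.Ok (ρ : Ren) (L L' : LCtx) : Prop :=
  ∀ s n i D, L s n i = some D → L' s n (ρ s n i) = some (D.ren ρ)

theorem Ren.Ok.tenv {ρ : Ren} {L L' : LCtx} (h : ρ.Ok L L') (hL : L.Wf) : TEnv 0 L ρ.env L' := by
  refine ⟨Ren.env_reg _ _, fun s n i D hD => ?_⟩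
  obtain ⟨rfl, rfl, -⟩ := hL _ _ _ _ hD
  rw [Decl.subst_env]
  simpa [Ren.env, TImg] using h _ _ _ _ hD

theorem Ren.wk_ok (L : LCtx) (D : Decl) : (Ren.wk D.sort D.level).Ok L (L.cons D) := by
  intro s n i D' h
  simp [h, Decl.weakenBy]

section Rename

variable {k : ℕ} {L L' : LCtx} {ρ : Ren}

theorem DeclOk.ren {D : Decl} (h : DeclOk k L D) (hρ : ρ.Ok L L') (hL : L.Wf) (hL' : L'.Wf) :
    ∃ k' ≤ k, DeclOk k' L' (D.ren ρ) := by
  obtain ⟨k', h1, h2⟩ := (substOk_zero k _ _ _ hL hL' (hρ.tenv hL)).1 _ h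
  exact ⟨k', h1 rfl, by rwa [Decl.subst_env] at h2⟩

theorem ExtOk.ren {Ψ : Ctx} (h : ExtOk k L Ψ) (hρ : ρ.Ok L L') (hL : L.Wf) (hL' : L'.Wf) :
    ∃ k' ≤ k, ExtOk k' L' (Ψ.ren ρ) := by
  obtain ⟨k', h1, h2⟩ := (substOk_zero k _ _ _ hL hL' (hρ.tenv hL)).2.1 _ h
  exact ⟨k', h1 rfl, by rwa [Ctx.subst_env] at h2⟩

theorem TyOk.ren {T : Ty} (h : TyOk k L T) (hρ : ρ.Ok L L') (hL : L.Wf) (hL' : L'.Wf) :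
    ∃ k' ≤ k, TyOk k' L' (T.ren ρ) := by
  obtain ⟨k', h1, h2⟩ := (substOk_zero k _ _ _ hL hL' (hρ.tenv hL)).2.2.1 _ h
  exact ⟨k', h1 rfl, by rwa [Ty.subst_env] at h2⟩

theorem TmOk.ren {e : Tm} {T : Ty} (h : TmOk k L e T) (hρ : ρ.Ok L L') (hL : L.Wf)
    (hL' : L'.Wf) : ∃ k' ≤ k, TmOk k' L' (e.ren ρ) (T.ren ρ) := by
  obtain ⟨k', h1, h2⟩ := (substOk_zero k _ _ _ hL hL' (hρ.tenv hL)).2.2.2.1 _ _ h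
  exact ⟨k', h1 rfl, by rwa [Ty.subst_env, Tm.subst_env] at h2⟩

theorem SubOk.ren {σ : Subst} {Ψ : Ctx} (h : SubOk k L σ Ψ) (hρ : ρ.Ok L L') (hL : L.Wf)
    (hL' : L'.Wf) : ∃ k' ≤ k, SubOk k' L' (σ.ren ρ) (Ψ.ren ρ) := by
  obtain ⟨k', h1, h2⟩ := (substOk_zero k _ _ _ hL hL' (hρ.tenv hL)).2.2.2.2 _ _ h
  exact ⟨k', h1 rfl, by rwa [Ctx.subst_env, Subst.subst_env] at h2⟩

end Rename

theorem Ren.Ok.enter {ρ : Ren} {L L' : LCtx} (h : ρ.Ok L L') (hL : L.Wf) (n : ℕ) :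
    (ρ.enter n).Ok (L.enter n) (L'.enter n) := by
  intro s k i D hD
  by_cases hk : k < n
  · simp [LCtx.enter, hk] at hD
  · simp only [LCtx.enter, hk, if_false] at hD ⊢
    have hl : n ≤ D.level := by have := (hL _ _ _ _ hD).2.1; omega
    have : D.ren (ρ.enter n) = D.ren ρ := by
      rw [← Decl.subst_env 0, ← Ren.env_enter, Decl.subst_enter hl, Decl.subst_env]
    rw [this, ← h _ _ _ _ hD]
    simp [Ren.enter, hk]

theorem Ren.Ok.loc {ρ : Ren} {L L' : LCtx} (h : ρ.Ok L L') (hL : L.Wf) (hL' : L'.Wf) {n : ℕ}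
    {Ψ : Ctx} (hn : Ψ.erase.LevelLE n) (hΨ : Ψ.Sc (L.enter n).sh) :
    (ρ.enter n).Ok ((L.enter n).conss Ψ) ((L'.enter n).conss (Ψ.ren (ρ.enter n))) := by
  have := (h.tenv hL).loc liftClosed_zero hL hL' hn hΨ
  rw [Ren.env_enter, Ctx.subst_env] at this
  intro s k i D hD
  obtain ⟨rfl, rfl, -⟩ := (hL.enter n).conss hΨ _ _ _ _ hD
  simpa [TImg, Ren.env, Decl.subst_env] using this.typ _ _ _ _ hD

/-- A contextual object carries a derivation over the chopped context extended by its local context.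
The renaming lemma transports it, with the renaming chopped at the same level. -/
theorem TImg.wk {ℓ : ℕ} {L : LCtx} (hL : L.Wf) {D D' : Decl} (hD : D.Sc L.sh) (hD' : D'.Sc L.sh)
    {a : Img} (h : TImg ℓ L a D') :
    TImg ℓ (L.cons D) (a.ren D'.sort D'.level (Ren.wk D.sort D.level))
      (D'.ren (Ren.wk D.sort D.level)) := by
  have hL' := hL.cons hD
  have hρ := Ren.wk_ok L D
  cases a with
  | var j => exact h.wk_var
  | ty Φ T =>
    obtain ⟨Ψ, n, a, b, rfl, hn, rfl, h1, h2⟩ := h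
    obtain ⟨a', -, h3⟩ := h1.ren (hρ.enter hL n) (hL.enter n) (hL'.enter n)
    obtain ⟨b', -, h4⟩ := h2.ren (hρ.loc hL hL' hD' (h1.sc (hL.enter n))) (h1.wf_loc hL)
      (h3.wf_loc hL')
    rw [← Ctx.subst_env 0, KCtx.subst_toCtx] at h3 h4
    exact ⟨Ψ, n, a', b', rfl, hn, rfl, h3, h4⟩
  | tm Φ e =>
    obtain ⟨Ψ, n, S, a, b, rfl, hn, rfl, h1, h2⟩ := h
    obtain ⟨a', -, h3⟩ := h1.ren (hρ.enter hL n) (hL.enter n) (hL'.enter n)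
    obtain ⟨b', -, h4⟩ := h2.ren (hρ.loc hL hL' hD'.1 (h1.sc (hL.enter n))) (h1.wf_loc hL)
      (h3.wf_loc hL')
    exact ⟨_, n, _, a', b', rfl, hn, by simp, h3, h4⟩

theorem liftClosed (ℓ : ℕ) : LiftClosed ℓ := fun _ _ _ _ hL hL' hD hE =>
  hE.lift_of hL hL'
    (fun _ _ hD' ha => by simpa using ha.wk hL' (hD.subst hE.reg (hE.sc hL hL')) hD') hD

/-- With renaming established, extension under binders holds at every level, and what remains is the
induction on the level for hereditary steps. -/
theorem substOk (ℓ k : ℕ) : SubstOk ℓ k := by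
  induction ℓ using Nat.strong_induction_on generalizing k with
  | _ ℓ IH => exact substOk_of_liftClosed (liftClosed ℓ) (fun n hn k => IH n hn k) k

/-! ## Contexts and their lookup functions -/

def LCtx.empty : LCtx := fun _ _ _ => none

theorem LCtx.empty_wf : LCtx.empty.Wf := by
  intro s n i D h; simp [LCtx.empty] at h

theorem Ctx.lookup_snoc (Γ : Ctx) (D : Decl) : (Ctx.snoc Γ D).lookup = LCtx.cons Γ.lookup D := by
  funext s n i
  simp only [Ctx.lookup, LCtx.cons, vcons]

theorem Ctx.lookup_nil : Ctx.nil.lookup = LCtx.empty := by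
  funext s n i; rfl

theorem Ctx.lookup_eq : ∀ Γ : Ctx, Γ.lookup = LCtx.empty.conss Γ
  | .nil => Ctx.lookup_nil
  | .snoc Γ D => by rw [Ctx.lookup_snoc, Ctx.lookup_eq Γ]; rfl

theorem Ctx.append_snoc (Γ Δ : Ctx) (D : Decl) : Γ ++ Ctx.snoc Δ D = .snoc (Γ ++ Δ) D := rfl

theorem LCtx.conss_append (L : LCtx) (Γ : Ctx) : ∀ Δ : Ctx, L.conss (Γ ++ Δ) = (L.conss Γ).conss Δ
  | .nil => rfl
  | .snoc Δ D => by
    rw [Ctx.append_snoc, LCtx.conss, LCtx.conss_append L Γ Δ]; rfl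

theorem Ctx.lookup_append (Γ Δ : Ctx) : (Γ ++ Δ).lookup = LCtx.conss Γ.lookup Δ := by
  rw [Ctx.lookup_eq, LCtx.conss_append, ← Ctx.lookup_eq]

theorem Ctx.erase_append (Γ : Ctx) : ∀ Δ : Ctx, (Γ ++ Δ).erase = Δ.erase ++ Γ.erase
  | .nil => rfl
  | .snoc Δ D => by
    rw [Ctx.append_snoc, Ctx.erase, Ctx.erase_append Γ Δ]; rfl

theorem Ctx.of_lookup {Γ : Ctx} {s : VarSort} {n i : ℕ} {D : Decl}
    (h : Γ.lookup s n i = some D) : D.level = n ∧ (s, n) ∈ Γ.erase := by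
  cases Γ with
  | nil => simp [Ctx.lookup] at h
  | snoc Γ D' =>
    rw [Ctx.lookup_snoc] at h
    obtain ⟨rfl, rfl, rfl⟩ | ⟨j, rfl⟩ := Ren.wk_cases D'.sort D'.level s n i
    · simp only [LCtx.cons_zero, Option.some.injEq] at h
      subst h
      simp [Decl.weakenBy, Ctx.erase]
    · simp only [LCtx.cons_wk, Option.map_eq_some_iff] at h
      obtain ⟨D₀, h0, rfl⟩ := h
      have := Ctx.of_lookup h0
      simp [Decl.weakenBy, Ctx.erase, this]

/-- Weakening by `D` moves only variables of the level of `D`, and a declaration of higher level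
cannot mention these from its ambient context. -/
theorem Decl.weakenBy_of_lt {D D' : Decl} (h : D.level < D'.level) : D.weakenBy D' = D' := by
  have : ∀ n, D.level < n → (Ren.wk D.sort D.level).enter n = Ren.id := by
    intro n hn
    funext s k i
    by_cases hk : k < n
    · simp [Ren.enter, hk, Ren.id]
    · simp [Ren.enter, hk, Ren.id, Ren.wk, show k ≠ D.level by omega]
  cases D' with
  | ty Ψ n => rfl
  | tm Ψ n T => simp [Decl.weakenBy, Decl.ren, this n h, Ctx.ren_id, Ty.ren_id]

theorem Ctx.lookup_cons_enter (Γ : Ctx) {D : Decl} {n : ℕ} (h : D.level < n) :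
    LCtx.enter n (LCtx.cons Γ.lookup D) = LCtx.enter n Γ.lookup := by
  funext s k i
  by_cases hk : k < n
  · simp [LCtx.enter, hk]
  · simp only [LCtx.enter, hk, if_false]
    rw [LCtx.cons, vcons_of_ne (by omega)]
    cases hl : Γ.lookup s k i with
    | none => rfl
    | some D' =>
      rw [Option.map_some, Decl.weakenBy_of_lt]
      have := (Ctx.of_lookup hl).1
      omega

theorem Ctx.lookup_enter_of_le {Γ : Ctx} {n : ℕ} (h : ∀ p ∈ Γ.erase, n ≤ p.2) :
    LCtx.enter n Γ.lookup = Γ.lookup := by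
  funext s k i
  by_cases hk : k < n
  · simp only [LCtx.enter, hk, if_true]
    cases hl : Γ.lookup s k i with
    | none => rfl
    | some D => have := h _ (Ctx.of_lookup hl).2; simp only at this; omega
  · simp [LCtx.enter, hk]

theorem Ctx.le_of_mem_chop {Γ : Ctx} (hΓ : Γ.erase.Sorted) {n : ℕ} {p : VarSort × ℕ}
    (hp : p ∈ (Γ.chop n).erase) : n ≤ p.2 := by
  cases Γ with
  | nil => simp [Ctx.chop, Ctx.erase] at hp
  | snoc Γ D =>
    rw [Ctx.chop] at hp
    have hs := List.pairwise_cons.1 hΓ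
    split at hp
    · exact Ctx.le_of_mem_chop hs.2 hp
    · rcases List.mem_cons.1 hp with rfl | hp
      · exact Nat.le_of_not_lt ‹¬ D.level < n›
      · have : D.level ≤ p.2 := hs.1 _ hp; omega

/-- In a sorted context the declarations below `n` form a final segment, so stopping at the first
one of level at least `n` forgets exactly the low levels. -/
theorem Ctx.lookup_chop {Γ : Ctx} (hΓ : Γ.erase.Sorted) (n : ℕ) :
    (Γ.chop n).lookup = LCtx.enter n Γ.lookup := by
  cases Γ with
  | nil => funext s k i; simp [Ctx.chop, Ctx.lookup, LCtx.enter]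
  | snoc Γ D =>
    have hs := List.pairwise_cons.1 hΓ
    rw [Ctx.chop]
    split
    · rename_i h
      rw [Ctx.lookup_snoc, Ctx.lookup_cons_enter _ h, Ctx.lookup_chop hs.2]
    · rename_i h
      rw [Ctx.lookup_enter_of_le]
      intro p hp
      rcases List.mem_cons.1 hp with rfl | hp
      · exact Nat.le_of_not_lt h
      · have : D.level ≤ p.2 := hs.1 _ hp; omega

theorem Ren.wk_comm (s s' : VarSort) (n n' : ℕ) :
    (Ren.wk s n).comp (Ren.wk s' n') = (Ren.wk s' n').comp (Ren.wk s n) := by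
  funext t k i
  simp only [Ren.comp, Ren.wk]
  split <;> split <;> rfl

theorem Decl.weakenBy_comm (D D' D₀ : Decl) :
    D.weakenBy (D'.weakenBy D₀) = D'.weakenBy (D.weakenBy D₀) := by
  simp only [Decl.weakenBy, Decl.ren_ren, Ren.wk_comm]

/-- Declarations of different levels do not compete for indices. The higher one cannot mention the
lower one, which in turn only has to be weakened. -/
theorem LCtx.cons_comm (L : LCtx) {D D' : Decl} (h : D'.level < D.level) :
    (L.cons D).cons (D.weakenBy D') = (L.cons D').cons D := by
  have hs : (D.weakenBy D').sort = D'.sort := by simp [Decl.weakenBy]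
  have hl : (D.weakenBy D').level = D'.level := by simp [Decl.weakenBy]
  have hw : (D.weakenBy D').weakenBy = D'.weakenBy := by
    funext D₀; simp only [Decl.weakenBy, Decl.sort_ren, Decl.level_ren]
  funext s k i
  obtain ⟨rfl, rfl, rfl⟩ | ⟨j, rfl⟩ := Ren.wk_cases (D.weakenBy D').sort (D.weakenBy D').level s k i
  · rw [LCtx.cons_zero, hw, hs, hl, LCtx.cons, vcons_of_ne (by omega), LCtx.cons_zero,
      Option.map_some, Decl.weakenBy_comm]
  · rw [LCtx.cons_wk, hw, hs, hl]
    obtain ⟨rfl, rfl, rfl⟩ | ⟨j, rfl⟩ := Ren.wk_cases D.sort D.level s k j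
    · have : Ren.wk D'.sort D'.level D.sort D.level 0 = 0 := by
        simp [Ren.wk, show D.level ≠ D'.level by omega]
      rw [this, LCtx.cons_zero, LCtx.cons_zero, Option.map_some, Decl.weakenBy_of_lt]
      simpa [Decl.weakenBy] using h
    · have := congrFun (congrFun (congrFun (Ren.wk_comm D'.sort D.sort D'.level D.level) s) k) j
      simp only [Ren.comp] at this
      rw [LCtx.cons_wk, this, LCtx.cons_wk, LCtx.cons_wk, Option.map_map, Option.map_map]
      congr 1
      funext D₀
      exact Decl.weakenBy_comm _ _ _

/-- Moving a new declaration leftwards past lower levels is invisible to lookup. This justifies the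
use of lookup functions in place of sorted contexts. -/
theorem Ctx.lookup_insert (D : Decl) : ∀ Γ : Ctx, (Γ.insert D).lookup = LCtx.cons Γ.lookup D
  | .nil => by rw [Ctx.insert, Ctx.lookup_snoc]
  | .snoc Γ D' => by
    rw [Ctx.insert]
    split
    · rw [Ctx.lookup_snoc]
    · rw [Ctx.lookup_snoc, Ctx.lookup_insert D Γ, Ctx.lookup_snoc, LCtx.cons_comm _ (by omega)]

theorem Ctx.lookup_merge (Γ : Ctx) : ∀ Δ : Ctx, (Γ.merge Δ).lookup = LCtx.conss Γ.lookup Δ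
  | .nil => rfl
  | .snoc Δ D => by rw [Ctx.merge, Ctx.lookup_insert, Ctx.lookup_merge Γ Δ]; rfl

theorem Ctx.mem_erase_insert {D : Decl} {p : VarSort × ℕ} : ∀ {Γ : Ctx},
    p ∈ (Γ.insert D).erase → p = (D.sort, D.level) ∨ p ∈ Γ.erase
  | .nil, h => by simpa [Ctx.insert, Ctx.erase] using h
  | .snoc Γ D', h => by
    rw [Ctx.insert] at h
    split at h
    · exact List.mem_cons.1 h
    · simp only [Ctx.erase, Decl.weakenBy, Decl.sort_ren, Decl.level_ren, List.mem_cons] at h ⊢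
      rcases h with h | h
      · exact .inr (.inl h)
      · rcases Ctx.mem_erase_insert h with h | h
        · exact .inl h
        · exact .inr (.inr h)

/-! ## Operations on well-formed contexts -/

theorem ExtOk.sorted {L : LCtx} : ∀ {Γ : Ctx} {k : ℕ}, ExtOk k L Γ → Γ.erase.Sorted
  | .nil, _, _ => List.Pairwise.nil
  | .snoc Γ D, _, h => by
    cases h with
    | snoc h1 h2 h3 => exact List.pairwise_cons.2 ⟨h2, ExtOk.sorted h1⟩

theorem ExtOk.lookup_wf {k : ℕ} {Γ : Ctx} (h : ExtOk k .empty Γ) : LCtx.Wf Γ.lookup := by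
  rw [Ctx.lookup_eq]
  exact LCtx.empty_wf.conss (h.sc LCtx.empty_wf)

/-- The validity of a declaration depends only on the variables of at least its own level. Hence it
survives the removal of lower declarations when it is inserted further left. -/
theorem DeclOk.of_enter {k : ℕ} {L L' : LCtx} {D : Decl} (h : DeclOk k L D)
    (hL : L.enter D.level = L'.enter D.level) : DeclOk k L' D := by
  cases h with
  | tm h1 h2 h3 =>
    rw [Decl.level] at hL
    rw [hL] at h2 h3
    exact .tm h1 h2 h3
  | ty h1 h2 =>
    rw [Decl.level] at hL
    rw [hL] at h2
    exact .ty h1 h2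

theorem ExtOk.chop {L : LCtx} (n : ℕ) : ∀ {Γ : Ctx} {k : ℕ}, ExtOk k L Γ →
    ∃ k' ≤ k, ExtOk k' L (Γ.chop n)
  | .nil, k, h => ⟨k, le_rfl, h⟩
  | .snoc Γ D, k, h => by
    rw [Ctx.chop]
    split
    · cases h with
      | snoc h1 h2 h3 =>
        obtain ⟨k', h4, h5⟩ := ExtOk.chop n h1
        exact ⟨k', by omega, h5⟩
    · exact ⟨k, le_rfl, h⟩

theorem ExtOk.append {a : ℕ} {L : LCtx} {Γ : Ctx} (hΓ : ExtOk a L Γ) : ∀ {Δ : Ctx} {b : ℕ},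
    ExtOk b (L.conss Γ) Δ → ECtx.Above Γ.erase Δ.erase → ∃ k ≤ a + b, ExtOk k L (Γ ++ Δ)
  | .nil, b, _, _ => ⟨a, by omega, hΓ⟩
  | .snoc Δ D, b, h, ha => by
    cases h with
    | @snoc c d _ _ _ h1 h2 h3 =>
      obtain ⟨k, hk, h4⟩ := ExtOk.append hΓ h1 fun p hp q hq => ha p hp q (by simp [Ctx.erase, hq])
      rw [← LCtx.conss_append] at h3
      refine ⟨k + d + 1, by omega, .snoc h4 ?_ h3⟩
      intro p hp
      change p ∈ (Γ ++ Δ).erase at hp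
      rw [Ctx.erase_append, List.mem_append] at hp
      rcases hp with hp | hp
      · exact h2 p hp
      · exact ha p hp (D.sort, D.level) (by simp [Ctx.erase])

theorem ExtOk.of_append {L : LCtx} {Γ : Ctx} : ∀ {Δ : Ctx} {k : ℕ}, ExtOk k L (Γ ++ Δ) →
    (∃ a, ExtOk a L Γ) ∧ ∃ b, ExtOk b (L.conss Γ) Δ
  | .nil, k, h => ⟨⟨k, h⟩, 1, .nil⟩
  | .snoc Δ D, k, h => by
    rw [Ctx.append_snoc] at h
    cases h with
    | @snoc c d _ _ _ h1 h2 h3 =>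
      obtain ⟨h4, b, h5⟩ := ExtOk.of_append h1
      rw [LCtx.conss_append] at h3
      refine ⟨h4, _, .snoc h5 (fun p hp => h2 p ?_) h3⟩
      rw [Ctx.erase_append, List.mem_append]
      exact .inl hp

theorem ExtOk.chop_append {a b n : ℕ} {Γ Φ : Ctx} (hΓ : ExtOk a .empty Γ)
    (hn : Φ.erase.LevelLE n) (hΦ : ExtOk b (LCtx.enter n Γ.lookup) Φ) :
    ∃ k ≤ a + b, ExtOk k .empty (Γ.chop n ++ Φ) := by
  obtain ⟨a', h1, h2⟩ := hΓ.chop n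
  rw [← Ctx.lookup_chop hΓ.sorted, Ctx.lookup_eq] at hΦ
  obtain ⟨k, h3, h4⟩ := h2.append hΦ fun p hp q hq => by
    have := Ctx.le_of_mem_chop hΓ.sorted hp
    have := hn q hq
    omega
  exact ⟨k, by omega, h4⟩

theorem Ctx.lookup_chop_append {k : ℕ} {L : LCtx} {Γ : Ctx} (hΓ : ExtOk k L Γ) (n : ℕ) (Φ : Ctx) :
    (Γ.chop n ++ Φ).lookup = LCtx.conss (LCtx.enter n Γ.lookup) Φ := by
  rw [Ctx.lookup_append, Ctx.lookup_chop hΓ.sorted]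

theorem ExtOk.of_chop_append {k a n : ℕ} {Γ Φ : Ctx} (hΓ : ExtOk a .empty Γ)
    (h : ExtOk k .empty (Γ.chop n ++ Φ)) : ∃ b, ExtOk b (LCtx.enter n Γ.lookup) Φ := by
  obtain ⟨-, b, h1⟩ := h.of_append
  rw [← Ctx.lookup_eq, Ctx.lookup_chop hΓ.sorted] at h1
  exact ⟨b, h1⟩

/-- Each lower declaration that is passed is weakened by `D`. Since renaming does not increase
sizes, the cost of an insertion stays bounded by the size of the inserted declaration plus one. -/
theorem ExtOk.insert {b : ℕ} {D : Decl} : ∀ {Γ : Ctx} {a : ℕ}, ExtOk a .empty Γ →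
    DeclOk b Γ.lookup D → ∃ k ≤ a + b + 1, ExtOk k .empty (Γ.insert D)
  | .nil, a, h, hD => by
    rw [Ctx.lookup_eq] at hD
    exact ⟨a + b + 1, le_rfl, .snoc h (by simp [Ctx.erase]) hD⟩
  | .snoc Γ D', a, h, hD => by
    rw [Ctx.insert]
    split
    · rename_i hl
      refine ⟨a + b + 1, le_rfl, .snoc h ?_ (by rwa [Ctx.lookup_eq] at hD)⟩
      intro p hp
      have hs := List.pairwise_cons.1 h.sorted
      rcases List.mem_cons.1 hp with rfl | hp
      · exact hl
      · have : D'.level ≤ p.2 := hs.1 _ hp; omega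
    · rename_i hl
      cases h with
      | @snoc c d _ _ _ h1 h2 h3 =>
        rw [Ctx.lookup_snoc] at hD
        have hD' := hD.of_enter (Ctx.lookup_cons_enter Γ (by omega))
        obtain ⟨k, hk, h4⟩ := ExtOk.insert h1 hD'
        rw [← Ctx.lookup_eq] at h3
        have hw := h1.lookup_wf
        obtain ⟨d', hd, h5⟩ := h3.ren (Ren.wk_ok _ D) hw (hw.cons (hD'.sc hw))
        rw [← Ctx.lookup_insert] at h5
        refine ⟨k + d' + 1, by omega, .snoc h4 ?_ (by rwa [Ctx.lookup_eq] at h5)⟩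
        intro p hp
        rw [Decl.weakenBy, Decl.level_ren]
        rcases Ctx.mem_erase_insert hp with rfl | hp
        · exact Nat.le_of_not_le hl
        · exact h2 p hp

theorem ExtOk.of_insert {D : Decl} : ∀ {Γ : Ctx} {k : ℕ}, ExtOk k .empty (Γ.insert D) →
    ∃ b, DeclOk b Γ.lookup D
  | .nil, k, h => by
    cases h with
    | @snoc a b _ _ _ h1 h2 h3 => exact ⟨b, by rwa [Ctx.lookup_eq]⟩
  | .snoc Γ D', k, h => by
    rw [Ctx.insert] at h
    split at h
    · cases h with
      | @snoc a b _ _ _ h1 h2 h3 => exact ⟨b, by rwa [Ctx.lookup_eq]⟩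
    · cases h with
      | @snoc a b _ _ _ h1 h2 h3 =>
        obtain ⟨b, h4⟩ := ExtOk.of_insert h1
        rw [Ctx.lookup_snoc]
        exact ⟨b, h4.of_enter (Ctx.lookup_cons_enter Γ (by omega)).symm⟩

theorem ExtOk.merge {a : ℕ} {Γ : Ctx} (hΓ : ExtOk a .empty Γ) : ∀ {Δ : Ctx} {b : ℕ},
    ExtOk b Γ.lookup Δ → ∃ k ≤ a + b, ExtOk k .empty (Γ.merge Δ)
  | .nil, b, _ => ⟨a, by omega, hΓ⟩
  | .snoc Δ D, b, h => by
    cases h with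
    | @snoc c d _ _ _ h1 h2 h3 =>
      obtain ⟨k, hk, h4⟩ := ExtOk.merge hΓ h1
      rw [← Ctx.lookup_merge] at h3
      obtain ⟨k', hk', h5⟩ := h4.insert h3
      exact ⟨k', by omega, h5⟩

/-! ## The judgments imply their presupposition-free forms -/

mutual
theorem WfCtx.ok : ∀ {Γ : Ctx}, WfCtx Γ → ∃ k, ExtOk k .empty Γ
  | _, .nil => ⟨1, .nil⟩
  | _, @WfCtx.tm Γ Φ n T h1 h2 h3 h4 h5 => by
    obtain ⟨a, h6⟩ := h1.ok
    obtain ⟨⟨b, h7⟩, c, h8⟩ := h5.ok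
    obtain ⟨d, h9⟩ := h6.of_chop_append h7
    rw [Ctx.lookup_chop_append h6] at h8
    refine ⟨_, .snoc h6 h2 (.tm (a := d) (b := c) h3 ?_ ?_)⟩ <;> rwa [← Ctx.lookup_eq]
  | _, @WfCtx.ty Γ Φ n h1 h2 h3 h4 => by
    obtain ⟨a, h6⟩ := h1.ok
    obtain ⟨b, h7⟩ := h4.ok
    obtain ⟨d, h9⟩ := h6.of_chop_append h7
    refine ⟨_, .snoc h6 h2 (.ty (a := d) h3 ?_)⟩
    rwa [← Ctx.lookup_eq]
-- The well-formedness of the context is returned as well, because validity of a bound declaration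
-- or of a local context is recovered from the contexts of the premises.
theorem WfTy.ok : ∀ {Γ : Ctx} {T : Ty}, WfTy Γ T →
    (∃ k, ExtOk k .empty Γ) ∧ ∃ k, TyOk k Γ.lookup T
  | _, _, .tvar h1 h2 h3 => by
    obtain ⟨h4, h5, k, h6⟩ := h3.ok
    exact ⟨h4, _, .tvar h2 h6⟩
  | _, _, .arr h1 h2 h3 => by
    obtain ⟨h4, a, h5⟩ := h2.ok
    obtain ⟨-, b, h6⟩ := h3.ok
    exact ⟨h4, _, .arr h5 h6⟩
  | _, _, .all h1 h2 h3 => by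
    obtain ⟨⟨a, h4⟩, b, h5⟩ := h3.ok
    obtain ⟨c, h6⟩ := h4.of_insert
    rw [Ctx.lookup_insert] at h5
    exact ⟨h1.ok, _, .all h6 h5⟩
  | _, _, .box h1 h2 h3 h4 h5 => by
    obtain ⟨⟨a, h6⟩, b, h7⟩ := h5.ok
    obtain ⟨c, h8⟩ := h1.ok
    obtain ⟨d, h9⟩ := h8.of_chop_append h6
    rw [Ctx.lookup_chop_append h8] at h7
    exact ⟨⟨c, h8⟩, _, .box h2 (.tm h3 h9 h7)⟩
theorem WfTm.ok : ∀ {Γ : Ctx} {e : Tm} {T : Ty}, WfTm Γ e T →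
    (∃ k, ExtOk k .empty Γ) ∧ ∃ k, TmOk k Γ.lookup e T
  | _, _, _, .var h1 h2 h3 => by
    obtain ⟨h4, h5, k, h6⟩ := h3.ok
    exact ⟨h4, _, .var h2 h6⟩
  | _, _, _, .lam h1 h2 => by
    obtain ⟨⟨a, h3⟩, b, h4⟩ := h2.ok
    cases h3 with
    | snoc h5 h6 h7 =>
      rw [Ctx.lookup_snoc] at h4
      rw [← Ctx.lookup_eq] at h7
      exact ⟨⟨_, h5⟩, _, .lam h7 h4⟩
  | _, _, _, .app h1 h2 h3 => by
    obtain ⟨h4, a, h5⟩ := h2.ok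
    obtain ⟨-, b, h6⟩ := h3.ok
    exact ⟨h4, _, .app h5 h6⟩
  | _, _, _, .tlam h1 h2 => by
    obtain ⟨⟨a, h3⟩, b, h4⟩ := h2.ok
    obtain ⟨c, h5⟩ := h3.of_insert
    rw [Ctx.lookup_insert] at h4
    exact ⟨h1.ok, _, .tlam h5 h4⟩
  | _, _, _, .tapp h1 h2 h3 => by
    obtain ⟨⟨a, h4⟩, b, h5⟩ := h2.ok
    obtain ⟨⟨c, h6⟩, d, h7⟩ := h3.ok
    obtain ⟨f, h8⟩ := h4.of_chop_append h6
    rw [Ctx.lookup_chop_append h4] at h7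
    -- The level bound on the local context is not a premise of this rule; it comes from the scoping
    -- of the quantified type of the function.
    exact ⟨⟨a, h4⟩, _, .tapp h5 (.ty (h5.sc h4.lookup_wf).2.1 h8) h7⟩
  | _, _, _, .box h1 h2 h3 h4 => by
    obtain ⟨⟨a, h6⟩, b, h7⟩ := h4.ok
    obtain ⟨c, h8⟩ := h1.ok
    obtain ⟨d, h9⟩ := h8.of_chop_append h6
    rw [Ctx.lookup_chop_append h8] at h7
    exact ⟨⟨c, h8⟩, _, .box h2 h3 h9 h7⟩
  | _, _, _, .letbox h1 h2 h3 h4 => by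
    obtain ⟨h5, a, h6⟩ := h3.ok
    obtain ⟨⟨b, h7⟩, c, h8⟩ := h4.ok
    obtain ⟨d, h9⟩ := h7.of_insert
    rw [Ctx.lookup_insert] at h8
    exact ⟨h5, _, .letbox h2 h6 h9 h8⟩
theorem WfSubst.ok : ∀ {Γ : Ctx} {σ : Subst} {Ψ : Ctx}, WfSubst Γ σ Ψ →
    (∃ k, ExtOk k .empty Γ) ∧ (∃ k, ExtOk k Γ.lookup Ψ) ∧ ∃ k, SubOk k Γ.lookup σ Ψ
  | _, _, _, .nil h => ⟨h.ok, ⟨1, .nil⟩, 1, .nil⟩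
  | _, _, _, .tm h1 h2 h3 h4 => by
    obtain ⟨⟨a, h5⟩, ⟨b, h6⟩, c, h7⟩ := h3.ok
    obtain ⟨⟨d, h8⟩, f, h9⟩ := h4.ok
    obtain ⟨g, h10⟩ := h2.ok
    obtain ⟨i, h11⟩ := ExtOk.of_insert h10
    obtain ⟨j, h12⟩ := h5.of_chop_append h8
    rw [Ctx.lookup_merge] at h11
    rw [Ctx.lookup_chop_append h5] at h9
    have h13 := ExtOk.snoc h6 (List.pairwise_cons.1 h1).1 h11
    exact ⟨⟨a, h5⟩, ⟨_, h13⟩, _, .tm h13 h7 h12 h9⟩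
  | _, _, _, .tmVar h1 h2 h3 h4 => by
    obtain ⟨⟨a, h5⟩, ⟨b, h6⟩, c, h7⟩ := h3.ok
    obtain ⟨g, h10⟩ := h2.ok
    obtain ⟨i, h11⟩ := ExtOk.of_insert h10
    rw [Ctx.lookup_merge] at h11
    have h13 := ExtOk.snoc h6 (List.pairwise_cons.1 h1).1 h11
    exact ⟨⟨a, h5⟩, ⟨_, h13⟩, _, .tmVar h13 h7 h4⟩
  | _, _, _, .ty h1 h2 h3 h4 => by
    obtain ⟨⟨a, h5⟩, ⟨b, h6⟩, c, h7⟩ := h3.ok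
    obtain ⟨⟨d, h8⟩, f, h9⟩ := h4.ok
    obtain ⟨g, h10⟩ := h2.ok
    obtain ⟨i, h11⟩ := ExtOk.of_insert h10
    obtain ⟨j, h12⟩ := h5.of_chop_append h8
    rw [Ctx.lookup_merge] at h11
    rw [Ctx.lookup_chop_append h5] at h9
    have h13 := ExtOk.snoc h6 (List.pairwise_cons.1 h1).1 h11
    exact ⟨⟨a, h5⟩, ⟨_, h13⟩, _, .ty h13 h7 h12 h9⟩
  | _, _, _, .tyVar h1 h2 h3 h4 => by
    obtain ⟨⟨a, h5⟩, ⟨b, h6⟩, c, h7⟩ := h3.ok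
    obtain ⟨g, h10⟩ := h2.ok
    obtain ⟨i, h11⟩ := ExtOk.of_insert h10
    rw [Ctx.lookup_merge] at h11
    have h13 := ExtOk.snoc h6 (List.pairwise_cons.1 h1).1 h11
    exact ⟨⟨a, h5⟩, ⟨_, h13⟩, _, .tyVar h13 h7 h4⟩
end

/-! ## The presupposition-free judgments imply the judgments -/

theorem Ctx.erase_simSubstLocal (n : ℕ) (σ : Subst) (Ψ : ECtx) (Φ : Ctx) :
    (Φ.simSubstLocal n σ Ψ).erase = Φ.erase := by
  simp [Ctx.simSubstLocal]

theorem ExtOk.snoc_lookup {a b : ℕ} {Γ : Ctx} {D : Decl} (hΓ : ExtOk a .empty Γ)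
    (h : ∀ p ∈ Γ.erase, D.level ≤ p.2) (hD : DeclOk b Γ.lookup D) :
    ExtOk (a + b + 1) .empty (.snoc Γ D) :=
  .snoc hΓ h (by rwa [← Ctx.lookup_eq])

theorem DeclOk.levelLE {k : ℕ} {L : LCtx} {Φ : Ctx} {n : ℕ} {T : Ty}
    (h : DeclOk k L (.tm Φ n T)) : Φ.erase.LevelLE n := by
  cases h with
  | tm h _ _ => exact h

theorem DeclOk.levelLE_ty {k : ℕ} {L : LCtx} {Φ : KCtx} {n : ℕ}
    (h : DeclOk k L (.ty Φ n)) : Φ.toCtx.erase.LevelLE n := by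
  cases h with
  | ty h _ => exact h

/-- The presuppositions put back at each node are about contexts that grow towards the leaves. What
decreases is the sum of the sizes of the context and of the derivation: a declaration that enters
the context brings a size already counted in the derivation. -/
theorem ExtOk.wf_aux (N : ℕ) : ∀ (Γ : Ctx) (a : ℕ), ExtOk a .empty Γ →
    (a < N → WfCtx Γ) ∧
    (∀ T k, TyOk k Γ.lookup T → a + k < N → WfTy Γ T) ∧
    (∀ e T k, TmOk k Γ.lookup e T → a + k < N → WfTm Γ e T) ∧
    (∀ σ Ψ k, SubOk k Γ.lookup σ Ψ → a + k < N → WfSubst Γ σ Ψ) := by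
  induction N with
  | zero => intro Γ a _; simp
  | succ N ih =>
  intro Γ a hΓ
  have hloc : ∀ {b n : ℕ} {Φ : Ctx}, Φ.erase.LevelLE n → ExtOk b (LCtx.enter n Γ.lookup) Φ →
      (a + b < N → WfCtx (Γ.chop n ++ Φ)) ∧
      (∀ T k, TyOk k (LCtx.conss (LCtx.enter n Γ.lookup) Φ) T → a + b + k < N →
        WfTy (Γ.chop n ++ Φ) T) ∧
      (∀ e T k, TmOk k (LCtx.conss (LCtx.enter n Γ.lookup) Φ) e T → a + b + k < N →
        WfTm (Γ.chop n ++ Φ) e T) := by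
    intro b n Φ hn hΦ
    obtain ⟨c, hc, h⟩ := hΓ.chop_append hn hΦ
    obtain ⟨h1, h2, h3, -⟩ := ih _ c h
    rw [Ctx.lookup_chop_append hΓ] at h2 h3
    exact ⟨fun hN => h1 (by omega), fun T k hT hN => h2 T k hT (by omega),
      fun e T k he hN => h3 e T k he (by omega)⟩
  have hins : ∀ {b : ℕ} {D : Decl}, DeclOk b Γ.lookup D →
      (∀ T k, TyOk k (LCtx.cons Γ.lookup D) T → a + b + 1 + k < N → WfTy (Γ.insert D) T) ∧
      (∀ e T k, TmOk k (LCtx.cons Γ.lookup D) e T → a + b + 1 + k < N →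
        WfTm (Γ.insert D) e T) := by
    intro b D hD
    obtain ⟨c, hc, h⟩ := hΓ.insert hD
    obtain ⟨-, h2, h3, -⟩ := ih _ c h
    rw [Ctx.lookup_insert] at h2 h3
    exact ⟨fun T k hT hN => h2 T k hT (by omega), fun e T k he hN => h3 e T k he (by omega)⟩
  have hmerge : ∀ {b : ℕ} {Δ : Ctx}, ExtOk b Γ.lookup Δ → a + b < N → WfCtx (Γ.merge Δ) := by
    intro b Δ hΔ hN
    obtain ⟨c, hc, h⟩ := hΓ.merge hΔ
    exact (ih _ c h).1 (by omega)
  -- The same context with a smaller bound: every derivation has positive size, so this covers the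
  -- presupposition on `Γ` and the premises over it.
  obtain ⟨ih1, ih2, ih3, ih4⟩ := ih Γ a hΓ
  refine ⟨?_, ?_, ?_, ?_⟩
  · intro hN
    cases hΓ with
    | nil => exact .nil
    | @snoc b c _ Γ D h1 h2 h3 =>
      rw [← Ctx.lookup_eq] at h3
      cases h3 with
      | @tm d f _ Φ n T h3 h4 h5 =>
        obtain ⟨g, hg, h⟩ := h1.chop_append h3 h4
        rw [← Ctx.lookup_chop_append h1] at h5
        exact .tm ((ih _ _ h1).1 (by omega)) h2 h3 ((ih _ _ h).1 (by omega))
          ((ih _ _ h).2.1 _ _ h5 (by omega))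
      | @ty d _ Φ n h3 h4 =>
        obtain ⟨g, hg, h⟩ := h1.chop_append h3 h4
        exact .ty ((ih _ _ h1).1 (by omega)) h2 h3 ((ih _ _ h).1 (by omega))
  · intro T k hT hN
    cases hT with
    | tvar h1 h2 => exact .tvar (ih1 (by omega)) h1 (ih4 _ _ _ h2 (by omega))
    | arr h1 h2 =>
      exact .arr (ih1 (by omega)) (ih2 _ _ h1 (by omega)) (ih2 _ _ h2 (by omega))
    | all h1 h2 =>
      have h3 := (hins h1).1 _ _ h2 (by omega)
      cases h1 with
      | ty h4 h5 => exact .all (ih1 (by omega)) ((hloc h4 h5).1 (by omega)) h3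
    | box h1 h2 =>
      cases h2 with
      | tm h4 h5 h6 =>
        exact .box (ih1 (by omega)) h1 h4 ((hloc h4 h5).1 (by omega))
          ((hloc h4 h5).2.1 _ _ h6 (by omega))
  · intro e T k he hN
    cases he with
    | var h1 h2 => exact .var (ih1 (by omega)) h1 (ih4 _ _ _ h2 (by omega))
    | lam h1 h2 =>
      rw [← Ctx.lookup_snoc] at h2
      exact .lam (ih1 (by omega)) ((ih _ _ (hΓ.snoc_lookup (fun p _ => Nat.zero_le _) h1)).2.2.1
        _ _ _ h2 (by omega))
    | app h1 h2 =>
      exact .app (ih1 (by omega)) (ih3 _ _ _ h1 (by omega)) (ih3 _ _ _ h2 (by omega))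
    | tlam h1 h2 => exact .tlam (ih1 (by omega)) ((hins h1).2 _ _ _ h2 (by omega))
    | tapp h1 h2 h3 =>
      cases h2 with
      | ty h4 h5 =>
        exact .tapp (ih1 (by omega)) (ih3 _ _ _ h1 (by omega))
          ((hloc h4 h5).2.1 _ _ h3 (by omega))
    | box h1 h2 h3 h4 =>
      exact .box (ih1 (by omega)) h1 h2 ((hloc h2 h3).2.2 _ _ _ h4 (by omega))
    | letbox h1 h2 h3 h4 =>
      exact .letbox (ih1 (by omega)) h1 (ih3 _ _ _ h2 (by omega))
        ((hins h3).2 _ _ _ h4 (by omega))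
  · intro σ Ψ k hσ hN
    cases hσ with
    | nil => exact .nil (ih1 (by omega))
    | @tm _ _ _ _ _ Δ Ψ n T σ e h1 h2 h3 h4 =>
      have h5 : Ψ.erase.LevelLE n := by
        cases h1 with
        | snoc _ _ h => exact h.levelLE
      exact .tm h1.sorted (hmerge h1 (by omega)) (ih4 _ _ _ h2 (by omega))
        ((hloc (by rwa [Ctx.erase_simSubstLocal]) h3).2.2 _ _ _ h4 (by omega))
    | tmVar h1 h2 h3 =>
      exact .tmVar h1.sorted (hmerge h1 (by omega)) (ih4 _ _ _ h2 (by omega)) h3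
    | @ty _ _ _ _ _ Δ Ψ n σ T h1 h2 h3 h4 =>
      have h5 : Ψ.toCtx.erase.LevelLE n := by
        cases h1 with
        | snoc _ _ h => exact h.levelLE_ty
      exact .ty h1.sorted (hmerge h1 (by omega)) (ih4 _ _ _ h2 (by omega))
        ((hloc h5 h3).2.1 _ _ h4 (by omega))
    | tyVar h1 h2 h3 =>
      exact .tyVar h1.sorted (hmerge h1 (by omega)) (ih4 _ _ _ h2 (by omega)) h3

theorem ExtOk.wf {a : ℕ} {Γ : Ctx} (h : ExtOk a .empty Γ) : WfCtx Γ :=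
  (ExtOk.wf_aux (a + 1) Γ a h).1 (by omega)

theorem TyOk.wf {a k : ℕ} {Γ : Ctx} {T : Ty} (hΓ : ExtOk a .empty Γ) (h : TyOk k Γ.lookup T) :
    WfTy Γ T :=
  (ExtOk.wf_aux (a + k + 1) Γ a hΓ).2.1 T k h (by omega)

theorem TmOk.wf {a k : ℕ} {Γ : Ctx} {e : Tm} {T : Ty} (hΓ : ExtOk a .empty Γ)
    (h : TmOk k Γ.lookup e T) : WfTm Γ e T :=
  (ExtOk.wf_aux (a + k + 1) Γ a hΓ).2.2.1 e T k h (by omega)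

theorem SubOk.wf {a k : ℕ} {Γ : Ctx} {σ : Subst} {Ψ : Ctx} (hΓ : ExtOk a .empty Γ)
    (h : SubOk k Γ.lookup σ Ψ) : WfSubst Γ σ Ψ :=
  (ExtOk.wf_aux (a + k + 1) Γ a hΓ).2.2.2 σ Ψ k h (by omega)

/-! ## Weakening by a context, and the simultaneous substitution lemma -/

theorem Ren.wks_cons (s : VarSort) (n : ℕ) (Φ : ECtx) :
    Ren.wks ((s, n) :: Φ) = (Ren.wk s n).comp (Ren.wks Φ) := by
  funext s' k i
  simp only [Ren.wks, Ren.comp, Ren.wk, List.count_cons, beq_iff_eq, Prod.mk.injEq]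
  by_cases h : s' = s ∧ k = n
  · obtain ⟨rfl, rfl⟩ := h
    simp [Nat.add_assoc]
  · rw [if_neg h, if_neg fun h' => h ⟨h'.1.symm, h'.2.symm⟩]
    rfl

theorem Ren.Ok.comp {ρ ρ' : Ren} {L L' L'' : LCtx} (h' : ρ'.Ok L' L'') (h : ρ.Ok L L') :
    (ρ'.comp ρ).Ok L L'' := by
  intro s n i D hD
  rw [← Decl.ren_ren]
  exact h' _ _ _ _ (h _ _ _ _ hD)

theorem Ren.wks_ok (L : LCtx) : ∀ Φ : Ctx, (Ren.wks Φ.erase).Ok L (L.conss Φ)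
  | .nil => by
    intro s n i D h
    simpa [Ctx.erase, LCtx.conss, Ren.id, Decl.ren_id] using h
  | .snoc Φ D => by
    rw [Ctx.erase, Ren.wks_cons]
    exact (Ren.wk_ok _ D).comp (Ren.wks_ok L Φ)

theorem Ren.Ok.lifts {ρ : Ren} {L L' : LCtx} (h : ρ.Ok L L') (hL : L.Wf) (hL' : L'.Wf)
    {Ψ : Ctx} (hΨ : Ψ.Sc L.sh) : (ρ.lifts Ψ.erase).Ok (L.conss Ψ) (L'.conss (Ψ.ren ρ)) := by
  have := (h.tenv hL).lifts liftClosed_zero hL hL' Ψ hΨ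
  rw [Ren.env_lifts, Ctx.subst_env] at this
  intro s k i D hD
  obtain ⟨rfl, rfl, -⟩ := hL.conss hΨ _ _ _ _ hD
  simpa [TImg, Ren.env, Decl.subst_env] using this.typ _ _ _ _ hD

/-- Variables of the block keep their entries, and variables outside it are moved past `Φ̂`. It
separates the change of the ambient context from the substitution proper. -/
theorem Subst.Sc.env_precomp {G : SCtx} {σ : Subst} {Δ : Sh} (h : σ.Sc G Δ) (Φ : ECtx) :
    (σ.env [] Δ.erase).precomp ((Ren.wks Φ).lifts Δ.erase) = σ.env Φ Δ.erase := by
  refine h.rec' (P := fun σ Δ =>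
    (σ.env [] Δ.erase).precomp ((Ren.wks Φ).lifts Δ.erase) = σ.env Φ Δ.erase) ?_ ?_
  · simp only [Sh.erase, Subst.env_nil, Ren.wks_nil]; rfl
  · intro σ Δ s n Ψ a _ _ ih
    rw [Sh.erase, Subst.env_snoc, Subst.env_snoc, ← ih]
    refine vext s n ?_ fun s' k i => ?_ <;>
      simp [Env.precomp, Ren.lifts, Env.cons_eq]

/-- Substitution after renaming, for all judgments. -/
theorem Ren.Ok.subst {ρ : Ren} {L M L' : LCtx} {ℓ : ℕ} {E : Env} (hρ : ρ.Ok L M)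
    (hE : TEnv ℓ M E L') (hL : L.Wf) (hM : M.Wf) (hL' : L'.Wf) :
    (∀ Ψ k, ExtOk k L Ψ → ∃ k', ExtOk k' L' (Ψ.subst ℓ (E.precomp ρ))) ∧
    (∀ T k, TyOk k L T → ∃ k', TyOk k' L' (T.subst ℓ (E.precomp ρ))) ∧
    (∀ e T k, TmOk k L e T →
      ∃ k', TmOk k' L' (e.subst ℓ (E.precomp ρ)) (T.subst ℓ (E.precomp ρ))) ∧
    (∀ σ Ψ k, SubOk k L σ Ψ →
      ∃ k', SubOk k' L' (σ.subst ℓ (E.precomp ρ)) (Ψ.subst ℓ (E.precomp ρ))) := by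
  refine ⟨fun Ψ k h => ?_, fun T k h => ?_, fun e T k h => ?_, fun σ Ψ k h => ?_⟩ <;>
    obtain ⟨k', -, h⟩ := h.ren hρ hL hM
  · obtain ⟨k'', -, h⟩ := (substOk ℓ k' _ _ _ hM hL' hE).2.1 _ h
    rw [Ctx.subst_ren _ _ _ hE.reg] at h
    exact ⟨k'', h⟩
  · obtain ⟨k'', -, h⟩ := (substOk ℓ k' _ _ _ hM hL' hE).2.2.1 _ h
    rw [Ty.subst_ren _ _ _ hE.reg] at h
    exact ⟨k'', h⟩
  · obtain ⟨k'', -, h⟩ := (substOk ℓ k' _ _ _ hM hL' hE).2.2.2.1 _ _ h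
    rw [Tm.subst_ren _ _ _ hE.reg, Ty.subst_ren _ _ _ hE.reg] at h
    exact ⟨k'', h⟩
  · obtain ⟨k'', -, h⟩ := (substOk ℓ k' _ _ _ hM hL' hE).2.2.2.2 _ _ h
    rw [Subst.subst_ren _ _ _ hE.reg, Ctx.subst_ren _ _ _ hE.reg] at h
    exact ⟨k'', h⟩

/-- Simultaneous substitution for the block `Γ₀` of a context `Γ₁, Γ₀`. -/
theorem SubOk.simSubst {Γ₁ Φ Γ₀ : Ctx} {σ : Subst} {a b c d : ℕ}
    (hΦ : ExtOk a .empty (Γ₁ ++ Φ)) (hw : ExtOk b (Γ₁ ++ Φ).lookup (Γ₀.weaken Φ.erase))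
    (hσ : SubOk c (Γ₁ ++ Φ).lookup σ (Γ₀.weaken Φ.erase)) (hΓ : ExtOk d .empty (Γ₁ ++ Γ₀)) :
    (∀ Ψ k, ExtOk k (Γ₁ ++ Γ₀).lookup Ψ →
      ∃ k', ExtOk k' (Γ₁ ++ Φ).lookup (Ψ.simSubst Φ.erase σ Γ₀.erase)) ∧
    (∀ T k, TyOk k (Γ₁ ++ Γ₀).lookup T →
      ∃ k', TyOk k' (Γ₁ ++ Φ).lookup (T.simSubst Φ.erase σ Γ₀.erase)) ∧
    (∀ e T k, TmOk k (Γ₁ ++ Γ₀).lookup e T →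
      ∃ k', TmOk k' (Γ₁ ++ Φ).lookup (e.simSubst Φ.erase σ Γ₀.erase)
        (T.simSubst Φ.erase σ Γ₀.erase)) ∧
    (∀ σ₂ Ψ k, SubOk k (Γ₁ ++ Γ₀).lookup σ₂ Ψ →
      ∃ k', SubOk k' (Γ₁ ++ Φ).lookup (Subst.simSubst Φ.erase σ Γ₀.erase σ₂)
        (Ψ.simSubst Φ.erase σ Γ₀.erase)) := by
  have hL' := hΦ.lookup_wf
  obtain ⟨⟨f, h1⟩, g, h0⟩ := hΓ.of_append
  rw [← Ctx.lookup_eq] at h0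
  have he : (Γ₀.weaken Φ.erase).erase = Γ₀.erase := by simp [Ctx.weaken]
  have hE := hσ.tenv hL' (ECtx.levelLE_level _)
  -- The intermediate context is `Γ₁, Φ` with the weakened `Γ₀` added. As an appended context it
  -- need not be sorted; as a lookup function it is harmless.
  have hρ := (Ren.wks_ok Γ₁.lookup Φ).lifts h1.lookup_wf
    (by rwa [← Ctx.lookup_append]) (h0.sc h1.lookup_wf)
  rw [← Ctx.lookup_append, ← Ctx.lookup_append] at hρ
  have := hρ.subst hE hΓ.lookup_wf (hL'.conss (hw.sc hL')) hL'
  rwa [← he, ← Ctx.erase_sh, (hσ.sc hL').env_precomp, Ctx.erase_sh, he] at this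

end Moebius

theorem mainTheorem2 (Γ₁ Φ Γ₀ : Moebius.Ctx) (σ : Moebius.Subst)
    (hσ : Moebius.WfSubst (Γ₁ ++ Φ) σ (Γ₀.weaken Φ.erase)) :
    (∀ Ψ : Moebius.Ctx, Moebius.ECtx.Above Φ.erase Ψ.erase →
      Moebius.WfCtx (Γ₁ ++ Γ₀ ++ Ψ) →
      Moebius.WfCtx (Γ₁ ++ Φ ++ Ψ.simSubst Φ.erase σ Γ₀.erase)) ∧
    (∀ S : Moebius.Ty, Moebius.WfTy (Γ₁ ++ Γ₀) S →
      Moebius.WfTy (Γ₁ ++ Φ) (S.simSubst Φ.erase σ Γ₀.erase)) ∧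
    (∀ (e : Moebius.Tm) (S : Moebius.Ty), Moebius.WfTm (Γ₁ ++ Γ₀) e S →
      Moebius.WfTm (Γ₁ ++ Φ) (e.simSubst Φ.erase σ Γ₀.erase)
        (S.simSubst Φ.erase σ Γ₀.erase)) ∧
    (∀ (σ₂ : Moebius.Subst) (Ψ : Moebius.Ctx), Moebius.WfSubst (Γ₁ ++ Γ₀) σ₂ Ψ →
      Moebius.WfSubst (Γ₁ ++ Φ) (Moebius.Subst.simSubst Φ.erase σ Γ₀.erase σ₂)
        (Ψ.simSubst Φ.erase σ Γ₀.erase)) := by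
  obtain ⟨⟨a, hΦ⟩, ⟨b, hw⟩, c, hs⟩ := hσ.ok
  refine ⟨fun Ψ hΨ h => ?_, fun S h => ?_, fun e S h => ?_, fun σ₂ Ψ h => ?_⟩
  · obtain ⟨k, h⟩ := h.ok
    have hsort := h.sorted
    rw [Moebius.Ctx.erase_append, Moebius.Ctx.erase_append] at hsort
    obtain ⟨⟨d, hΓ⟩, m, h⟩ := h.of_append
    rw [← Moebius.Ctx.lookup_eq] at h
    obtain ⟨k', h'⟩ := (hs.simSubst hΦ hw hΓ).1 _ _ h
    rw [Moebius.Ctx.lookup_eq] at h'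
    obtain ⟨l, -, h'⟩ := hΦ.append h' fun p hp q hq => by
      rw [Moebius.Ctx.erase_append, List.mem_append] at hp
      rw [Moebius.Ctx.simSubst, Moebius.Ctx.erase_subst] at hq
      -- Sortedness of the result: `Φ` lies above the new block by hypothesis, `Γ₁` because the
      -- given context was sorted, and substitution changes no levels.
      rcases hp with hp | hp
      · exact hΨ p hp q hq
      · exact (List.pairwise_append.1 hsort).2.2 q hq p (List.mem_append.2 (.inr hp))
    exact h'.wf
  · obtain ⟨⟨d, hΓ⟩, k, h⟩ := h.ok
    obtain ⟨k', h'⟩ := (hs.simSubst hΦ hw hΓ).2.1 _ _ h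
    exact h'.wf hΦ
  · obtain ⟨⟨d, hΓ⟩, k, h⟩ := h.ok
    obtain ⟨k', h'⟩ := (hs.simSubst hΦ hw hΓ).2.2.1 _ _ _ h
    exact h'.wf hΦ
  · obtain ⟨⟨d, hΓ⟩, -, k, h⟩ := h.ok
    obtain ⟨k', h'⟩ := (hs.simSubst hΦ hw hΓ).2.2.2 _ _ _ h
    exact h'.wf hΦ
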